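/- **Notation.** Let $A\in\mathbb C$ with $0<|A|<1$, $[n]=\frac{A^{2n}-A^{-2n}}{A^2-A^{-2}}$, $[n]!=\prod_{j=1}^n[j]$. Let $\sqrt{[n]}$ be the holomorphic square root of $[n]$ on $\{0<|A|<1\}$ that tends to $\sqrt n$ as $A\to1$, and $\sqrt{[n]!}=\prod_{j=1}^n\sqrt{[j]}$. A triple $(a,b,c)$ of elements of $\frac12\mathbb N$ is admissible if it satisfies the three weak triangle inequalities and $a+b+c\in\mathbb N$. Put $$\Delta(a,b,c)=\frac{\sqrt{[a+b-c]!}\,\sqrt{[b+c-a]!}\,\sqrt{[c+a-b]!}}{\sqrt{[a+b+c+1]!}} .$$ The unitary quantum $6j$-symbol is $$T\begin{pmatrix}a&b&c\\ d&e&f\end{pmatrix}=\mathbf i^{2(a+b+c+d+e+f)}\Delta(a,b,c)\Delta(a,e,f)\Delta(d,b,f)\Delta(d,e,c)\sum_{k=\max T_i}^{\min Q_j}\frac{(-1)^k[k+1]!}{\prod_{i=1}^4[k-T_i]!\,\prod_{j=1}^3[Q_j-k]!}$$ with $T_1=a+b+c$, $T_2=a+e+f$, $T_3=d+b+f$, $T_4=d+e+c$,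 $Q_1=a+b+d+e$, $Q_2=a+c+d+f$, $Q_3=b+c+e+f$, if $(a,b,c),(a,e,f),(d,b,f),(d,e,c)$ are admissible, and $T=0$ otherwise. Let $\Gamma\subset S^2$ be a finite connected planar trivalent graph (for example the $1$-skeleton of a convex polyhedron with trivalent vertices). A coloring $c$ of its edges by half-integers is admissible if the colors at every vertex form an admissible triple. Fix a region $r_0$ of $S^2\setminus\Gamma$. The unitary Kauffman bracket is $$\langle\Gamma,c\rangle^{\mathrm U}=\sum_s\ \prod_{r}(-1)^{2s(r)}[2s(r)+1]\ \prod_{v}T\begin{pmatrix}c_1&c_2&c_3\\ s_1&s_2&s_3\end{pmatrix},$$ where $r$ runs over the regions, $v$ over the vertices, and $s$ over the maps from the set of regions to $\frac12\mathbb N$ such that $s(r_0)=0$ and such that the values of $s$ on the two sides of any edge form an admissible triple with the color of the edge; at a vertex with edges $e_1',e_2',e_3'$ of colors $c_1,c_2,c_3$, $s_i$ is the value of $s$ on the region in the corner between the two edges other than $e_i'$. (If $c$ is not admissible, the bracket is $0$.) Let $e_0,\dots,e_{p-1},e_p=e_0$ be the consecutive edges around a face, $a_j=c(e_j)$, and let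 $b_j$ be the color of the third edge at the vertex common to $e_j$ and $e_{j+1}$. For a perturbation $\delta$ with values $\pm\frac12$ on $e_0,\dots,e_{p-1}$ and $0$ elsewhere put $a_j'=a_j+\delta(e_j)$, $$\mathbb V(j)=\left.T\begin{pmatrix}a_j&a_{j+1}&b_j\\ a_{j+1}'&a_j'&\frac12\end{pmatrix}\right/ T\begin{pmatrix}a_j'&a_{j+1}'&b_j\\ a_{j+1}'&a_j'&0\end{pmatrix}$$ (and $\mathbb V(j)=0$ if $(a'_j,a'_{j+1},b_j)$ is not admissible), $k(c,\delta)=\prod_{i=0}^{p-2}\mathbb V(i)$ and $Z(c,\delta(e_0),\delta(e_{p-1}))=\mathbb V(p-1)$. **Corollary (Gordon–Schulten recursion).** Let $e_0,e_1,e_2$ be the edges of a triangular face of $\Gamma$, let $1_i$ be the edge coloring that is $1$ on $e_i$ and $0$ on all other edges, and $\delta_\pm=\frac12(1_0\pm1_1+1_2)$. Then for every admissible coloring $c$ of $\Gamma$, and every choice of $r_0$, the denominators $Z(c+\delta_\pm,-\frac12,-\frac12)$ are nonzero and $$\sum_\pm\frac{k(c,\delta_\pm)\,k(c+\delta_\pm,-\delta_\mp)}{Z(c+\delta_\pm,-\frac12,-\frac12)}\langle\Gamma,c\pm1_1\rangle^{\mathrm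 U}=\left(Z\left(c,\tfrac12,\tfrac12\right)-\sum_\pm\frac{k(c,\delta_\pm)\,k(c+\delta_\pm,-\delta_\pm)}{Z(c+\delta_\pm,-\frac12,-\frac12)}\right)\langle\Gamma,c\rangle^{\mathrm U}.$$ Moreover, if $\Gamma$ is the planar tetrahedron with edge colors $a,b,c$ at one vertex and $d,e,f$ on the respectively opposite edges, then $\langle\Gamma,c\rangle^{\mathrm U}=T\begin{pmatrix}a&b&c\\ d&e&f\end{pmatrix}$. Hence, for all half-integers such that $(a_0,a_1,b_0),(a_1,a_2,b_1),(a_2,a_0,b_2),(b_0,b_1,b_2)$ are admissible, the recursion above, with the coefficients computed from these $a_i,b_i$, is a three-term recursion in $a_1$ for the quantum $6j$-symbols $$T\begin{pmatrix}a_0&a_1\pm1&b_0\\ b_1&b_2&a_2\end{pmatrix},\qquad T\begin{pmatrix}a_0&a_1&b_0\\ b_1&b_2&a_2\end{pmatrix}.$$ -/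

import Mathlib

/-!
Unitary Kauffman brackets of planar trivalent graphs.

Half-integers (colors, shadow-states, perturbations) are stored through their doubles: the integer `a`
stands for the half-integer `a / 2`.  So the color `1/2` is `1`, and the perturbation `1_i` of the
color of one edge by one unit has the value `2` on that edge.
-/

namespace SpinNetwork

noncomputable section

/-! ### Quantum integers, 6j-symbols -/

/-- The quantum integer `[n] = (A^(2n) - A^(-2n)) / (A^2 - A^(-2))`. -/
def qInt (A : ℂ) (n : ℤ) : ℂ :=
  (A ^ (2 * n) - A ^ (-2 * n)) / (A ^ (2 : ℤ) - A ^ (-2 : ℤ))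

/-- `[n]! = ∏_{j=1}^n [j]`. -/
def qFact (A : ℂ) (n : ℕ) : ℂ :=
  ∏ j ∈ Finset.range n, qInt A (j + 1)

/-- The branch of `√[n]` on the punctured unit disc which tends to `√n` as `A` tends to `1`.  One has
`[n] = A^(2-2n) ∑_{i<n} A^(4i)`; for `‖A‖ < 1` the sum `(1 - A^(4n)) / (1 - A^4)` avoids the
half-line of non-positive reals, so the principal root of it is holomorphic there. -/
def sqrtQInt (A : ℂ) (n : ℕ) : ℂ :=
  A ^ (1 - (n : ℤ)) * (∑ i ∈ Finset.range n, A ^ (4 * i)) ^ (1 / 2 : ℂ)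

/-- `√([n]!) = ∏_{j=1}^n √[j]`. -/
def sqrtQFact (A : ℂ) (n : ℕ) : ℂ :=
  ∏ j ∈ Finset.range n, sqrtQInt A (j + 1)

/-- Admissible triples of colors (given by their doubles): the triangle inequalities hold and the
sum of the three colors is an integer.  The triangle inequalities force the colors to be
nonnegative. -/
def AdmTriple (a b c : ℤ) : Prop :=
  c ≤ a + b ∧ a ≤ b + c ∧ b ≤ c + a ∧ Even (a + b + c)

/-- `Δ(a,b,c) = √([a+b-c]! [b+c-a]! [c+a-b]! / [a+b+c+1]!)`. -/
def triDelta (A : ℂ) (a b c : ℤ) : ℂ :=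
  sqrtQFact A ((a + b - c) / 2).toNat * sqrtQFact A ((b + c - a) / 2).toNat *
    sqrtQFact A ((c + a - b) / 2).toNat / sqrtQFact A ((a + b + c) / 2 + 1).toNat

/-- The unitary (symmetric) quantum `6j`-symbol: the value of the planar tetrahedron with edge colors
`a, b, c, d, e, f`, in which `(a,b,c)`, `(a,e,f)`, `(d,b,f)`, `(d,e,c)` are the triples of colors of the
edges that meet at a vertex.  As usual it is `0` if one of these triples is not admissible. -/
def tet (A : ℂ) (a b c d e f : ℤ) : ℂ :=
  open scoped Classical in
  let T₁ := (a + b + c) / 2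
  let T₂ := (a + e + f) / 2
  let T₃ := (d + b + f) / 2
  let T₄ := (d + e + c) / 2
  let Q₁ := (a + b + d + e) / 2
  let Q₂ := (a + c + d + f) / 2
  let Q₃ := (b + c + e + f) / 2
  if AdmTriple a b c ∧ AdmTriple a e f ∧ AdmTriple d b f ∧ AdmTriple d e c then
    Complex.I ^ (a + b + c + d + e + f).toNat *
      (triDelta A a b c * triDelta A a e f * triDelta A d b f * triDelta A d e c) *
      ∑ k ∈ Finset.Icc (max (max T₁ T₂) (max T₃ T₄)) (min Q₁ (min Q₂ Q₃)),
        (-1) ^ k.toNat * (qFact A (k + 1).toNat /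
          (qFact A (k - T₁).toNat * qFact A (k - T₂).toNat * qFact A (k - T₃).toNat *
            qFact A (k - T₄).toNat * qFact A (Q₁ - k).toNat * qFact A (Q₂ - k).toNat *
            qFact A (Q₃ - k).toNat * qFact A 1))
  else 0

/-- The quotient of tetrahedra `𝕍` from which the coefficients of the recursions are built: `a`, `a₁`
are the colors of two consecutive sides of a face, `b` is the color of the third edge at their common
vertex, and `a'`, `a₁'` are the perturbed colors of the two sides.  The denominator is nonzero on the
punctured unit disc when `(a', a₁', b)` is admissible; otherwise numerator and denominator are both `0`
by the convention for `tet`, and the quotient is `0`. -/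
def vQuot (A : ℂ) (a a₁ b a' a₁' : ℤ) : ℂ :=
  tet A a a₁ b a₁' a' 1 / tet A a' a₁' b a₁' a' 0

/-! ### Trivalent graphs on the sphere -/

/-- A finite trivalent graph on an oriented surface, as a rotation system.  The darts (oriented edges)
starting at the vertex `v` are `(v, 0)`, `(v, 1)`, `(v, 2)`, in counterclockwise order, and `opp` reverses
the orientation of a dart. -/
structure TrivalentMap (V : Type*) where
  opp : Equiv.Perm (V × Fin 3)
  opp_opp : ∀ d, opp (opp d) = d
  opp_ne : ∀ d, opp d ≠ d

namespace TrivalentMap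

variable {V : Type*}

/-- Turn a dart counterclockwise around its starting point: `(v, i) ↦ (v, i + 1)`. -/
def rot (_Γ : TrivalentMap V) : Equiv.Perm (V × Fin 3) :=
  Equiv.prodCongr (Equiv.refl V) (Equiv.addRight 1)

/-- The next dart along the boundary of the region to the left of a dart. -/
def next (Γ : TrivalentMap V) : Equiv.Perm (V × Fin 3) :=
  Γ.opp.trans Γ.rot.symm

/-- Edges: darts up to reversal. -/
def Edge (Γ : TrivalentMap V) : Type _ :=
  Quotient (Equiv.Perm.SameCycle.setoid Γ.opp)

/-- Regions of the complement of the graph: orbits of darts under `next`. -/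
def Region (Γ : TrivalentMap V) : Type _ :=
  Quotient (Equiv.Perm.SameCycle.setoid Γ.next)

/-- The edge underlying a dart. -/
def edge (Γ : TrivalentMap V) (d : V × Fin 3) : Γ.Edge :=
  Quotient.mk _ d

/-- The region to the left of a dart.  It has the corner between `d` and `rot d`. -/
def region (Γ : TrivalentMap V) (d : V × Fin 3) : Γ.Region :=
  Quotient.mk _ d

instance (Γ : TrivalentMap V) [Finite V] : Finite Γ.Region :=
  inferInstanceAs (Finite (Quotient _))

instance (Γ : TrivalentMap V) [Finite V] : Fintype Γ.Region :=
  Fintype.ofFinite _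

/-- The graph is connected. -/
def Connected (Γ : TrivalentMap V) : Prop :=
  ∀ d d' : V × Fin 3, ∃ g ∈ Subgroup.closure {Γ.rot, Γ.opp}, g d = d'

/-- A connected trivalent graph cellularly embedded in the sphere `S²`, by Euler's formula. -/
structure Planar (Γ : TrivalentMap V) : Prop where
  connected : Γ.Connected
  euler : (Nat.card V : ℤ) - Nat.card Γ.Edge + Nat.card Γ.Region = 2

/-! ### Colorings, shadow-states, Kauffman brackets -/

/-- Admissible colorings (the color of the edge `e` is `c e / 2`). -/
def Admissible (Γ : TrivalentMap V) (c : Γ.Edge → ℤ) : Prop :=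
  ∀ v : V, AdmTriple (c (Γ.edge (v, 0))) (c (Γ.edge (v, 1))) (c (Γ.edge (v, 2)))

/-- Shadow-states (the value on the region `r` is `s r / 2`): the value on `r₀` is `0`, and the values
on the two sides of an edge form an admissible triple with the color of the edge. -/
def IsShadowState (Γ : TrivalentMap V) (c : Γ.Edge → ℤ) (r₀ : Γ.Region) (s : Γ.Region → ℤ) : Prop :=
  s r₀ = 0 ∧ ∀ d, AdmTriple (s (Γ.region d)) (s (Γ.region (Γ.opp d))) (c (Γ.edge d))

/-- The weight of a shadow-state: a factor `(-1)^(2u) [2u+1]` for each region with state `u` (all regions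
are discs), and a tetrahedron for each vertex, in which the state of a region at the vertex is opposite
to the color of the edge that is not on the boundary of the corner of this region. -/
def weight (Γ : TrivalentMap V) [Fintype V] (A : ℂ) (c : Γ.Edge → ℤ) (s : Γ.Region → ℤ) : ℂ :=
  (∏ r : Γ.Region, (-1) ^ (s r).toNat * qInt A (s r + 1)) *
    ∏ v : V, tet A (c (Γ.edge (v, 0))) (c (Γ.edge (v, 1))) (c (Γ.edge (v, 2)))
      (s (Γ.region (v, 1))) (s (Γ.region (v, 2))) (s (Γ.region (v, 0)))

/-- The unitary Kauffman bracket `⟨Γ, c⟩ᵁ` of a planar graph at the point `A` of the punctured unit disc,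
by the shadow-state formula with `r₀` as unbounded region.  The sum is finite for connected graphs
(`finite_shadowStates`), and it is `0` if `c` is not admissible. -/
def bracket (Γ : TrivalentMap V) [Fintype V] (A : ℂ) (r₀ : Γ.Region) (c : Γ.Edge → ℤ) : ℂ :=
  ∑ᶠ s ∈ {s : Γ.Region → ℤ | Γ.IsShadowState c r₀ s}, Γ.weight A c s

/-! ### The coefficients of the circle recursions around a face -/

/-- The number of sides of the face to the left of the dart `x`. -/
def faceLength (Γ : TrivalentMap V) (x : V × Fin 3) : ℕ :=
  Function.minimalPeriod Γ.next x

/-- The side `e_j` of the face to the left of `x`, starting at `e_0 = edge x`. -/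
def side (Γ : TrivalentMap V) (x : V × Fin 3) (j : ℕ) : Γ.Edge :=
  Γ.edge ((Γ.next ^ j) x)

/-- The third edge at the vertex shared by `e_j` and `e_{j+1}`; its color is denoted `b_j`. -/
def spoke (Γ : TrivalentMap V) (x : V × Fin 3) (j : ℕ) : Γ.Edge :=
  Γ.edge (Γ.rot (Γ.opp ((Γ.next ^ j) x)))

/-- The coefficient `k(c,δ) = ∏_{i=0}^{p-2} 𝕍(i)`, where `p` is the number of sides. -/
def kCoeff (Γ : TrivalentMap V) (A : ℂ) (x : V × Fin 3) (c δ : Γ.Edge → ℤ) : ℂ :=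
  ∏ i ∈ Finset.range (Γ.faceLength x - 1),
    vQuot A (c (Γ.side x i)) (c (Γ.side x (i + 1))) (c (Γ.spoke x i))
      (c (Γ.side x i) + δ (Γ.side x i)) (c (Γ.side x (i + 1)) + δ (Γ.side x (i + 1)))

/-- The coefficient `Z(c, δ(e_0), δ(e_{p-1})) = 𝕍(p-1)`, with `e_p = e_0`; here `s = 2 δ(e_0)` and
`t = 2 δ(e_{p-1})`. -/
def zCoeff (Γ : TrivalentMap V) (A : ℂ) (x : V × Fin 3) (c : Γ.Edge → ℤ) (s t : ℤ) : ℂ :=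
  vQuot A (c (Γ.side x (Γ.faceLength x - 1))) (c (Γ.side x 0)) (c (Γ.spoke x (Γ.faceLength x - 1)))
    (c (Γ.side x (Γ.faceLength x - 1)) + t) (c (Γ.side x 0) + s)

/-- Half of the coloring that is `1` on the edge `e` and `0` on the other edges. -/
def halfAt (Γ : TrivalentMap V) (e : Γ.Edge) : Γ.Edge → ℤ :=
  open scoped Classical in fun f => if f = e then 1 else 0

/-- `δ_ε = (1_0 + ε 1_1 + 1_2) / 2` for `ε = 1` or `ε = -1`. -/
def deltaPert (Γ : TrivalentMap V) (x : V × Fin 3) (ε : ℤ) : Γ.Edge → ℤ :=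
  Γ.halfAt (Γ.side x 0) + ε • Γ.halfAt (Γ.side x 1) + Γ.halfAt (Γ.side x 2)

/-! ### The sum over shadow-states is finite -/

theorem region_next (Γ : TrivalentMap V) (d : V × Fin 3) :
    Γ.region (Γ.next d) = Γ.region d :=
  Quotient.sound (Equiv.Perm.sameCycle_apply_left.2 (Equiv.Perm.SameCycle.refl _ _))

theorem finite_shadowStates (Γ : TrivalentMap V) [Finite V] (hΓ : Γ.Connected)
    (c : Γ.Edge → ℤ) (r₀ : Γ.Region) :
    {s : Γ.Region → ℤ | Γ.IsShadowState c r₀ s}.Finite := by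
  have key : ∀ g ∈ Subgroup.closure {Γ.rot, Γ.opp}, ∀ d : V × Fin 3,
      ∃ N : ℤ, ∀ s, Γ.IsShadowState c r₀ s → s (Γ.region (g d)) ≤ s (Γ.region d) + N := by
    have hopp : ∀ d, ∀ s, Γ.IsShadowState c r₀ s →
        s (Γ.region (Γ.opp d)) ≤ s (Γ.region d) + c (Γ.edge d) := by
      intro d s hs
      have h := (hs.2 d).2.2.1
      linarith
    have hrot : ∀ d, Γ.region (Γ.rot.symm d) = Γ.region (Γ.opp d) := by
      intro d
      rw [← Γ.region_next (Γ.opp d)]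
      simp [next, Γ.opp_opp]
    intro g hg
    induction hg using Subgroup.closure_induction'' with
    | mem g hg =>
      rintro d
      rcases hg with rfl | rfl
      · refine ⟨c (Γ.edge (Γ.opp (Γ.rot d))), fun s hs => ?_⟩
        have h1 := hopp (Γ.opp (Γ.rot d)) s hs
        have h2 := hrot (Γ.rot d)
        rw [Equiv.symm_apply_apply] at h2
        rw [Γ.opp_opp, ← h2] at h1
        exact h1
      · exact ⟨_, fun s hs => hopp d s hs⟩
    | inv_mem g hg =>
      rintro d
      rcases hg with rfl | rfl
      · refine ⟨c (Γ.edge d), fun s hs => ?_⟩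
        have h1 := hopp d s hs
        rw [← hrot d] at h1
        exact h1
      · refine ⟨c (Γ.edge d), fun s hs => ?_⟩
        have h1 := hopp d s hs
        have h2 : Γ.opp⁻¹ d = Γ.opp d := by
          rw [Equiv.Perm.inv_eq_iff_eq, Γ.opp_opp]
        rw [h2]
        exact h1
    | one => exact fun d => ⟨0, fun s _ => by simp⟩
    | mul g h _ _ hg hh =>
      intro d
      obtain ⟨N, hN⟩ := hh d
      obtain ⟨M, hM⟩ := hg (h d)
      refine ⟨N + M, fun s hs => ?_⟩
      have h1 := hN s hs
      have h2 := hM s hs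
      rw [Equiv.Perm.mul_apply]
      linarith
  obtain ⟨d₀, rfl⟩ : ∃ d₀, Γ.region d₀ = r₀ := Quotient.exists_rep r₀
  have bound : ∀ r : Γ.Region, ∃ N : ℤ, ∀ s, Γ.IsShadowState c (Γ.region d₀) s → s r ≤ N := by
    intro r
    obtain ⟨d, rfl⟩ : ∃ d, Γ.region d = r := Quotient.exists_rep r
    obtain ⟨g, hg, rfl⟩ := hΓ d₀ d
    obtain ⟨N, hN⟩ := key g hg d₀
    refine ⟨N, fun s hs => ?_⟩
    have h1 := hN s hs
    rw [hs.1] at h1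
    linarith
  choose N hN using bound
  refine (Set.Finite.pi' (t := fun r => Set.Icc (0 : ℤ) (N r)) fun r => Set.finite_Icc _ _).subset ?_
  intro s hs r
  refine ⟨?_, hN r s hs⟩
  obtain ⟨d, rfl⟩ : ∃ d, Γ.region d = r := Quotient.exists_rep r
  have h1 := (hs.2 d).1
  have h2 := (hs.2 d).2.2.1
  have h3 := (hs.2 d).2.1
  linarith

end TrivalentMap

/-! ### The tetrahedron -/

/-- Reversal of darts in the planar tetrahedron with central vertex `0` and outer vertices `1`, `2`, `3`,
in counterclockwise order.  The darts at `0` go to `1`, `2`, `3`; the darts at `1` go to `0`, `3`, `2`;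
those at `2` go to `0`, `1`, `3`; and those at `3` go to `0`, `2`, `1`. -/
def tetOpp : Fin 4 × Fin 3 → Fin 4 × Fin 3
  | (0, 0) => (1, 0)
  | (0, 1) => (2, 0)
  | (0, 2) => (3, 0)
  | (1, 0) => (0, 0)
  | (1, 1) => (3, 2)
  | (1, 2) => (2, 1)
  | (2, 0) => (0, 1)
  | (2, 1) => (1, 2)
  | (2, 2) => (3, 1)
  | (3, 0) => (0, 2)
  | (3, 1) => (2, 2)
  | (3, 2) => (1, 1)

/-- The tetrahedron as a planar graph. -/
def tetrahedron : TrivalentMap (Fin 4) where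
  opp := Function.Involutive.toPerm tetOpp (by unfold Function.Involutive; decide)
  opp_opp := by decide
  opp_ne := by decide

theorem card_orbits {α : Type*} [Finite α] (p : Equiv.Perm α) (n : ℕ) (f : α → Fin n)
    (hp : ∀ a, f (p a) = f a) (hf : ∀ i, ∃ a, f a = i)
    (h : ∀ a b, f a = f b → ∃ k : Fin 3, (p ^ (k : ℕ)) a = b) :
    Nat.card (Quotient (Equiv.Perm.SameCycle.setoid p)) = n := by
  have hinv : ∀ (k : ℕ) (a), f ((p ^ k) a) = f a := by
    intro k
    induction k with
    | zero => intro a; rfl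
    | succ k ih => intro a; rw [pow_succ, Equiv.Perm.mul_apply, ih, hp]
  let F : Quotient (Equiv.Perm.SameCycle.setoid p) → Fin n := Quotient.lift f (by
    intro a b hab
    obtain ⟨k, hk⟩ := Equiv.Perm.SameCycle.exists_nat_pow_eq hab
    rw [← hk, hinv])
  have hF : Function.Bijective F := by
    constructor
    · rintro ⟨a⟩ ⟨b⟩ hab
      obtain ⟨k, hk⟩ := h a b hab
      exact Quotient.sound ⟨(k : ℕ), by simpa using hk⟩
    · intro i
      obtain ⟨a, ha⟩ := hf i
      exact ⟨Quotient.mk _ a, ha⟩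
  rw [Nat.card_congr (Equiv.ofBijective F hF), Nat.card_fin]

theorem tetrahedron_planar : tetrahedron.Planar := by
  constructor
  · have hr : ∀ d, (∃ g ∈ Subgroup.closure {tetrahedron.rot, tetrahedron.opp}, g (0, 0) = d) →
        ∃ g ∈ Subgroup.closure {tetrahedron.rot, tetrahedron.opp}, g (0, 0) = tetrahedron.rot d := by
      rintro d ⟨g, hg, rfl⟩
      exact ⟨tetrahedron.rot * g, mul_mem (Subgroup.subset_closure (by simp)) hg, rfl⟩
    have ho : ∀ d, (∃ g ∈ Subgroup.closure {tetrahedron.rot, tetrahedron.opp}, g (0, 0) = d) →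
        ∃ g ∈ Subgroup.closure {tetrahedron.rot, tetrahedron.opp}, g (0, 0) = tetrahedron.opp d := by
      rintro d ⟨g, hg, rfl⟩
      exact ⟨tetrahedron.opp * g, mul_mem (Subgroup.subset_closure (by simp)) hg, rfl⟩
    have h00 : ∃ g ∈ Subgroup.closure {tetrahedron.rot, tetrahedron.opp},
        g ((0, 0) : Fin 4 × Fin 3) = (0, 0) := ⟨1, one_mem _, rfl⟩
    have h01 := hr _ h00
    have h02 := hr _ h01
    have h10 := ho _ h00
    have h20 := ho _ h01
    have h30 := ho _ h02
    have all : ∀ d, ∃ g ∈ Subgroup.closure {tetrahedron.rot, tetrahedron.opp}, g (0, 0) = d := by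
      rintro ⟨v, i⟩
      fin_cases v <;> fin_cases i
      · exact h00
      · exact h01
      · exact h02
      · exact h10
      · exact hr _ h10
      · exact hr _ (hr _ h10)
      · exact h20
      · exact hr _ h20
      · exact hr _ (hr _ h20)
      · exact h30
      · exact hr _ h30
      · exact hr _ (hr _ h30)
    intro d d'
    obtain ⟨g, hg, rfl⟩ := all d
    obtain ⟨g', hg', rfl⟩ := all d'
    exact ⟨g' * g⁻¹, mul_mem hg' (inv_mem hg), by simp⟩
  · have hE : Nat.card tetrahedron.Edge = 6 :=
      card_orbits tetrahedron.opp 6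
        (fun d => (![![0, 1, 2], ![0, 4, 5], ![1, 5, 3], ![2, 3, 4]] : Fin 4 → Fin 3 → Fin 6) d.1 d.2)
        (by decide) (by decide) (by decide)
    have hR : Nat.card tetrahedron.Region = 4 :=
      card_orbits tetrahedron.next 4
        (fun d => (![![3, 1, 2], ![2, 0, 3], ![3, 0, 1], ![1, 0, 2]] : Fin 4 → Fin 3 → Fin 4) d.1 d.2)
        (by decide) (by decide) (by decide)
    rw [hE, hR]
    simp

/-! ### The coefficients for a tetrahedron -/

/-- The coefficient `k` for a triangular face of a tetrahedron whose sides `e_0, e_1, e_2` have the colors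
`u, v, w`, the perturbation being `(s, t, s)`; the third edges at `e_0 ∩ e_1` and `e_1 ∩ e_2` have the
colors `b₀`, `b₁`. -/
def tetK (A : ℂ) (b₀ b₁ u v w s t : ℤ) : ℂ :=
  vQuot A u v b₀ (u + s) (v + t) * vQuot A v w b₁ (v + t) (w + s)

/-- The coefficient `Z` for the same face, where `b₂` is the color of the third edge at `e_2 ∩ e_0`. -/
def tetZ (A : ℂ) (b₂ u w s : ℤ) : ℂ :=
  vQuot A w u b₂ (w + s) (u + s)

end

end SpinNetwork

/-! The recursion comes from fusing a circle of color `1/2` with the sides of a face, carried out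
algebraically. Two identities for 6j-symbols with an entry `1/2` do the work: the Biedenharn–Elliott
identity (`pentagon`), which slides the circle past a vertex, and `orthogonality`, which slides it
past an edge. Symbols with an entry `1/2` or `0` are given by a single term, so orthogonality
reduces to `[a+c][b+c] = [c][a+b+c] + [a][b]`, and the pentagon to contiguity relations between
Racah sums, proved by telescoping.

Applied at the three corners of a triangular face, the pentagon gives a first-order `CircleRelation`
for the sum over the state of the face (`circleRelation_triangleSum`); summation over the outer
states gives it for the bracket (`circleRelation_bracket`), provided that the face is not the region
`r₀`. In this relation the new colors of `e_0` and `e_2` are prescribed and that of `e_1` is summed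
over. Raising `e_0`, `e_2` by `1/2` and lowering them again eliminates the intermediate colorings
and leaves three terms (`CircleRelation.three_term`). The denominators are nonzero because they are
evaluated in closed form.

If `r₀` is the face itself, another region can take its role (`exists_bracket_eq`). A disc
neighborhood of a spanning tree has legs that are glued back in pairs. Euler's formula guarantees
that two neighboring legs can always be glued so as to enclose exactly one new region, until two
legs of one color remain. At every stage the disc is compatible with pushing a `1/2`-circle across
it, and a two-legged disc with this property takes one value on all admissible states. So the
regions on the two sides of the last edge give the same bracket.

For the tetrahedron there is only one candidate state. Three vertices contribute symbols with an
entry `0`, which cancel the weights of the regions, and the fourth contributes the 6j-symbol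
(`tetrahedron_bracket`). The recursion for 6j-symbols needs no graph: the pentagon is already a
circle relation for them (`circleRelation_tet`). -/

namespace SpinNetwork

noncomputable section

/-! ### Quantum integers and factorials -/

section quantum

variable {A : ℂ}

theorem pow_ne_one_of_norm_lt (hA₁ : ‖A‖ < 1) {n : ℕ} (hn : n ≠ 0) : A ^ n ≠ 1 := by
  intro h
  have h1 : ‖A‖ ^ n = 1 := by rw [← norm_pow, h, norm_one]
  exact (pow_lt_one₀ (norm_nonneg A) hA₁ hn).ne h1

theorem zpow_sub_zpow_neg_ne_zero (hA₀ : A ≠ 0) (hA₁ : ‖A‖ < 1) {n : ℕ} (hn : n ≠ 0) :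
    A ^ (2 * (n : ℤ)) - A ^ (-2 * (n : ℤ)) ≠ 0 := by
  intro h
  rw [sub_eq_zero] at h
  have h1 : A ^ (4 * n) = 1 := by
    have h2 : A ^ ((4 * n : ℕ) : ℤ) = A ^ (2 * (n : ℤ)) * A ^ (2 * (n : ℤ)) := by
      rw [← zpow_add₀ hA₀]; congr 1; push_cast; ring
    rw [← zpow_natCast, h2]
    nth_rewrite 1 [h]
    rw [← zpow_add₀ hA₀]
    simp
  exact pow_ne_one_of_norm_lt hA₁ (by omega) h1

theorem zpow_two_sub_ne_zero (hA₀ : A ≠ 0) (hA₁ : ‖A‖ < 1) :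
    A ^ (2 : ℤ) - A ^ (-2 : ℤ) ≠ 0 := by
  simpa using zpow_sub_zpow_neg_ne_zero hA₀ hA₁ one_ne_zero

@[simp] theorem qInt_zero : qInt A 0 = 0 := by simp [qInt]

theorem qInt_one (hA₀ : A ≠ 0) (hA₁ : ‖A‖ < 1) : qInt A 1 = 1 := by
  have := zpow_two_sub_ne_zero hA₀ hA₁
  rw [qInt]
  simpa using div_self this

theorem qInt_neg (n : ℤ) : qInt A (-n) = -qInt A n := by
  rw [qInt, qInt, ← neg_div]
  congr 1
  rw [show 2 * -n = -2 * n by ring, show -2 * -n = 2 * n by ring]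
  ring

theorem qInt_natCast_ne_zero (hA₀ : A ≠ 0) (hA₁ : ‖A‖ < 1) {n : ℕ} (hn : n ≠ 0) :
    qInt A n ≠ 0 :=
  div_ne_zero (zpow_sub_zpow_neg_ne_zero hA₀ hA₁ hn) (zpow_two_sub_ne_zero hA₀ hA₁)

theorem qInt_ne_zero (hA₀ : A ≠ 0) (hA₁ : ‖A‖ < 1) {n : ℤ} (hn : 0 < n) : qInt A n ≠ 0 := by
  lift n to ℕ using hn.le
  exact qInt_natCast_ne_zero hA₀ hA₁ (by omega)

/-- The q-analogue of `(a+c)(b+c) = c(a+b+c) + ab`. It is the only quadratic relation between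
quantum integers on which the contiguity relations and orthogonality depend. -/
theorem qInt_mul_qInt (hA₀ : A ≠ 0) (a b c : ℤ) :
    qInt A (a + c) * qInt A (b + c) = qInt A c * qInt A (a + b + c) + qInt A a * qInt A b := by
  simp only [qInt, div_mul_div_comm, ← add_div]
  congr 1
  simp only [mul_add, zpow_add₀ hA₀, neg_mul, zpow_neg]
  have ha : A ^ (2 * a) ≠ 0 := zpow_ne_zero _ hA₀
  have hb : A ^ (2 * b) ≠ 0 := zpow_ne_zero _ hA₀
  have hc : A ^ (2 * c) ≠ 0 := zpow_ne_zero _ hA₀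
  field_simp
  ring

theorem qFact_zero : qFact A 0 = 1 := by simp [qFact]

theorem qFact_one (hA₀ : A ≠ 0) (hA₁ : ‖A‖ < 1) : qFact A 1 = 1 := by
  simp [qFact, qInt_one hA₀ hA₁]

theorem qFact_succ (n : ℕ) : qFact A (n + 1) = qInt A (n + 1) * qFact A n := by
  rw [qFact, Finset.prod_range_succ, mul_comm, qFact]

theorem qFact_ne_zero (hA₀ : A ≠ 0) (hA₁ : ‖A‖ < 1) (n : ℕ) : qFact A n ≠ 0 :=
  Finset.prod_ne_zero_iff.2 fun j _ => by
    exact_mod_cast qInt_natCast_ne_zero hA₀ hA₁ (Nat.succ_ne_zero j)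

/-- The geometric sum turns the radicand into `A^(2n-2) [n]`. No other property of the chosen branch
enters the proof. -/
theorem sqrtQInt_sq (hA₀ : A ≠ 0) (hA₁ : ‖A‖ < 1) (n : ℕ) :
    sqrtQInt A n ^ 2 = qInt A n := by
  have h4 : A ^ 4 ≠ 1 := pow_ne_one_of_norm_lt hA₁ (by norm_num)
  have hs : ∑ i ∈ Finset.range n, A ^ (4 * i) = (A ^ (4 * n) - 1) / (A ^ 4 - 1) := by
    simp only [pow_mul]
    exact geom_sum_eq h4 n
  rw [sqrtQInt, mul_pow, ← Complex.cpow_nat_mul]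
  norm_num
  rw [hs, qInt, ← zpow_natCast, ← zpow_mul]
  have h4' : A ^ 4 - 1 ≠ 0 := sub_ne_zero.2 h4
  have h2 := zpow_two_sub_ne_zero hA₀ hA₁
  rw [mul_div_assoc', div_eq_div_iff h4' h2]
  have e1 : A ^ ((1 - (n : ℤ)) * ((2 : ℕ) : ℤ)) = A ^ 2 * (A ^ (2 * n))⁻¹ := by
    rw [← zpow_natCast, ← zpow_natCast, ← zpow_neg, ← zpow_add₀ hA₀]
    congr 1; push_cast; ring
  have e2 : A ^ (2 * (n : ℤ)) = A ^ (2 * n) := by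
    rw [← zpow_natCast]; norm_cast
  have e3 : A ^ (-2 * (n : ℤ)) = (A ^ (2 * n))⁻¹ := by
    rw [← zpow_natCast, ← zpow_neg]; push_cast; ring_nf
  have e4 : A ^ (2 : ℤ) = A ^ 2 := by norm_cast
  have e5 : A ^ (-2 : ℤ) = (A ^ 2)⁻¹ := by rw [zpow_neg]; norm_cast
  rw [e1, e2, e3, e4, e5, show 4 * n = 2 * n * 2 by ring, pow_mul A (2 * n) 2]
  have hn : A ^ (2 * n) ≠ 0 := pow_ne_zero _ hA₀
  field_simp

theorem sqrtQInt_ne_zero (hA₀ : A ≠ 0) (hA₁ : ‖A‖ < 1) {n : ℕ} (hn : n ≠ 0) :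
    sqrtQInt A n ≠ 0 := fun h =>
  qInt_natCast_ne_zero hA₀ hA₁ hn (by rw [← sqrtQInt_sq hA₀ hA₁, h]; simp)

theorem sqrtQFact_sq (hA₀ : A ≠ 0) (hA₁ : ‖A‖ < 1) (n : ℕ) :
    sqrtQFact A n ^ 2 = qFact A n := by
  rw [sqrtQFact, qFact, ← Finset.prod_pow]
  exact Finset.prod_congr rfl fun j _ => by rw [sqrtQInt_sq hA₀ hA₁]; push_cast; rfl

theorem sqrtQFact_ne_zero (hA₀ : A ≠ 0) (hA₁ : ‖A‖ < 1) (n : ℕ) : sqrtQFact A n ≠ 0 := fun h =>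
  qFact_ne_zero hA₀ hA₁ n (by rw [← sqrtQFact_sq hA₀ hA₁, h]; simp)

theorem sqrtQFact_succ (n : ℕ) :
    sqrtQFact A (n + 1) = sqrtQInt A (n + 1) * sqrtQFact A n := by
  rw [sqrtQFact, Finset.prod_range_succ, mul_comm, sqrtQFact]

/-- `1 / [n]!`, with the value `0` for negative `n`. -/
def invQFact (A : ℂ) (n : ℤ) : ℂ := if n < 0 then 0 else (qFact A n.toNat)⁻¹

theorem invQFact_of_neg {n : ℤ} (hn : n < 0) : invQFact A n = 0 := if_pos hn

theorem invQFact_natCast (n : ℕ) : invQFact A n = (qFact A n)⁻¹ := by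
  rw [invQFact, if_neg (by omega), Int.toNat_natCast]

theorem invQFact_of_nonneg {n : ℤ} (hn : 0 ≤ n) : invQFact A n = (qFact A n.toNat)⁻¹ :=
  if_neg (by omega)

/-- Since `[0] = 0`, the recursion persists at and below `n = 0`. Summands can therefore be compared
termwise without attention to the range of summation. -/
theorem invQFact_sub_one (hA₀ : A ≠ 0) (hA₁ : ‖A‖ < 1) (n : ℤ) :
    invQFact A (n - 1) = qInt A n * invQFact A n := by
  rcases lt_trichotomy n 0 with h | rfl | h
  · rw [invQFact_of_neg h, invQFact_of_neg (by omega), mul_zero]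
  · rw [qInt_zero, zero_mul, invQFact_of_neg (by omega)]
  · obtain ⟨m, rfl⟩ : ∃ m : ℕ, n = m + 1 := ⟨(n - 1).toNat, by omega⟩
    have h1 : invQFact A ((m : ℤ) + 1) = (qFact A (m + 1))⁻¹ := invQFact_natCast (m + 1)
    have h2 : qInt A ((m : ℤ) + 1) ≠ 0 := qInt_ne_zero hA₀ hA₁ (by omega)
    rw [add_sub_cancel_right, invQFact_natCast, h1, qFact_succ]
    field_simp

/-! ### Admissible triples -/

theorem AdmTriple.swap {a b c : ℤ} (h : AdmTriple a b c) : AdmTriple b a c := by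
  simp only [AdmTriple, Int.even_iff] at *; omega

theorem AdmTriple.rotate {a b c : ℤ} (h : AdmTriple a b c) : AdmTriple b c a := by
  simp only [AdmTriple, Int.even_iff] at *; omega

theorem AdmTriple.swap_right {a b c : ℤ} (h : AdmTriple a b c) : AdmTriple a c b := by
  simp only [AdmTriple, Int.even_iff] at *; omega

theorem AdmTriple.reverse {a b c : ℤ} (h : AdmTriple a b c) : AdmTriple c b a := by
  simp only [AdmTriple, Int.even_iff] at *; omega

theorem AdmTriple.nonneg {a b c : ℤ} (h : AdmTriple a b c) : 0 ≤ a ∧ 0 ≤ b ∧ 0 ≤ c := by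
  simp only [AdmTriple] at *; omega

/-- The parameters count the strands that join the three edges pairwise at a vertex. They replace
halves and triangle inequalities by natural numbers. -/
theorem AdmTriple.exists_param {a b c : ℤ} (h : AdmTriple a b c) :
    ∃ x y z : ℕ, a = y + z ∧ b = x + y ∧ c = x + z := by
  simp only [AdmTriple, Int.even_iff] at h
  exact ⟨((b + c - a) / 2).toNat, ((a + b - c) / 2).toNat, ((c + a - b) / 2).toNat, by omega⟩

theorem admTriple_zero {x y : ℤ} (h : AdmTriple x 0 y) : x = y := by
  simp only [AdmTriple] at h; omega

theorem triDelta_param (x y z : ℕ) :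
    triDelta A (y + z) (x + y) (x + z) =
      sqrtQFact A x * sqrtQFact A y * sqrtQFact A z / sqrtQFact A (x + y + z + 1) := by
  rw [triDelta]
  have h1 : (((y : ℤ) + z + (x + y) - (x + z)) / 2).toNat = y := by omega
  have h2 : (((x : ℤ) + y + (x + z) - (y + z)) / 2).toNat = x := by omega
  have h3 : (((x : ℤ) + z + (y + z) - (x + y)) / 2).toNat = z := by omega
  have h4 : (((y : ℤ) + z + (x + y) + (x + z)) / 2 + 1).toNat = x + y + z + 1 := by omega
  rw [h1, h2, h3, h4]
  ring

theorem triDelta_ne_zero (hA₀ : A ≠ 0) (hA₁ : ‖A‖ < 1) (a b c : ℤ) : triDelta A a b c ≠ 0 := by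
  have h := sqrtQFact_ne_zero hA₀ hA₁
  rw [triDelta]
  exact div_ne_zero (mul_ne_zero (mul_ne_zero (h _) (h _)) (h _)) (h _)

theorem triDelta_swap (a b c : ℤ) : triDelta A b a c = triDelta A a b c := by
  rw [triDelta, triDelta, add_comm b a, add_comm a c, add_comm c b]
  ring

theorem triDelta_rotate (a b c : ℤ) : triDelta A b c a = triDelta A a b c := by
  rw [triDelta, triDelta, show b + c + a = a + b + c by ring]
  ring

theorem triDelta_swap_right (a b c : ℤ) : triDelta A a c b = triDelta A a b c := by
  rw [triDelta_rotate b a c, triDelta_swap]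

/-! ### Quantum `6j`-symbols as sums -/

/-- The sum in the definition of the quantum `6j`-symbol. -/
def racahSum (A : ℂ) (N : ℕ) (T₁ T₂ T₃ T₄ Q₁ Q₂ Q₃ : ℤ) : ℂ :=
  ∑ k ∈ Finset.range N, (-1) ^ k * qFact A (k + 1) *
    (invQFact A (k - T₁) * invQFact A (k - T₂) * invQFact A (k - T₃) * invQFact A (k - T₄) *
      invQFact A (Q₁ - k) * invQFact A (Q₂ - k) * invQFact A (Q₃ - k))

/-- The conditions under which the `6j`-symbol is given by its defining sum. -/
def AdmTet (a b c d e f : ℤ) : Prop :=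
  AdmTriple a b c ∧ AdmTriple a e f ∧ AdmTriple d b f ∧ AdmTriple d e c

theorem tet_of_not {a b c d e f : ℤ} (h : ¬ AdmTet a b c d e f) : tet A a b c d e f = 0 :=
  if_neg h

theorem admTet_of_ne_zero {a b c d e f : ℤ} (h : tet A a b c d e f ≠ 0) : AdmTet a b c d e f := by
  by_contra h'
  exact h (tet_of_not h')

/-- The reciprocal factorials vanish outside `T_i ≤ k ≤ Q_j`, so the sum may run over all `k < N`
for any `N > Q₁`. One `N` then serves all the symbols in an identity. -/
theorem tet_eq (hA₀ : A ≠ 0) (hA₁ : ‖A‖ < 1) {a b c d e f : ℤ} (h : AdmTet a b c d e f)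
    {T₁ T₂ T₃ T₄ Q₁ Q₂ Q₃ : ℤ} (h1 : a + b + c = 2 * T₁) (h2 : a + e + f = 2 * T₂)
    (h3 : d + b + f = 2 * T₃) (h4 : d + e + c = 2 * T₄) (hQ1 : a + b + d + e = 2 * Q₁)
    (hQ2 : a + c + d + f = 2 * Q₂) (hQ3 : b + c + e + f = 2 * Q₃) {N : ℕ} (hN : Q₁ < N) :
    tet A a b c d e f = Complex.I ^ (a + b + c + d + e + f) *
      (triDelta A a b c * triDelta A a e f * triDelta A d b f * triDelta A d e c) *
        racahSum A N T₁ T₂ T₃ T₄ Q₁ Q₂ Q₃ := by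
  have h' := h
  obtain ⟨g1, g2, g3, g4⟩ := h'
  have n1 := g1.nonneg
  have n2 := g4.nonneg
  have n3 := g2.nonneg
  have n4 := g3.nonneg
  rw [tet]
  rw [if_pos (show AdmTriple a b c ∧ AdmTriple a e f ∧ AdmTriple d b f ∧ AdmTriple d e c from h),
    h1, h2, h3, h4, hQ1, hQ2, hQ3]
  simp only [Int.mul_ediv_cancel_left _ (two_ne_zero : (2 : ℤ) ≠ 0)]
  congr 1
  · congr 1
    rw [← zpow_natCast, Int.toNat_of_nonneg (by omega)]
  · rw [racahSum]
    apply Finset.sum_of_injOn Int.toNat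
    · intro x hx y hy hxy
      simp only [Finset.coe_Icc, Set.mem_Icc] at hx hy
      omega
    · intro x hx
      simp only [Finset.coe_Icc, Set.mem_Icc, Finset.coe_range, Set.mem_Iio] at hx ⊢
      omega
    · intro k _ hk
      have hk' : (k : ℤ) < T₁ ∨ (k : ℤ) < T₂ ∨ (k : ℤ) < T₃ ∨ (k : ℤ) < T₄ ∨ Q₁ < k ∨ Q₂ < k ∨
          Q₃ < k := by
        by_contra! hcon
        refine hk ⟨(k : ℤ), ?_, by simp⟩
        simp only [Finset.coe_Icc, Set.mem_Icc]
        omega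
      rcases hk' with h | h | h | h | h | h | h <;>
        rw [invQFact_of_neg (sub_neg.2 h)] <;> simp
    · intro k hk
      rw [Finset.mem_Icc] at hk
      have e : ((k.toNat : ℕ) : ℤ) = k := Int.toNat_of_nonneg (by omega)
      have e1 : (k + 1).toNat = k.toNat + 1 := by omega
      rw [e, e1, qFact_one hA₀ hA₁]
      iterate 7 rw [invQFact_of_nonneg (by omega)]
      simp only [mul_inv, mul_one, div_eq_mul_inv]
      ring

/-- Every term has a reciprocal factorial of a negative number. This is the counterpart, for sums,
of the convention that inadmissible symbols are `0`. -/
theorem racahSum_eq_zero {N : ℕ} {T₁ T₂ T₃ T₄ Q₁ Q₂ Q₃ : ℤ}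
    (h : Q₁ < T₁ ∨ Q₁ < T₂ ∨ Q₁ < T₃ ∨ Q₁ < T₄ ∨ Q₂ < T₁ ∨ Q₂ < T₂ ∨ Q₂ < T₃ ∨ Q₂ < T₄ ∨
      Q₃ < T₁ ∨ Q₃ < T₂ ∨ Q₃ < T₃ ∨ Q₃ < T₄) :
    racahSum A N T₁ T₂ T₃ T₄ Q₁ Q₂ Q₃ = 0 := by
  refine Finset.sum_eq_zero fun k _ => ?_
  have hk' : (k : ℤ) < T₁ ∨ (k : ℤ) < T₂ ∨ (k : ℤ) < T₃ ∨ (k : ℤ) < T₄ ∨ Q₁ < k ∨ Q₂ < k ∨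
      Q₃ < k := by omega
  rcases hk' with h | h | h | h | h | h | h <;>
    rw [invQFact_of_neg (sub_neg.2 h)] <;> simp

/-- A coincidence `T_i = Q_j = k` leaves room for one index only. This occurs for symbols with an
entry `0` or `1/2`. -/
theorem racahSum_eq_single {N : ℕ} {T₁ T₂ T₃ T₄ Q₁ Q₂ Q₃ : ℤ} (k : ℕ) (hN : k < N)
    (hT : k = T₁ ∨ k = T₂ ∨ k = T₃ ∨ k = T₄) (hQ : Q₁ = k ∨ Q₂ = k ∨ Q₃ = k) :
    racahSum A N T₁ T₂ T₃ T₄ Q₁ Q₂ Q₃ = (-1) ^ k * qFact A (k + 1) *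
    (invQFact A (k - T₁) * invQFact A (k - T₂) * invQFact A (k - T₃) * invQFact A (k - T₄) *
      invQFact A (Q₁ - k) * invQFact A (Q₂ - k) * invQFact A (Q₃ - k)) := by
  refine Finset.sum_eq_single k (fun j _ hj => ?_) fun h => absurd (Finset.mem_range.2 hN) h
  have hk' : (j : ℤ) < T₁ ∨ (j : ℤ) < T₂ ∨ (j : ℤ) < T₃ ∨ (j : ℤ) < T₄ ∨ Q₁ < j ∨ Q₂ < j ∨
      Q₃ < j := by omega
  rcases hk' with h | h | h | h | h | h | h <;>
    rw [invQFact_of_neg (sub_neg.2 h)] <;> simp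

/-! ### Symmetries -/

theorem AdmTet.exists_sums {a b c d e f : ℤ} (h : AdmTet a b c d e f) :
    ∃ T₁ T₂ T₃ T₄ Q₁ Q₂ Q₃ : ℤ, a + b + c = 2 * T₁ ∧ a + e + f = 2 * T₂ ∧ d + b + f = 2 * T₃ ∧
      d + e + c = 2 * T₄ ∧ a + b + d + e = 2 * Q₁ ∧ a + c + d + f = 2 * Q₂ ∧
      b + c + e + f = 2 * Q₃ := by
  simp only [AdmTet, AdmTriple, Int.even_iff] at h
  exact ⟨(a + b + c) / 2, (a + e + f) / 2, (d + b + f) / 2, (d + e + c) / 2,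
    (a + b + d + e) / 2, (a + c + d + f) / 2, (b + c + e + f) / 2, by omega⟩

/-- Symmetries of the tetrahedron permute the `T_i` and the `Q_j`, and the sum is symmetric in both.
This swap, `tet_swap_right` and `tet_flip` generate all 24 symmetries. -/
theorem tet_swap (hA₀ : A ≠ 0) (hA₁ : ‖A‖ < 1) (a b c d e f : ℤ) :
    tet A b a c e d f = tet A a b c d e f := by
  by_cases h : AdmTet a b c d e f
  · have h' : AdmTet b a c e d f := ⟨h.1.swap, h.2.2.1.swap, h.2.1.swap, h.2.2.2.swap⟩
    obtain ⟨T₁, T₂, T₃, T₄, Q₁, Q₂, Q₃, h1, h2, h3, h4, h5, h6, h7⟩ := h.exists_sums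
    have hN : Q₁ < ((Q₁.toNat + 1 : ℕ) : ℤ) := by omega
    rw [tet_eq hA₀ hA₁ h h1 h2 h3 h4 h5 h6 h7 hN,
      tet_eq hA₀ hA₁ h' (T₁ := T₁) (T₂ := T₃) (T₃ := T₂) (T₄ := T₄) (Q₁ := Q₁) (Q₂ := Q₃)
        (Q₃ := Q₂) (by omega) (by omega) (by omega) (by omega) (by omega) (by omega) (by omega) hN,
      triDelta_swap a b c, triDelta_swap d b f, triDelta_swap a e f, triDelta_swap d e c]
    congr 1
    · rw [show b + a + c + e + d + f = a + b + c + d + e + f by ring]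
      ring
    · refine Finset.sum_congr rfl fun k _ => ?_
      ring
  · have h' : ¬ AdmTet b a c e d f := fun h' =>
      h ⟨h'.1.swap, h'.2.2.1.swap, h'.2.1.swap, h'.2.2.2.swap⟩
    rw [tet_of_not h, tet_of_not h']

theorem tet_swap_right (hA₀ : A ≠ 0) (hA₁ : ‖A‖ < 1) (a b c d e f : ℤ) :
    tet A a c b d f e = tet A a b c d e f := by
  have key : ∀ {a b c d e f : ℤ}, AdmTet a b c d e f → AdmTet a c b d f e := fun h =>
    ⟨h.1.swap_right, h.2.1.swap_right, h.2.2.2.swap_right, h.2.2.1.swap_right⟩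
  by_cases h : AdmTet a b c d e f
  · obtain ⟨T₁, T₂, T₃, T₄, Q₁, Q₂, Q₃, h1, h2, h3, h4, h5, h6, h7⟩ := h.exists_sums
    -- The swap exchanges `Q₁` and `Q₂`, and `tet_eq` asks for a range beyond the first of them, so
    -- the range has to exceed both.
    have hN : Q₁ < ((Q₁.toNat + Q₂.toNat + 1 : ℕ) : ℤ) := by omega
    have hN' : Q₂ < ((Q₁.toNat + Q₂.toNat + 1 : ℕ) : ℤ) := by omega
    rw [tet_eq hA₀ hA₁ h h1 h2 h3 h4 h5 h6 h7 hN,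
      tet_eq hA₀ hA₁ (key h) (T₁ := T₁) (T₂ := T₂) (T₃ := T₄) (T₄ := T₃) (Q₁ := Q₂) (Q₂ := Q₁)
        (Q₃ := Q₃) (by omega) (by omega) (by omega) (by omega) (by omega) (by omega) (by omega) hN',
      triDelta_swap_right a b c, triDelta_swap_right d b f, triDelta_swap_right a e f,
      triDelta_swap_right d e c]
    congr 1
    · rw [show a + c + b + d + f + e = a + b + c + d + e + f by ring]
      ring
    · refine Finset.sum_congr rfl fun k _ => ?_
      ring
  · rw [tet_of_not h, tet_of_not fun h' => h (key h')]

theorem tet_flip (hA₀ : A ≠ 0) (hA₁ : ‖A‖ < 1) (a b c d e f : ℤ) :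
    tet A a e f d b c = tet A a b c d e f := by
  have key : ∀ {a b c d e f : ℤ}, AdmTet a b c d e f → AdmTet a e f d b c := fun h =>
    ⟨h.2.1, h.1, h.2.2.2, h.2.2.1⟩
  by_cases h : AdmTet a b c d e f
  · obtain ⟨T₁, T₂, T₃, T₄, Q₁, Q₂, Q₃, h1, h2, h3, h4, h5, h6, h7⟩ := h.exists_sums
    have hN : Q₁ < ((Q₁.toNat + 1 : ℕ) : ℤ) := by omega
    rw [tet_eq hA₀ hA₁ h h1 h2 h3 h4 h5 h6 h7 hN,
      tet_eq hA₀ hA₁ (key h) (T₁ := T₂) (T₂ := T₁) (T₃ := T₄) (T₄ := T₃) (Q₁ := Q₁) (Q₂ := Q₂)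
        (Q₃ := Q₃) (by omega) (by omega) (by omega) (by omega) (by omega) (by omega) (by omega) hN]
    congr 1
    · rw [show a + e + f + d + b + c = a + b + c + d + e + f by ring]
      ring
    · refine Finset.sum_congr rfl fun k _ => ?_
      ring
  · rw [tet_of_not h, tet_of_not fun h' => h (key h')]

end quantum

end

end SpinNetwork

namespace SpinNetwork

noncomputable section

section quantum

variable {A : ℂ}

/-! ### Contiguity relations -/

theorem qInt_mul_of_eq (hA₀ : A ≠ 0) {p q a b c r : ℤ} (hp : p = a + c) (hq : q = b + c)
    (hr : r = a + b + c) :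
    qInt A p * qInt A q = qInt A c * qInt A r + qInt A a * qInt A b := by
  rw [hp, hq, hr, qInt_mul_qInt hA₀]

theorem qInt_mul_of_eq' (hA₀ : A ≠ 0) {p q a b c r : ℤ} (ha : a = p - c) (hb : b = q + c)
    (hr : r = c + q - p) :
    qInt A p * qInt A q = qInt A a * qInt A b + qInt A c * qInt A r := by
  have h := qInt_mul_of_eq hA₀ (p := p) (q := -q) (a := p - c) (b := -(q + c)) (c := c)
    (r := -(c + q - p)) (by ring) (by ring) (by ring)
  simp only [qInt_neg] at h
  rw [ha, hb, hr]
  linear_combination -h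

theorem invQFact_of_eq_sub_one (hA₀ : A ≠ 0) (hA₁ : ‖A‖ < 1) {m n : ℤ} (h : m = n - 1) :
    invQFact A m = qInt A n * invQFact A n := by
  rw [h, invQFact_sub_one hA₀ hA₁]

/-- Creative telescoping: the `k`-th summands of the two sides differ by `G (k+1) - G k`, and `G`
vanishes at both ends. This is the case of the pentagon in which `s₂` and `s₃` both increase; `s`
plays the role of `s₁`. -/
theorem racahSum_contiguous_up (hA₀ : A ≠ 0) (hA₁ : ‖A‖ < 1) {N : ℕ}
    {T₁ T₂ T₃ T₄ Q₁ Q₂ Q₃ s : ℤ} (hTQ : T₁ + T₂ + T₃ + T₄ = Q₁ + Q₂ + Q₃)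
    (hs : s = Q₁ + Q₂ - T₁ - T₂) (hT : 0 ≤ T₁) (hN : Q₁ + 1 < N) :
    -qInt A (T₂ + 2) * racahSum A N T₁ T₂ T₃ T₄ Q₁ Q₂ Q₃ * qInt A (s + 1) =
      qInt A (Q₂ - T₁ + 1) * qInt A (Q₁ - T₁ + 1) *
          racahSum A N T₁ (T₂ + 1) (T₃ + 1) (T₄ + 1) (Q₁ + 1) (Q₂ + 1) (Q₃ + 1) -
        qInt A (Q₃ - T₄ + 1) * qInt A (Q₃ - T₃ + 1) *
          racahSum A N T₁ (T₂ + 1) T₃ T₄ Q₁ Q₂ (Q₃ + 1) := by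
  -- The telescoping certificate. The shift in `k - 1 - T₁` gives `G 0 = 0` because `T₁ ≥ 0`, and
  -- `Q₁ + 1 - k` gives `G N = 0`.
  let G : ℕ → ℂ := fun k => -((-1) ^ k * qFact A (k + 1) * qInt A (s + 2 - k + T₂) *
    (invQFact A (k - 1 - T₁) * invQFact A (k - 1 - T₂) * invQFact A (k - 1 - T₃) *
      invQFact A (k - 1 - T₄) * invQFact A (Q₁ + 1 - k) * invQFact A (Q₂ + 1 - k) *
      invQFact A (Q₃ + 1 - k)))
  have hG := Finset.sum_range_sub G N
  have hG0 : G 0 = 0 := by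
    simp only [G]
    rw [invQFact_of_neg (n := ((0 : ℕ) : ℤ) - 1 - T₁) (by push_cast; omega)]
    ring
  have hGN : G N = 0 := by
    simp only [G]
    rw [invQFact_of_neg (n := Q₁ + 1 - N) (by omega)]
    ring
  rw [hG0, hGN, sub_zero] at hG
  rw [eq_comm, ← sub_eq_zero, ← hG]
  simp only [racahSum, Finset.mul_sum, Finset.sum_mul, ← Finset.sum_sub_distrib]
  refine Finset.sum_congr rfl fun k _ => ?_
  simp only [G]
  have r2 := invQFact_of_eq_sub_one hA₀ hA₁ (m := k - (T₂ + 1)) (n := k - T₂) (by ring)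
  have r3 := invQFact_of_eq_sub_one hA₀ hA₁ (m := k - (T₃ + 1)) (n := k - T₃) (by ring)
  have r4 := invQFact_of_eq_sub_one hA₀ hA₁ (m := k - (T₄ + 1)) (n := k - T₄) (by ring)
  have q1 := invQFact_of_eq_sub_one hA₀ hA₁ (m := Q₁ - k) (n := Q₁ + 1 - k) (by ring)
  have q2 := invQFact_of_eq_sub_one hA₀ hA₁ (m := Q₂ - k) (n := Q₂ + 1 - k) (by ring)
  have q3 := invQFact_of_eq_sub_one hA₀ hA₁ (m := Q₃ - k) (n := Q₃ + 1 - k) (by ring)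
  have t1 := invQFact_of_eq_sub_one hA₀ hA₁ (m := k - 1 - T₁) (n := k - T₁) (by ring)
  have t2 := invQFact_of_eq_sub_one hA₀ hA₁ (m := k - 1 - T₂) (n := k - T₂) (by ring)
  have t3 := invQFact_of_eq_sub_one hA₀ hA₁ (m := k - 1 - T₃) (n := k - T₃) (by ring)
  have t4 := invQFact_of_eq_sub_one hA₀ hA₁ (m := k - 1 - T₄) (n := k - T₄) (by ring)
  have e : ∀ x : ℤ, ((k + 1 : ℕ) : ℤ) - 1 - x = k - x := fun x => by push_cast; ring
  have e' : ∀ x : ℤ, x + 1 - ((k + 1 : ℕ) : ℤ) = x - k := fun x => by push_cast; ring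
  have e'' : s + 2 - ((k + 1 : ℕ) : ℤ) + T₂ = s + 1 - k + T₂ := by push_cast; ring
  have f : qFact A (k + 1 + 1) = qInt A (k + 2) * qFact A (k + 1) := by
    rw [qFact_succ]; push_cast; ring_nf
  rw [e, e, e, e, e', e', e', e'', f, r2, r3, r4, t1, t2, t3, t4, q1, q2, q3, pow_succ]
  have h1 := qInt_mul_of_eq hA₀ (p := Q₂ - T₁ + 1) (q := Q₁ - T₁ + 1) (a := Q₂ + 1 - k)
    (b := Q₁ + 1 - k) (c := k - T₁) (r := s + 2 - k + T₂) (by ring) (by ring) (by omega)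
  have h2 := qInt_mul_of_eq hA₀ (p := Q₃ - T₄ + 1) (q := Q₃ - T₃ + 1) (a := k - T₄)
    (b := k - T₃) (c := Q₃ + 1 - k) (r := k + 1 - s) (by ring) (by ring) (by omega)
  have h3 := qInt_mul_of_eq' hA₀ (p := s + 1) (q := T₂ + 2) (c := k - T₂)
    (a := s + 1 - k + T₂) (b := k + 2) (r := k + 1 - s) (by ring) (by ring) (by ring)
  -- All terms are now multiples of one product of reciprocal factorials. The cofactors agree by
  -- three instances of the quadratic relation between quantum integers.
  linear_combination ((-1) ^ k * qFact A (k + 1) * (invQFact A (k - T₁) * invQFact A (k - T₂) *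
    invQFact A (k - T₃) * invQFact A (k - T₄) * invQFact A (Q₁ + 1 - k) *
    invQFact A (Q₂ + 1 - k) * invQFact A (Q₃ + 1 - k))) *
      (qInt A (k - T₂) * qInt A (k - T₃) * qInt A (k - T₄) * h1 -
        qInt A (k - T₂) * qInt A (Q₁ + 1 - k) * qInt A (Q₂ + 1 - k) * h2 +
        qInt A (Q₁ + 1 - k) * qInt A (Q₂ + 1 - k) * qInt A (Q₃ + 1 - k) * h3)

/-- The same telescoping, for the case of the pentagon in which `s₂` and `s₃` both decrease. -/
theorem racahSum_contiguous_down (hA₀ : A ≠ 0) (hA₁ : ‖A‖ < 1) {N : ℕ}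
    {T₁ T₂ T₃ T₄ Q₁ Q₂ Q₃ s : ℤ} (hTQ : T₁ + T₂ + T₃ + T₄ = Q₁ + Q₂ + Q₃)
    (hs : s = Q₁ + Q₂ - T₁ - T₂) (hT : 0 ≤ T₁) (hN : Q₁ < N) :
    qInt A (Q₃ - T₁) * racahSum A N T₁ T₂ T₃ T₄ Q₁ Q₂ Q₃ * qInt A (s + 1) =
      qInt A (Q₁ - T₂ + 1) * qInt A (Q₂ - T₂ + 1) *
          racahSum A N T₁ (T₂ - 1) T₃ T₄ Q₁ Q₂ (Q₃ - 1) -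
        qInt A (T₃ + 1) * qInt A (T₄ + 1) *
          racahSum A N T₁ (T₂ - 1) (T₃ - 1) (T₄ - 1) (Q₁ - 1) (Q₂ - 1) (Q₃ - 1) := by
  let G : ℕ → ℂ := fun k => (-1) ^ k * qFact A (k + 1) * qInt A (s + 1 + Q₃ - k) *
    (invQFact A (k - 1 - T₁) * invQFact A (k - T₂) * invQFact A (k - T₃) *
      invQFact A (k - T₄) * invQFact A (Q₁ - k) * invQFact A (Q₂ - k) *
      invQFact A (Q₃ - k))
  have hG := Finset.sum_range_sub G N
  have hG0 : G 0 = 0 := by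
    simp only [G]
    rw [invQFact_of_neg (n := ((0 : ℕ) : ℤ) - 1 - T₁) (by push_cast; omega)]
    ring
  have hGN : G N = 0 := by
    simp only [G]
    rw [invQFact_of_neg (n := Q₁ - N) (by omega)]
    ring
  rw [hG0, hGN, sub_zero] at hG
  rw [eq_comm, ← sub_eq_zero, ← hG]
  simp only [racahSum, Finset.mul_sum, Finset.sum_mul, ← Finset.sum_sub_distrib]
  refine Finset.sum_congr rfl fun k _ => ?_
  simp only [G]
  have r2 := invQFact_of_eq_sub_one hA₀ hA₁ (m := k - T₂) (n := k - (T₂ - 1)) (by ring)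
  have r3 := invQFact_of_eq_sub_one hA₀ hA₁ (m := k - T₃) (n := k - (T₃ - 1)) (by ring)
  have r4 := invQFact_of_eq_sub_one hA₀ hA₁ (m := k - T₄) (n := k - (T₄ - 1)) (by ring)
  have q1 := invQFact_of_eq_sub_one hA₀ hA₁ (m := Q₁ - 1 - k) (n := Q₁ - k) (by ring)
  have q2 := invQFact_of_eq_sub_one hA₀ hA₁ (m := Q₂ - 1 - k) (n := Q₂ - k) (by ring)
  have q3 := invQFact_of_eq_sub_one hA₀ hA₁ (m := Q₃ - 1 - k) (n := Q₃ - k) (by ring)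
  have t1 := invQFact_of_eq_sub_one hA₀ hA₁ (m := k - 1 - T₁) (n := k - T₁) (by ring)
  have e1 : ((k + 1 : ℕ) : ℤ) - 1 - T₁ = k - T₁ := by push_cast; ring
  have e : ∀ x : ℤ, ((k + 1 : ℕ) : ℤ) - x = k - (x - 1) := fun x => by push_cast; ring
  have e' : ∀ x : ℤ, x - ((k + 1 : ℕ) : ℤ) = x - 1 - k := fun x => by push_cast; ring
  have e'' : s + 1 + Q₃ - ((k + 1 : ℕ) : ℤ) = s + Q₃ - k := by push_cast; ring
  have f : qFact A (k + 1 + 1) = qInt A (k + 2) * qFact A (k + 1) := by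
    rw [qFact_succ]; push_cast; ring_nf
  rw [e1, e'', e, e, e, e', e', e', f, r2, r3, r4, t1, q1, q2, q3, pow_succ]
  have h1 := qInt_mul_of_eq hA₀ (p := Q₁ - T₂ + 1) (q := Q₂ - T₂ + 1) (a := Q₁ - k)
    (b := Q₂ - k) (c := k - (T₂ - 1)) (r := s + 1 + T₁ - k) (by ring) (by ring) (by omega)
  have h2 := qInt_mul_of_eq hA₀ (p := T₃ + 1) (q := T₄ + 1) (a := -(k - (T₃ - 1)))
    (b := -(k - (T₄ - 1))) (c := k + 2) (r := s + Q₃ - k) (by ring) (by ring) (by omega)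
  have h3 := qInt_mul_of_eq' hA₀ (p := s + 1) (q := Q₃ - T₁) (c := -(Q₃ - k))
    (a := s + 1 + Q₃ - k) (b := k - T₁) (r := -(s + 1 + T₁ - k)) (by ring) (by ring) (by ring)
  simp only [qInt_neg] at h2 h3
  linear_combination ((-1) ^ k * qFact A (k + 1) * (invQFact A (k - T₁) *
    invQFact A (k - (T₂ - 1)) * invQFact A (k - (T₃ - 1)) * invQFact A (k - (T₄ - 1)) *
    invQFact A (Q₁ - k) * invQFact A (Q₂ - k) * invQFact A (Q₃ - k))) *
      (qInt A (Q₃ - k) * qInt A (k - (T₃ - 1)) * qInt A (k - (T₄ - 1)) * h1 -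
        qInt A (Q₁ - k) * qInt A (Q₂ - k) * qInt A (Q₃ - k) * h2 -
        qInt A (k - (T₂ - 1)) * qInt A (k - (T₃ - 1)) * qInt A (k - (T₄ - 1)) * h3)

/-- The same telescoping, for the case of the pentagon in which `s₂` increases and `s₃` decreases.
-/
theorem racahSum_contiguous_mixed (hA₀ : A ≠ 0) (hA₁ : ‖A‖ < 1) {N : ℕ}
    {T₁ T₂ T₃ T₄ Q₁ Q₂ Q₃ s : ℤ} (hTQ : T₁ + T₂ + T₃ + T₄ = Q₁ + Q₂ + Q₃)
    (hs : s = Q₁ + Q₂ - T₁ - T₂) (hT : 0 ≤ T₁) (hN : Q₁ + 1 < N) :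
    qInt A (Q₂ - T₄) * racahSum A N T₁ T₂ T₃ T₄ Q₁ Q₂ Q₃ * qInt A (s + 1) =
      qInt A (Q₁ - T₂ + 1) * qInt A (Q₁ - T₁ + 1) *
          racahSum A N T₁ T₂ T₃ (T₄ + 1) (Q₁ + 1) Q₂ Q₃ +
        qInt A (T₃ + 1) * qInt A (Q₃ - T₃ + 1) *
          racahSum A N T₁ T₂ (T₃ - 1) T₄ Q₁ (Q₂ - 1) Q₃ := by
  let G : ℕ → ℂ := fun k => -((-1) ^ k * qFact A (k + 1) *
    (invQFact A (k - 1 - T₁) * invQFact A (k - 1 - T₂) * invQFact A (k - T₃) *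
      invQFact A (k - 1 - T₄) * invQFact A (Q₁ + 1 - k) * invQFact A (Q₂ - k) *
      invQFact A (Q₃ - k)))
  have hG := Finset.sum_range_sub G N
  have hG0 : G 0 = 0 := by
    simp only [G]
    rw [invQFact_of_neg (n := ((0 : ℕ) : ℤ) - 1 - T₁) (by push_cast; omega)]
    ring
  have hGN : G N = 0 := by
    simp only [G]
    rw [invQFact_of_neg (n := Q₁ + 1 - N) (by omega)]
    ring
  rw [hG0, hGN, sub_zero] at hG
  rw [eq_comm, ← sub_eq_zero, ← hG]
  simp only [racahSum, Finset.mul_sum, Finset.sum_mul, ← Finset.sum_add_distrib,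
    ← Finset.sum_sub_distrib]
  refine Finset.sum_congr rfl fun k _ => ?_
  simp only [G]
  have r3 := invQFact_of_eq_sub_one hA₀ hA₁ (m := k - T₃) (n := k - (T₃ - 1)) (by ring)
  have r4 := invQFact_of_eq_sub_one hA₀ hA₁ (m := k - (T₄ + 1)) (n := k - T₄) (by ring)
  have q1 := invQFact_of_eq_sub_one hA₀ hA₁ (m := Q₁ - k) (n := Q₁ + 1 - k) (by ring)
  have q2 := invQFact_of_eq_sub_one hA₀ hA₁ (m := Q₂ - 1 - k) (n := Q₂ - k) (by ring)
  have q3 := invQFact_of_eq_sub_one hA₀ hA₁ (m := Q₃ - 1 - k) (n := Q₃ - k) (by ring)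
  have t1 := invQFact_of_eq_sub_one hA₀ hA₁ (m := k - 1 - T₁) (n := k - T₁) (by ring)
  have t2 := invQFact_of_eq_sub_one hA₀ hA₁ (m := k - 1 - T₂) (n := k - T₂) (by ring)
  have t4 := invQFact_of_eq_sub_one hA₀ hA₁ (m := k - 1 - T₄) (n := k - T₄) (by ring)
  have e1 : ∀ x : ℤ, ((k + 1 : ℕ) : ℤ) - 1 - x = k - x := fun x => by push_cast; ring
  have e : ∀ x : ℤ, ((k + 1 : ℕ) : ℤ) - x = k - (x - 1) := fun x => by push_cast; ring
  have e2 : ∀ x : ℤ, x + 1 - ((k + 1 : ℕ) : ℤ) = x - k := fun x => by push_cast; ring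
  have e' : ∀ x : ℤ, x - ((k + 1 : ℕ) : ℤ) = x - 1 - k := fun x => by push_cast; ring
  have f : qFact A (k + 1 + 1) = qInt A (k + 2) * qFact A (k + 1) := by
    rw [qFact_succ]; push_cast; ring_nf
  rw [e1, e1, e1, e T₃, e2, e' Q₂, e' Q₃, f, r3, r4, t1, t2, t4, q1, q2, q3, pow_succ]
  have h1 := qInt_mul_of_eq hA₀ (p := Q₁ - T₂ + 1) (q := Q₁ - T₁ + 1) (a := k - T₂)
    (b := k - T₁) (c := Q₁ + 1 - k) (r := s + 1 - (Q₂ - k)) (by ring) (by ring) (by omega)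
  have h2 := qInt_mul_of_eq' hA₀ (p := Q₃ - T₃ + 1) (q := T₃ + 1) (a := Q₃ - k)
    (b := k + 2) (c := k - (T₃ - 1)) (r := s + 1 + (k - T₄)) (by ring) (by ring) (by omega)
  have h3 := qInt_mul_of_eq hA₀ (p := s + 1) (q := Q₂ - T₄) (a := s + 1 - (Q₂ - k))
    (b := k - T₄) (c := Q₂ - k) (r := s + 1 + (k - T₄)) (by ring) (by ring) (by ring)
  linear_combination ((-1) ^ k * qFact A (k + 1) * (invQFact A (k - T₁) *
    invQFact A (k - T₂) * invQFact A (k - (T₃ - 1)) * invQFact A (k - T₄) *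
    invQFact A (Q₁ + 1 - k) * invQFact A (Q₂ - k) * invQFact A (Q₃ - k))) *
      (qInt A (k - (T₃ - 1)) * qInt A (k - T₄) * h1 +
        qInt A (Q₁ + 1 - k) * qInt A (Q₂ - k) * h2 -
        qInt A (k - (T₃ - 1)) * qInt A (Q₁ + 1 - k) * h3)

/-! ### `6j`-symbols with an entry `1/2` -/

theorem I_zpow_congr {a b : ℤ} (h : (4 : ℤ) ∣ a - b) : Complex.I ^ a = Complex.I ^ b := by
  obtain ⟨j, hj⟩ := h
  rw [show a = 4 * j + b by linarith, zpow_add₀ Complex.I_ne_zero, zpow_mul]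
  have : Complex.I ^ (4 : ℤ) = 1 := by exact_mod_cast Complex.I_pow_four
  rw [this, one_zpow, one_mul]

theorem neg_one_pow_eq_I (k : ℕ) : (-1 : ℂ) ^ k = Complex.I ^ (2 * (k : ℤ)) := by
  rw [zpow_mul, zpow_natCast]
  congr 1
  exact_mod_cast Complex.I_sq.symm

theorem I_zpow_congr_neg {a b : ℤ} (h : (4 : ℤ) ∣ a - b - 2) :
    Complex.I ^ a = -Complex.I ^ b := by
  rw [I_zpow_congr (b := b + 2) (by rwa [← sub_sub]), zpow_add₀ Complex.I_ne_zero]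
  have : Complex.I ^ (2 : ℤ) = -1 := by exact_mod_cast Complex.I_sq
  rw [this]; ring

/-- The tetrahedron with one edge of color `1/2`, opposite to an edge of color `c`; the edges `u`, `v`
are opposite to `v'`, `u'`. -/
def halfTet (A : ℂ) (c u v u' v' : ℤ) : ℂ := tet A c u v 1 v' u'

theorem halfTet_swap (hA₀ : A ≠ 0) (hA₁ : ‖A‖ < 1) (c u v u' v' : ℤ) :
    halfTet A c v u v' u' = halfTet A c u v u' v' :=
  tet_swap_right hA₀ hA₁ c u v 1 v' u'

theorem halfTet_symm (hA₀ : A ≠ 0) (hA₁ : ‖A‖ < 1) (c u v u' v' : ℤ) :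
    halfTet A c u' v' u v = halfTet A c u v u' v' := by
  rw [halfTet, halfTet, ← tet_flip hA₀ hA₁ c u v 1 v' u', tet_swap_right hA₀ hA₁]

/-- `halfTet` up to normalization. -/
def halfCoeff (A : ℂ) (c u v u' v' : ℤ) : ℂ :=
  if u' = u + 1 then
    if v' = v + 1 then qInt A ((u + v - c) / 2 + 1) else qInt A ((c + u - v) / 2 + 1)
  else
    if v' = v + 1 then qInt A ((c + v - u) / 2 + 1) else -qInt A ((c + u + v) / 2 + 1)

/-- Squares of `Δ` are free of square roots. The identities below are arranged so that each `Δ`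
occurs squared or is common to both sides. -/
theorem triDelta_mul_self (hA₀ : A ≠ 0) (hA₁ : ‖A‖ < 1) (x y z : ℕ) :
    triDelta A (y + z) (x + y) (x + z) * triDelta A (y + z) (x + y) (x + z) =
      qFact A x * qFact A y * qFact A z / qFact A (x + y + z + 1) := by
  rw [triDelta_param]
  simp only [← sqrtQFact_sq hA₀ hA₁]
  rw [div_mul_div_comm]
  ring

theorem admTriple_of_halfTet_ne_zero {c u v u' v' : ℤ} (h : halfTet A c u v u' v' ≠ 0) :
    AdmTriple c u v ∧ AdmTriple c u' v' ∧ (u' = u + 1 ∨ u' = u - 1) ∧ (v' = v + 1 ∨ v' = v - 1) := by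
  obtain ⟨h1, h2, h3, h4⟩ := admTet_of_ne_zero h
  refine ⟨h1, h2.swap_right, ?_, ?_⟩
  · simp only [AdmTriple, Int.even_iff] at h3; omega
  · simp only [AdmTriple, Int.even_iff] at h4; omega

end quantum

end

end SpinNetwork

namespace SpinNetwork

noncomputable section

section quantum

variable {A : ℂ}

theorem invQFact_of_eq {n : ℤ} {m : ℕ} (h : n = m) : invQFact A n = (qFact A m)⁻¹ := by
  rw [h, invQFact_natCast]

/-- The factor `Δ(c,u',v')` on the left squares the one inside the symbol. What remains of each sign
pattern is the evaluation `hz` of a sum with one term. -/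
theorem halfTet_mul_triDelta_of_racahSum (hA₀ : A ≠ 0) (hA₁ : ‖A‖ < 1) {c u v u' v' : ℤ}
    (h : AdmTet c u v 1 v' u') {T₁ T₂ T₃ T₄ Q₁ Q₂ Q₃ : ℤ} (h1 : c + u + v = 2 * T₁)
    (h2 : c + v' + u' = 2 * T₂) (h3 : 1 + u + u' = 2 * T₃) (h4 : 1 + v' + v = 2 * T₄)
    (h5 : c + u + 1 + v' = 2 * Q₁) (h6 : c + v + 1 + u' = 2 * Q₂) (h7 : u + v + v' + u' = 2 * Q₃)
    {k N : ℕ} (hN : Q₁ < N) {z : ℂ}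
    (hz : triDelta A c u' v' * triDelta A c u' v' * racahSum A N T₁ T₂ T₃ T₄ Q₁ Q₂ Q₃ =
      (-1) ^ k * z) :
    halfTet A c u v u' v' * triDelta A c u' v' =
      triDelta A c u v * (triDelta A 1 u u' * triDelta A 1 v v') *
        (Complex.I ^ (c + u + v + 1 + v' + u' + 2 * k) * z) := by
  rw [halfTet, tet_eq hA₀ hA₁ h h1 h2 h3 h4 h5 h6 h7 hN, zpow_add₀ Complex.I_ne_zero _ (2 * (k : ℤ)),
    ← neg_one_pow_eq_I, triDelta_swap_right c u' v', triDelta_swap_right 1 v v']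
  linear_combination (Complex.I ^ (c + u + v + 1 + v' + u') * triDelta A c u v *
    triDelta A 1 u u' * triDelta A 1 v v') * hz

/-- Here `T₂ = Q₁`, so the sum has a single term. In the other sign patterns `T₁ = Q₁` has the same
effect. -/
theorem halfTet_mul_triDelta_up_up (hA₀ : A ≠ 0) (hA₁ : ‖A‖ < 1) {c u v : ℤ}
    (h : AdmTriple c u v) :
    halfTet A c u v (u + 1) (v + 1) * triDelta A c (u + 1) (v + 1) =
      triDelta A c u v * (triDelta A 1 u (u + 1) * triDelta A 1 v (v + 1)) *
        (Complex.I ^ (u + v + 1) * qInt A ((u + v - c) / 2 + 1)) := by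
  have hadm : AdmTet c u v 1 (v + 1) (u + 1) := by
    simp only [AdmTet, AdmTriple, Int.even_iff] at *; omega
  obtain ⟨x, y, z, rfl, rfl, rfl⟩ := h.exists_param
  rw [halfTet_mul_triDelta_of_racahSum hA₀ hA₁ hadm (T₁ := x + y + z) (T₂ := x + y + z + 1)
    (T₃ := x + y + 1) (T₄ := x + z + 1) (Q₁ := x + y + z + 1) (Q₂ := x + y + z + 1)
    (Q₃ := 2 * x + y + z + 1) (N := x + y + z + 2) (k := x + y + z + 1) (z := qInt A (x + 1))
    (by ring) (by ring) (by ring) (by ring) (by ring) (by ring) (by ring) (by push_cast; omega)]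
  · rw [I_zpow_congr (b := (x : ℤ) + y + (x + z) + 1) ⟨x + y + z + 1, by push_cast; ring⟩,
      show ((x : ℤ) + y + (x + z) - (y + z)) / 2 + 1 = x + 1 by omega]
  · have hD := triDelta_mul_self hA₀ hA₁ (x + 1) y z
    rw [show (((x + 1 : ℕ) : ℤ) + y) = x + y + 1 by push_cast; ring,
      show (((x + 1 : ℕ) : ℤ) + z) = x + z + 1 by push_cast; ring] at hD
    rw [hD, racahSum_eq_single (x + y + z + 1) (by omega) (by push_cast; omega) (by push_cast; omega),
      invQFact_of_eq (m := 1) (by push_cast; ring), invQFact_of_eq (m := 0) (by push_cast; ring),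
      invQFact_of_eq (m := z) (by push_cast; ring), invQFact_of_eq (m := y) (by push_cast; ring),
      invQFact_of_eq (m := 0) (by push_cast; ring), invQFact_of_eq (m := x) (by push_cast; ring),
      qFact_one hA₀ hA₁, qFact_zero, show x + 1 + y + z + 1 = x + y + z + 1 + 1 by ring,
      qFact_succ x]
    have f := qFact_ne_zero hA₀ hA₁
    have f1 := f x
    have f2 := f y
    have f3 := f z
    have f4 := f (x + y + z + 1 + 1)
    field_simp

theorem halfTet_mul_triDelta_up_down (hA₀ : A ≠ 0) (hA₁ : ‖A‖ < 1) {c u v : ℤ}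
    (h : AdmTriple c u v) (h' : AdmTriple c (u + 1) (v - 1)) :
    halfTet A c u v (u + 1) (v - 1) * triDelta A c (u + 1) (v - 1) =
      triDelta A c u v * (triDelta A 1 u (u + 1) * triDelta A 1 v (v - 1)) *
        (Complex.I ^ (u + v + 1) * qInt A ((c + u - v) / 2 + 1)) := by
  have hadm : AdmTet c u v 1 (v - 1) (u + 1) := by
    simp only [AdmTet, AdmTriple, Int.even_iff] at *; omega
  obtain ⟨x, y, z, rfl, rfl, rfl⟩ := h.exists_param
  -- Passing to `(c, u+1, v-1)` converts a strand of `z` into a strand of `y`, so admissibility of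
  -- the new triple forces `z ≥ 1`.
  obtain ⟨z, rfl⟩ : ∃ n, z = n + 1 := ⟨z - 1, by simp only [AdmTriple] at h'; omega⟩
  rw [halfTet_mul_triDelta_of_racahSum hA₀ hA₁ hadm (T₁ := x + y + z + 1) (T₂ := x + y + z + 1)
    (T₃ := x + y + 1) (T₄ := x + z + 1) (Q₁ := x + y + z + 1) (Q₂ := x + y + z + 2)
    (Q₃ := 2 * x + y + z + 1) (N := x + y + z + 2) (k := x + y + z + 1) (z := qInt A (y + 1))
    (by push_cast; ring) (by push_cast; ring) (by ring) (by push_cast; ring)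
    (by push_cast; ring) (by push_cast; ring) (by push_cast; ring) (by push_cast; omega)]
  · rw [I_zpow_congr (b := (x : ℤ) + y + (x + (z + 1 : ℕ)) + 1)
        ⟨x + y + z + 1, by push_cast; ring⟩,
      show ((y : ℤ) + (z + 1 : ℕ) + (x + y) - (x + (z + 1 : ℕ))) / 2 + 1 = y + 1 by omega]
  · have hD := triDelta_mul_self hA₀ hA₁ x (y + 1) z
    rw [show (((y + 1 : ℕ) : ℤ) + z) = y + (z + 1 : ℕ) by push_cast; ring,
      show ((x : ℤ) + (y + 1 : ℕ)) = x + y + 1 by push_cast; ring,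
      show ((x : ℤ) + z) = x + (z + 1 : ℕ) - 1 by push_cast; ring] at hD
    rw [hD, racahSum_eq_single (x + y + z + 1) (by omega) (by push_cast; omega) (by push_cast; omega),
      invQFact_of_eq (m := 0) (by push_cast; ring),
      invQFact_of_eq (m := z) (by push_cast; ring), invQFact_of_eq (m := y) (by push_cast; ring),
      invQFact_of_eq (m := 0) (by push_cast; ring), invQFact_of_eq (m := 1) (by push_cast; ring),
      invQFact_of_eq (m := x) (by push_cast; ring),
      qFact_one hA₀ hA₁, qFact_zero, show x + (y + 1) + z + 1 = x + y + z + 1 + 1 by ring,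
      qFact_succ y]
    have f := qFact_ne_zero hA₀ hA₁
    have f1 := f x
    have f2 := f y
    have f3 := f z
    have f4 := f (x + y + z + 1 + 1)
    field_simp

theorem halfTet_mul_triDelta_down_down (hA₀ : A ≠ 0) (hA₁ : ‖A‖ < 1) {c u v : ℤ}
    (h : AdmTriple c u v) (h' : AdmTriple c (u - 1) (v - 1)) :
    halfTet A c u v (u - 1) (v - 1) * triDelta A c (u - 1) (v - 1) =
      triDelta A c u v * (triDelta A 1 u (u - 1) * triDelta A 1 v (v - 1)) *
        (Complex.I ^ (u + v + 1) * -qInt A ((c + u + v) / 2 + 1)) := by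
  have hadm : AdmTet c u v 1 (v - 1) (u - 1) := by
    simp only [AdmTet, AdmTriple, Int.even_iff] at *; omega
  obtain ⟨x, y, z, rfl, rfl, rfl⟩ := h.exists_param
  -- Lowering both `u` and `v` removes one of the `x` strands that join them.
  obtain ⟨x, rfl⟩ : ∃ n, x = n + 1 := ⟨x - 1, by simp only [AdmTriple] at h'; omega⟩
  rw [halfTet_mul_triDelta_of_racahSum hA₀ hA₁ hadm (T₁ := x + y + z + 1) (T₂ := x + y + z)
    (T₃ := x + y + 1) (T₄ := x + z + 1) (Q₁ := x + y + z + 1) (Q₂ := x + y + z + 1)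
    (Q₃ := 2 * x + y + z + 1) (N := x + y + z + 2) (k := x + y + z + 1)
    (z := qInt A (x + y + z + 2))
    (by push_cast; ring) (by push_cast; ring) (by push_cast; ring) (by push_cast; ring)
    (by push_cast; ring) (by push_cast; ring) (by push_cast; ring) (by push_cast; omega)]
  · rw [I_zpow_congr_neg (b := ((x + 1 : ℕ) : ℤ) + y + ((x + 1 : ℕ) + z) + 1)
        ⟨x + y + z, by push_cast; ring⟩,
      show ((y : ℤ) + z + ((x + 1 : ℕ) + y) + ((x + 1 : ℕ) + z)) / 2 + 1 = x + y + z + 2 by omega]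
    ring
  · have hD := triDelta_mul_self hA₀ hA₁ x y z
    rw [show ((x : ℤ) + y) = (x + 1 : ℕ) + y - 1 by push_cast; ring,
      show ((x : ℤ) + z) = (x + 1 : ℕ) + z - 1 by push_cast; ring] at hD
    rw [hD, racahSum_eq_single (x + y + z + 1) (by omega) (by push_cast; omega) (by push_cast; omega),
      invQFact_of_eq (m := 0) (by push_cast; ring), invQFact_of_eq (m := 1) (by push_cast; ring),
      invQFact_of_eq (m := z) (by push_cast; ring), invQFact_of_eq (m := y) (by push_cast; ring),
      invQFact_of_eq (m := 0) (by push_cast; ring),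
      invQFact_of_eq (m := x) (by push_cast; ring),
      qFact_one hA₀ hA₁, qFact_zero, qFact_succ (x + y + z + 1),
      show (((x + y + z + 1 : ℕ) : ℤ) + 1) = x + y + z + 2 by push_cast; ring]
    have f := qFact_ne_zero hA₀ hA₁
    have f1 := f x
    have f2 := f y
    have f3 := f z
    have f4 := f (x + y + z + 1)
    field_simp

/-- A uniform evaluation: the phase depends only on `u + v`, and the sign of the case in which both
decrease sits in `halfCoeff`. Written without division, it trades `Δ(c,u',v')` for `Δ(c,u,v)`, which
lets these factors cancel in longer products. -/
theorem halfTet_mul_triDelta (hA₀ : A ≠ 0) (hA₁ : ‖A‖ < 1) {c u v u' v' : ℤ}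
    (h : AdmTriple c u v) (h' : AdmTriple c u' v') (hu : u' = u + 1 ∨ u' = u - 1)
    (hv : v' = v + 1 ∨ v' = v - 1) :
    halfTet A c u v u' v' * triDelta A c u' v' =
      triDelta A c u v * (triDelta A 1 u u' * triDelta A 1 v v') *
        (Complex.I ^ (u + v + 1) * halfCoeff A c u v u' v') := by
  have hne : ∀ t : ℤ, ¬ (t - 1 = t + 1) := fun t => by omega
  rcases hu with rfl | rfl <;> rcases hv with rfl | rfl
  · rw [halfTet_mul_triDelta_up_up hA₀ hA₁ h, halfCoeff, if_pos rfl, if_pos rfl]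
  · rw [halfTet_mul_triDelta_up_down hA₀ hA₁ h h', halfCoeff, if_pos rfl, if_neg (hne _)]
  -- The remaining mixed pattern is the other one with the roles of `u` and `v` exchanged.
  · rw [← halfTet_swap hA₀ hA₁, ← triDelta_swap_right c (u - 1) (v + 1),
      halfTet_mul_triDelta_up_down hA₀ hA₁ h.swap_right h'.swap_right, halfCoeff, if_neg (hne _),
      if_pos rfl, triDelta_swap_right c u v, add_comm v u]
    ring
  · rw [halfTet_mul_triDelta_down_down hA₀ hA₁ h h', halfCoeff, if_neg (hne _), if_neg (hne _)]

theorem halfCoeff_ne_zero (hA₀ : A ≠ 0) (hA₁ : ‖A‖ < 1) {c u v u' v' : ℤ}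
    (h : AdmTriple c u v) :
    halfCoeff A c u v u' v' ≠ 0 := by
  have hq : ∀ {n : ℤ}, 0 < n → qInt A n ≠ 0 := fun hn => qInt_ne_zero hA₀ hA₁ hn
  simp only [AdmTriple] at h
  rw [halfCoeff]
  split_ifs
  · exact hq (by omega)
  · exact hq (by omega)
  · exact hq (by omega)
  · exact neg_ne_zero.2 (hq (by omega))

theorem halfTet_ne_zero (hA₀ : A ≠ 0) (hA₁ : ‖A‖ < 1) {c u v u' v' : ℤ}
    (h : AdmTriple c u v) (h' : AdmTriple c u' v') (hu : u' = u + 1 ∨ u' = u - 1)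
    (hv : v' = v + 1 ∨ v' = v - 1) : halfTet A c u v u' v' ≠ 0 := by
  have hd := triDelta_ne_zero hA₀ hA₁
  refine left_ne_zero_of_mul (b := triDelta A c u' v') ?_
  rw [halfTet_mul_triDelta hA₀ hA₁ h h' hu hv]
  exact mul_ne_zero (mul_ne_zero (hd _ _ _) (mul_ne_zero (hd _ _ _) (hd _ _ _)))
    (mul_ne_zero (zpow_ne_zero _ Complex.I_ne_zero) (halfCoeff_ne_zero hA₀ hA₁ h))

/-! ### Weights of regions and tetrahedra with an entry `0` -/

/-- The weight of a region with state `x`. -/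
def regionWeight (A : ℂ) (x : ℤ) : ℂ := (-1) ^ x.toNat * qInt A (x + 1)

theorem regionWeight_ne_zero (hA₀ : A ≠ 0) (hA₁ : ‖A‖ < 1) {x : ℤ} (hx : 0 ≤ x) :
    regionWeight A x ≠ 0 :=
  mul_ne_zero (pow_ne_zero _ (by norm_num)) (qInt_ne_zero hA₀ hA₁ (by omega))

/-- A square root of the weight of a region with state `x`. -/
def sqrtRegionWeight (A : ℂ) (x : ℤ) : ℂ := Complex.I ^ x * sqrtQInt A (x + 1).toNat

theorem sqrtRegionWeight_mul_self (hA₀ : A ≠ 0) (hA₁ : ‖A‖ < 1) {x : ℤ} (hx : 0 ≤ x) :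
    sqrtRegionWeight A x * sqrtRegionWeight A x = regionWeight A x := by
  obtain ⟨n, rfl⟩ := Int.eq_ofNat_of_zero_le hx
  rw [sqrtRegionWeight, regionWeight, Int.toNat_natCast, neg_one_pow_eq_I,
    show 2 * (n : ℤ) = n + n by ring, zpow_add₀ Complex.I_ne_zero,
    show ((n : ℤ) + 1).toNat = n + 1 by omega]
  have := sqrtQInt_sq hA₀ hA₁ (n + 1)
  push_cast at this
  rw [← this]
  ring

theorem sqrtRegionWeight_ne_zero (hA₀ : A ≠ 0) (hA₁ : ‖A‖ < 1) {x : ℤ} (hx : 0 ≤ x) :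
    sqrtRegionWeight A x ≠ 0 := fun h =>
  regionWeight_ne_zero hA₀ hA₁ hx (by rw [← sqrtRegionWeight_mul_self hA₀ hA₁ hx, h, mul_zero])

theorem triDelta_self_zero (hA₀ : A ≠ 0) (hA₁ : ‖A‖ < 1) (n : ℕ) :
    triDelta A n n 0 = 1 / sqrtQInt A (n + 1) := by
  have d := triDelta_param (A := A) 0 n 0
  simp only [CharP.cast_eq_zero, zero_add, add_zero] at d
  have h0 : sqrtQFact A 0 = 1 := by simp [sqrtQFact]
  have hn := sqrtQFact_ne_zero hA₀ hA₁ n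
  have hs := sqrtQInt_ne_zero hA₀ hA₁ (Nat.succ_ne_zero n)
  rw [d, h0, sqrtQFact_succ]
  field_simp

/-- With an edge of color `0` the tetrahedron degenerates to a theta graph. Then `T₁ = T₄ = Q₂ =
Q₃`, one term survives, and the two equal factors `Δ` cancel against it. -/
theorem tet_zero (hA₀ : A ≠ 0) (hA₁ : ‖A‖ < 1) {x y b : ℤ} (h : AdmTriple x y b) :
    tet A x y b y x 0 =
      Complex.I ^ (2 * b) / (sqrtRegionWeight A x * sqrtRegionWeight A y) := by
  have hadm : AdmTet x y b y x 0 := by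
    simp only [AdmTet, AdmTriple, Int.even_iff] at *; omega
  obtain ⟨p, q, r, rfl, rfl, rfl⟩ := h.exists_param
  rw [tet_eq hA₀ hA₁ hadm (T₁ := p + q + r) (T₂ := q + r) (T₃ := p + q) (T₄ := p + q + r)
    (Q₁ := p + 2 * q + r) (Q₂ := p + q + r) (Q₃ := p + q + r) (N := p + 2 * q + r + 1)
    (by ring) (by ring) (by ring) (by ring) (by ring) (by ring) (by ring) (by push_cast; omega),
    racahSum_eq_single (p + q + r) (by omega) (by push_cast; omega) (by push_cast; omega),
    invQFact_of_eq (m := 0) (by push_cast; ring), invQFact_of_eq (m := p) (by push_cast; ring),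
    invQFact_of_eq (m := r) (by push_cast; ring), invQFact_of_eq (m := q) (by push_cast; ring),
    invQFact_of_eq (n := (p : ℤ) + q + r - (p + q + r : ℕ)) (m := 0) (by push_cast; ring),
    qFact_zero]
  have d1 := triDelta_self_zero hA₀ hA₁ (q + r)
  have d2 := triDelta_self_zero hA₀ hA₁ (p + q)
  have hD := triDelta_mul_self hA₀ hA₁ p q r
  push_cast at d1 d2
  rw [triDelta_swap ((q : ℤ) + r) (p + q) (p + r), d1, d2, sqrtRegionWeight, sqrtRegionWeight,
    show ((q : ℤ) + r + 1).toNat = q + r + 1 by omega,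
    show ((p : ℤ) + q + 1).toNat = p + q + 1 by omega, neg_one_pow_eq_I]
  have hI : Complex.I ^ ((q : ℤ) + r + (p + q) + (p + r) + (p + q) + (q + r) + 0) *
      Complex.I ^ (2 * ((p + q + r : ℕ) : ℤ)) =
      Complex.I ^ (2 * ((p : ℤ) + r)) / (Complex.I ^ ((q : ℤ) + r) * Complex.I ^ ((p : ℤ) + q)) := by
    rw [← zpow_add₀ Complex.I_ne_zero, ← zpow_add₀ Complex.I_ne_zero,
      ← zpow_sub₀ Complex.I_ne_zero]
    exact I_zpow_congr ⟨2 * q + p + r, by push_cast; ring⟩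
  have f := qFact_ne_zero hA₀ hA₁
  have f1 := f p
  have f2 := f q
  have f3 := f r
  have f4 := f (p + q + r + 1)
  have s1 : sqrtQInt A (q + r + 1) ≠ 0 := sqrtQInt_ne_zero hA₀ hA₁ (by omega)
  have s2 : sqrtQInt A (p + q + 1) ≠ 0 := sqrtQInt_ne_zero hA₀ hA₁ (by omega)
  have i1 : Complex.I ^ ((q : ℤ) + r) ≠ 0 := zpow_ne_zero _ Complex.I_ne_zero
  have i2 : Complex.I ^ ((p : ℤ) + q) ≠ 0 := zpow_ne_zero _ Complex.I_ne_zero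
  calc _ = (Complex.I ^ ((q : ℤ) + r + (p + q) + (p + r) + (p + q) + (q + r) + 0) *
      Complex.I ^ (2 * ((p + q + r : ℕ) : ℤ))) * (triDelta A (q + r) (p + q) (p + r) *
        triDelta A (q + r) (p + q) (p + r)) * qFact A (p + q + r + 1) *
        (1 / sqrtQInt A (q + r + 1) * (1 / sqrtQInt A (p + q + 1))) *
        ((qFact A p)⁻¹ * (qFact A r)⁻¹ * (qFact A q)⁻¹) := by ring
    _ = _ := by
      rw [hI, hD]
      field_simp

end quantum

end

end SpinNetwork

namespace SpinNetwork

noncomputable section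

section quantum

variable {A : ℂ}

/-! ### The pentagon identity with an entry `1/2`, and orthogonality -/

/-- The square of `triDelta A 1 s s'` is the reciprocal of `[s+1] [s'+1]`. Hence the weight of the
summed region disappears up to a phase. -/
theorem regionWeight_mul_triDelta_sq (hA₀ : A ≠ 0) (hA₁ : ‖A‖ < 1) {s s' : ℤ} (hs : 0 ≤ s)
    (hs' : 0 ≤ s') (h : s' = s + 1 ∨ s' = s - 1) :
    regionWeight A s' * (triDelta A 1 s s' * triDelta A 1 s s') * qInt A (s + 1) =
      Complex.I ^ (2 * s') := by
  have f := qFact_ne_zero hA₀ hA₁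
  rcases h with rfl | rfl
  · obtain ⟨n, rfl⟩ := Int.eq_ofNat_of_zero_le hs
    have d := triDelta_mul_self hA₀ hA₁ n 0 1
    simp only [CharP.cast_eq_zero, Nat.cast_one, zero_add, add_zero, qFact_zero,
      qFact_one hA₀ hA₁, mul_one, qFact_succ] at d
    rw [d, regionWeight, show ((n : ℤ) + 1).toNat = n + 1 by omega, neg_one_pow_eq_I]
    have f0 := f n
    have f1 := qInt_ne_zero hA₀ hA₁ (show 0 < (n : ℤ) + 1 by omega)
    have f2 := qInt_ne_zero hA₀ hA₁ (show 0 < (n : ℤ) + 1 + 1 by omega)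
    push_cast
    field_simp
  · obtain ⟨n, rfl⟩ : ∃ n : ℕ, s = n + 1 := ⟨(s - 1).toNat, by omega⟩
    have d := triDelta_mul_self hA₀ hA₁ n 1 0
    simp only [CharP.cast_eq_zero, Nat.cast_one, add_zero, qFact_zero,
      qFact_one hA₀ hA₁, mul_one, qFact_succ] at d
    rw [add_sub_cancel_right, d, regionWeight, Int.toNat_natCast, neg_one_pow_eq_I]
    have f0 := f n
    have f1 := qInt_ne_zero hA₀ hA₁ (show 0 < (n : ℤ) + 1 by omega)
    have f2 := qInt_ne_zero hA₀ hA₁ (show 0 < (n : ℤ) + 1 + 1 by omega)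
    push_cast
    field_simp

/-- All `Δ` that involve `s₁'` cancel between the symbol, the two half tetrahedra and the region
weight. The remaining product of `Δ` does not depend on `s₁'`, so the pentagon becomes a relation
between Racah sums. -/
theorem pentagon_term (hA₀ : A ≠ 0) (hA₁ : ‖A‖ < 1) {c₁ c₂ c₃ s₁ s₂ s₃ s₁' s₂' s₃' : ℤ}
    (hc : AdmTriple c₁ c₂ c₃) (h1 : AdmTriple c₁ s₂' s₃') (h2 : AdmTriple c₂ s₁ s₃)
    (h3 : AdmTriple c₃ s₁ s₂) (hs1 : s₁' = s₁ + 1 ∨ s₁' = s₁ - 1)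
    (hs2 : s₂' = s₂ + 1 ∨ s₂' = s₂ - 1) (hs3 : s₃' = s₃ + 1 ∨ s₃' = s₃ - 1)
    {T₁ T₂ T₃ T₄ Q₁ Q₂ Q₃ : ℤ} (t1 : c₁ + c₂ + c₃ = 2 * T₁) (t2 : c₁ + s₂' + s₃' = 2 * T₂)
    (t3 : s₁' + c₂ + s₃' = 2 * T₃) (t4 : s₁' + s₂' + c₃ = 2 * T₄)
    (q1 : c₁ + c₂ + s₁' + s₂' = 2 * Q₁) (q2 : c₁ + c₃ + s₁' + s₃' = 2 * Q₂)
    (q3 : c₂ + c₃ + s₂' + s₃' = 2 * Q₃) {N : ℕ} (hN : Q₁ < N) :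
    regionWeight A s₁' * tet A c₁ c₂ c₃ s₁' s₂' s₃' * halfTet A c₂ s₁ s₃ s₁' s₃' *
        halfTet A c₃ s₁ s₂ s₁' s₂' * qInt A (s₁ + 1) =
      (triDelta A c₁ c₂ c₃ * triDelta A c₁ s₂' s₃' * triDelta A c₂ s₁ s₃ * triDelta A c₃ s₁ s₂ *
        (triDelta A 1 s₂ s₂' * triDelta A 1 s₃ s₃')) *
      Complex.I ^ (c₁ + c₂ + c₃ + s₁' + s₂' + s₃' + 2 * s₁' + (s₁ + s₃ + 1) + (s₁ + s₂ + 1)) *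
      (halfCoeff A c₂ s₁ s₃ s₁' s₃' * halfCoeff A c₃ s₁ s₂ s₁' s₂' *
        racahSum A N T₁ T₂ T₃ T₄ Q₁ Q₂ Q₃) := by
  by_cases h : AdmTriple c₂ s₁' s₃' ∧ AdmTriple c₃ s₁' s₂'
  · obtain ⟨h2', h3'⟩ := h
    have e2 := halfTet_mul_triDelta hA₀ hA₁ h2 h2' hs1 hs3
    have e3 := halfTet_mul_triDelta hA₀ hA₁ h3 h3' hs1 hs2
    have ew := regionWeight_mul_triDelta_sq hA₀ hA₁ h2.nonneg.2.1 h2'.nonneg.2.1 hs1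
    rw [tet_eq hA₀ hA₁ ⟨hc, h1, h2'.swap, h3'.rotate⟩ t1 t2 t3 t4 q1 q2 q3 hN,
      triDelta_swap c₂ s₁' s₃', triDelta_rotate c₃ s₁' s₂',
      zpow_add₀ Complex.I_ne_zero _ (s₁ + s₂ + 1), zpow_add₀ Complex.I_ne_zero _ (s₁ + s₃ + 1),
      zpow_add₀ Complex.I_ne_zero _ (2 * s₁')]
    calc _ = regionWeight A s₁' * Complex.I ^ (c₁ + c₂ + c₃ + s₁' + s₂' + s₃') *
          (triDelta A c₁ c₂ c₃ * triDelta A c₁ s₂' s₃') *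
          racahSum A N T₁ T₂ T₃ T₄ Q₁ Q₂ Q₃ * qInt A (s₁ + 1) *
          (halfTet A c₂ s₁ s₃ s₁' s₃' * triDelta A c₂ s₁' s₃') *
          (halfTet A c₃ s₁ s₂ s₁' s₂' * triDelta A c₃ s₁' s₂') := by ring
      _ = _ := by
        rw [e2, e3, ← ew]
        ring
  -- If a triple that contains `s₁'` is inadmissible, some `T_i` exceeds some `Q_j`. Both sides
  -- vanish, and the contiguity relations need no case distinction.
  · have hL : halfTet A c₂ s₁ s₃ s₁' s₃' = 0 ∨ halfTet A c₃ s₁ s₂ s₁' s₂' = 0 := by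
      by_contra! hcon
      exact h ⟨(admTriple_of_halfTet_ne_zero hcon.1).2.1, (admTriple_of_halfTet_ne_zero hcon.2).2.1⟩
    have hR : racahSum A N T₁ T₂ T₃ T₄ Q₁ Q₂ Q₃ = 0 := by
      apply racahSum_eq_zero
      simp only [AdmTriple, Int.even_iff] at h
      omega
    rw [hR]
    rcases hL with hL | hL <;> rw [hL] <;> ring

/-- The half tetrahedron is evaluated backwards, from `(s₂', s₃')` to `(s₂, s₃)`. This produces the
same product of `Δ` as in `pentagon_term`. -/
theorem pentagon_rhs (hA₀ : A ≠ 0) (hA₁ : ‖A‖ < 1) {c₁ c₂ c₃ s₁ s₂ s₃ s₂' s₃' : ℤ}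
    (hc : AdmTriple c₁ c₂ c₃) (h1 : AdmTriple c₁ s₂' s₃') (h2 : AdmTriple c₂ s₁ s₃)
    (h3 : AdmTriple c₃ s₁ s₂)
    (hs2 : s₂' = s₂ + 1 ∨ s₂' = s₂ - 1) (hs3 : s₃' = s₃ + 1 ∨ s₃' = s₃ - 1)
    {T₁ T₂ T₃ T₄ Q₁ Q₂ Q₃ : ℤ} (t1 : c₁ + c₂ + c₃ = 2 * T₁) (t2 : c₁ + s₂ + s₃ = 2 * T₂)
    (t3 : s₁ + c₂ + s₃ = 2 * T₃) (t4 : s₁ + s₂ + c₃ = 2 * T₄)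
    (q1 : c₁ + c₂ + s₁ + s₂ = 2 * Q₁) (q2 : c₁ + c₃ + s₁ + s₃ = 2 * Q₂)
    (q3 : c₂ + c₃ + s₂ + s₃ = 2 * Q₃) {N : ℕ} (hN : Q₁ < N) :
    tet A c₁ c₂ c₃ s₁ s₂ s₃ * halfTet A c₁ s₂ s₃ s₂' s₃' =
      (triDelta A c₁ c₂ c₃ * triDelta A c₁ s₂' s₃' * triDelta A c₂ s₁ s₃ * triDelta A c₃ s₁ s₂ *
        (triDelta A 1 s₂ s₂' * triDelta A 1 s₃ s₃')) *
      Complex.I ^ (c₁ + c₂ + c₃ + s₁ + s₂ + s₃ + (s₂' + s₃' + 1)) *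
      (halfCoeff A c₁ s₂' s₃' s₂ s₃ * racahSum A N T₁ T₂ T₃ T₄ Q₁ Q₂ Q₃) := by
  by_cases h : AdmTriple c₁ s₂ s₃
  · have e1 := halfTet_mul_triDelta hA₀ hA₁ h1 h (by omega) (by omega)
    rw [halfTet_symm hA₀ hA₁] at e1
    rw [tet_eq hA₀ hA₁ ⟨hc, h, h2.swap, h3.rotate⟩ t1 t2 t3 t4 q1 q2 q3 hN,
      triDelta_swap c₂ s₁ s₃, triDelta_rotate c₃ s₁ s₂,
      zpow_add₀ Complex.I_ne_zero _ (s₂' + s₃' + 1)]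
    rw [triDelta_swap_right 1 s₂ s₂', triDelta_swap_right 1 s₃ s₃'] at e1
    linear_combination (Complex.I ^ (c₁ + c₂ + c₃ + s₁ + s₂ + s₃) * (triDelta A c₁ c₂ c₃ *
      triDelta A c₂ s₁ s₃ * triDelta A c₃ s₁ s₂) * racahSum A N T₁ T₂ T₃ T₄ Q₁ Q₂ Q₃) * e1
  · have hL : halfTet A c₁ s₂ s₃ s₂' s₃' = 0 := by
      by_contra hcon
      exact h (admTriple_of_halfTet_ne_zero hcon).1
    have hR : racahSum A N T₁ T₂ T₃ T₄ Q₁ Q₂ Q₃ = 0 := by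
      apply racahSum_eq_zero
      simp only [AdmTriple, Int.even_iff] at h
      omega
    rw [hL, hR]
    ring

theorem halfCoeff_up_up {c u v u' v' n : ℤ} (hu : u' = u + 1) (hv : v' = v + 1)
    (hn : (u + v - c) / 2 + 1 = n) : halfCoeff A c u v u' v' = qInt A n := by
  rw [halfCoeff, if_pos hu, if_pos hv, hn]

theorem halfCoeff_up_down {c u v u' v' n : ℤ} (hu : u' = u + 1) (hv : v' = v - 1)
    (hn : (c + u - v) / 2 + 1 = n) : halfCoeff A c u v u' v' = qInt A n := by
  rw [halfCoeff, if_pos hu, if_neg (by omega), hn]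

theorem halfCoeff_down_up {c u v u' v' n : ℤ} (hu : u' = u - 1) (hv : v' = v + 1)
    (hn : (c + v - u) / 2 + 1 = n) : halfCoeff A c u v u' v' = qInt A n := by
  rw [halfCoeff, if_neg (by omega), if_pos hv, hn]

theorem halfCoeff_down_down {c u v u' v' n : ℤ} (hu : u' = u - 1) (hv : v' = v - 1)
    (hn : (c + u + v) / 2 + 1 = n) : halfCoeff A c u v u' v' = -qInt A n := by
  rw [halfCoeff, if_neg (by omega), if_neg (by omega), hn]

/-- One summand of the pentagon identity with an entry `1/2`. -/
def pentagonSummand (A : ℂ) (c₁ c₂ c₃ s₁ s₂ s₃ s₂' s₃' s₁' : ℤ) : ℂ :=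
  regionWeight A s₁' * tet A c₁ c₂ c₃ s₁' s₂' s₃' * halfTet A c₂ s₁ s₃ s₁' s₃' *
    halfTet A c₃ s₁ s₂ s₁' s₂'

theorem pentagonSummand_swap (hA₀ : A ≠ 0) (hA₁ : ‖A‖ < 1) (c₁ c₂ c₃ s₁ s₂ s₃ s₂' s₃' s₁' : ℤ) :
    pentagonSummand A c₁ c₃ c₂ s₁ s₃ s₂ s₃' s₂' s₁' =
      pentagonSummand A c₁ c₂ c₃ s₁ s₂ s₃ s₂' s₃' s₁' := by
  rw [pentagonSummand, pentagonSummand, tet_swap_right hA₀ hA₁ c₁ c₂ c₃ s₁' s₂' s₃']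
  ring

/-- After the common product of `Δ` is split off, the three sign patterns are exactly the three
contiguity relations. -/
theorem pentagon_of_adm (hA₀ : A ≠ 0) (hA₁ : ‖A‖ < 1) {c₁ c₂ c₃ s₁ s₂ s₃ s₂' s₃' : ℤ}
    (hc : AdmTriple c₁ c₂ c₃) (h1 : AdmTriple c₁ s₂' s₃') (h2 : AdmTriple c₂ s₁ s₃)
    (h3 : AdmTriple c₃ s₁ s₂)
    (hs : s₂' = s₂ + 1 ∧ s₃' = s₃ + 1 ∨ s₂' = s₂ - 1 ∧ s₃' = s₃ - 1 ∨
      s₂' = s₂ + 1 ∧ s₃' = s₃ - 1) :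
    pentagonSummand A c₁ c₂ c₃ s₁ s₂ s₃ s₂' s₃' (s₁ + 1) +
        pentagonSummand A c₁ c₂ c₃ s₁ s₂ s₃ s₂' s₃' (s₁ - 1) =
      tet A c₁ c₂ c₃ s₁ s₂ s₃ * halfTet A c₁ s₂ s₃ s₂' s₃' := by
  have hs0 := h2.nonneg.2.1
  have hc0 := hc.nonneg
  have hq := qInt_ne_zero hA₀ hA₁ (show 0 < s₁ + 1 by omega)
  obtain ⟨T₁, T₂, T₃, T₄, Q₁, Q₂, Q₃, t1, t2, t3, t4, q1, q2, q3⟩ :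
      ∃ T₁ T₂ T₃ T₄ Q₁ Q₂ Q₃ : ℤ, c₁ + c₂ + c₃ = 2 * T₁ ∧ c₁ + s₂ + s₃ = 2 * T₂ ∧
      s₁ + c₂ + s₃ = 2 * T₃ ∧ s₁ + s₂ + c₃ = 2 * T₄ ∧ c₁ + c₂ + s₁ + s₂ = 2 * Q₁ ∧
      c₁ + c₃ + s₁ + s₃ = 2 * Q₂ ∧ c₂ + c₃ + s₂ + s₃ = 2 * Q₃ := by
    simp only [AdmTriple, Int.even_iff] at hc h1 h2 h3
    exact ⟨(c₁ + c₂ + c₃) / 2, (c₁ + s₂ + s₃) / 2, (s₁ + c₂ + s₃) / 2, (s₁ + s₂ + c₃) / 2,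
      (c₁ + c₂ + s₁ + s₂) / 2, (c₁ + c₃ + s₁ + s₃) / 2, (c₂ + c₃ + s₂ + s₃) / 2, by omega⟩
  obtain ⟨N, hN⟩ : ∃ N : ℕ, Q₁ + 1 < N := ⟨(Q₁ + 2).toNat, by omega⟩
  have hTQ : T₁ + T₂ + T₃ + T₄ = Q₁ + Q₂ + Q₃ := by omega
  have hsT : s₁ = Q₁ + Q₂ - T₁ - T₂ := by omega
  have hT : 0 ≤ T₁ := by omega
  -- The factor `[s₁+1]` is the one that `pentagon_term` needs to absorb the region weight.
  apply mul_right_cancel₀ hq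
  rw [add_mul, pentagonSummand, pentagonSummand]
  rw [pentagon_rhs hA₀ hA₁ hc h1 h2 h3 (by omega) (by omega) t1 t2 t3 t4 q1 q2 q3
    (show Q₁ < N by omega)]
  rcases hs with ⟨rfl, rfl⟩ | ⟨rfl, rfl⟩ | ⟨rfl, rfl⟩
  · have key := racahSum_contiguous_up hA₀ hA₁ hTQ hsT hT hN
    -- Relative to the right-hand side, the phase is `1` for the summand `s₁ + 1` and `-1` for the
    -- summand `s₁ - 1`.
    rw [pentagon_term hA₀ hA₁ hc h1 h2 h3 (.inl rfl) (.inl rfl) (.inl rfl)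
        (T₁ := T₁) (T₂ := T₂ + 1) (T₃ := T₃ + 1) (T₄ := T₄ + 1) (Q₁ := Q₁ + 1) (Q₂ := Q₂ + 1) (Q₃ := Q₃ + 1) (N := N)
        (by omega) (by omega) (by omega) (by omega) (by omega) (by omega) (by omega) (by omega),
      pentagon_term hA₀ hA₁ hc h1 h2 h3 (.inr rfl) (.inl rfl) (.inl rfl)
        (T₁ := T₁) (T₂ := T₂ + 1) (T₃ := T₃) (T₄ := T₄) (Q₁ := Q₁) (Q₂ := Q₂) (Q₃ := Q₃ + 1) (N := N)
        (by omega) (by omega) (by omega) (by omega) (by omega) (by omega) (by omega) (by omega),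
      I_zpow_congr (b := c₁ + c₂ + c₃ + s₁ + s₂ + s₃ + (s₂ + 1 + (s₃ + 1) + 1))
        (a := _ + 2 * (s₁ + 1) + _ + _) ⟨s₁ + 1, by ring⟩,
      I_zpow_congr_neg (b := c₁ + c₂ + c₃ + s₁ + s₂ + s₃ + (s₂ + 1 + (s₃ + 1) + 1))
        (a := _ + 2 * (s₁ - 1) + _ + _) ⟨s₁ - 1, by ring⟩,
      halfCoeff_down_down (c := c₁) (u := s₂ + 1) (v := s₃ + 1) (u' := s₂) (v' := s₃)
        (n := T₂ + 2) (by omega) (by omega) (by omega),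
      halfCoeff_up_up (c := c₂) (u := s₁) (v := s₃) (u' := s₁ + 1) (v' := s₃ + 1)
        (n := Q₂ - T₁ + 1) (by omega) (by omega) (by omega),
      halfCoeff_up_up (c := c₃) (u := s₁) (v := s₂) (u' := s₁ + 1) (v' := s₂ + 1)
        (n := Q₁ - T₁ + 1) (by omega) (by omega) (by omega),
      halfCoeff_down_up (c := c₂) (u := s₁) (v := s₃) (u' := s₁ - 1) (v' := s₃ + 1)
        (n := Q₃ - T₄ + 1) (by omega) (by omega) (by omega),
      halfCoeff_down_up (c := c₃) (u := s₁) (v := s₂) (u' := s₁ - 1) (v' := s₂ + 1)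
        (n := Q₃ - T₃ + 1) (by omega) (by omega) (by omega)]
    linear_combination (-(triDelta A c₁ c₂ c₃ * triDelta A c₁ (s₂ + 1) (s₃ + 1) * triDelta A c₂ s₁ s₃ *
      triDelta A c₃ s₁ s₂ * (triDelta A 1 s₂ (s₂ + 1) * triDelta A 1 s₃ (s₃ + 1))) *
      Complex.I ^ (c₁ + c₂ + c₃ + s₁ + s₂ + s₃ + (s₂ + 1 + (s₃ + 1) + 1))) * key
  · have key := racahSum_contiguous_down hA₀ hA₁ hTQ hsT hT (show Q₁ < N by omega)
    rw [pentagon_term hA₀ hA₁ hc h1 h2 h3 (.inl rfl) (.inr rfl) (.inr rfl)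
        (T₁ := T₁) (T₂ := T₂ - 1) (T₃ := T₃) (T₄ := T₄) (Q₁ := Q₁) (Q₂ := Q₂) (Q₃ := Q₃ - 1) (N := N)
        (by omega) (by omega) (by omega) (by omega) (by omega) (by omega) (by omega) (by omega),
      pentagon_term hA₀ hA₁ hc h1 h2 h3 (.inr rfl) (.inr rfl) (.inr rfl)
        (T₁ := T₁) (T₂ := T₂ - 1) (T₃ := T₃ - 1) (T₄ := T₄ - 1) (Q₁ := Q₁ - 1) (Q₂ := Q₂ - 1) (Q₃ := Q₃ - 1) (N := N)
        (by omega) (by omega) (by omega) (by omega) (by omega) (by omega) (by omega) (by omega),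
      I_zpow_congr (b := c₁ + c₂ + c₃ + s₁ + s₂ + s₃ + (s₂ - 1 + (s₃ - 1) + 1))
        (a := _ + 2 * (s₁ + 1) + _ + _) ⟨s₁ + 1, by ring⟩,
      I_zpow_congr_neg (b := c₁ + c₂ + c₃ + s₁ + s₂ + s₃ + (s₂ - 1 + (s₃ - 1) + 1))
        (a := _ + 2 * (s₁ - 1) + _ + _) ⟨s₁ - 1, by ring⟩,
      halfCoeff_up_up (c := c₁) (u := s₂ - 1) (v := s₃ - 1) (u' := s₂) (v' := s₃)
        (n := Q₃ - T₁) (by omega) (by omega) (by omega),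
      halfCoeff_up_down (c := c₂) (u := s₁) (v := s₃) (u' := s₁ + 1) (v' := s₃ - 1)
        (n := Q₁ - T₂ + 1) (by omega) (by omega) (by omega),
      halfCoeff_up_down (c := c₃) (u := s₁) (v := s₂) (u' := s₁ + 1) (v' := s₂ - 1)
        (n := Q₂ - T₂ + 1) (by omega) (by omega) (by omega),
      halfCoeff_down_down (c := c₂) (u := s₁) (v := s₃) (u' := s₁ - 1) (v' := s₃ - 1)
        (n := T₃ + 1) (by omega) (by omega) (by omega),
      halfCoeff_down_down (c := c₃) (u := s₁) (v := s₂) (u' := s₁ - 1) (v' := s₂ - 1)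
        (n := T₄ + 1) (by omega) (by omega) (by omega)]
    linear_combination (-(triDelta A c₁ c₂ c₃ * triDelta A c₁ (s₂ - 1) (s₃ - 1) * triDelta A c₂ s₁ s₃ *
      triDelta A c₃ s₁ s₂ * (triDelta A 1 s₂ (s₂ - 1) * triDelta A 1 s₃ (s₃ - 1))) *
      Complex.I ^ (c₁ + c₂ + c₃ + s₁ + s₂ + s₃ + (s₂ - 1 + (s₃ - 1) + 1))) * key
  · have key := racahSum_contiguous_mixed hA₀ hA₁ hTQ hsT hT hN
    rw [pentagon_term hA₀ hA₁ hc h1 h2 h3 (.inl rfl) (.inl rfl) (.inr rfl)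
        (T₁ := T₁) (T₂ := T₂) (T₃ := T₃) (T₄ := T₄ + 1) (Q₁ := Q₁ + 1) (Q₂ := Q₂) (Q₃ := Q₃) (N := N)
        (by omega) (by omega) (by omega) (by omega) (by omega) (by omega) (by omega) (by omega),
      pentagon_term hA₀ hA₁ hc h1 h2 h3 (.inr rfl) (.inl rfl) (.inr rfl)
        (T₁ := T₁) (T₂ := T₂) (T₃ := T₃ - 1) (T₄ := T₄) (Q₁ := Q₁) (Q₂ := Q₂ - 1) (Q₃ := Q₃) (N := N)
        (by omega) (by omega) (by omega) (by omega) (by omega) (by omega) (by omega) (by omega),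
      I_zpow_congr (b := c₁ + c₂ + c₃ + s₁ + s₂ + s₃ + (s₂ + 1 + (s₃ - 1) + 1))
        (a := _ + 2 * (s₁ + 1) + _ + _) ⟨s₁ + 1, by ring⟩,
      I_zpow_congr_neg (b := c₁ + c₂ + c₃ + s₁ + s₂ + s₃ + (s₂ + 1 + (s₃ - 1) + 1))
        (a := _ + 2 * (s₁ - 1) + _ + _) ⟨s₁ - 1, by ring⟩,
      halfCoeff_down_up (c := c₁) (u := s₂ + 1) (v := s₃ - 1) (u' := s₂) (v' := s₃)
        (n := Q₂ - T₄) (by omega) (by omega) (by omega),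
      halfCoeff_up_down (c := c₂) (u := s₁) (v := s₃) (u' := s₁ + 1) (v' := s₃ - 1)
        (n := Q₁ - T₂ + 1) (by omega) (by omega) (by omega),
      halfCoeff_up_up (c := c₃) (u := s₁) (v := s₂) (u' := s₁ + 1) (v' := s₂ + 1)
        (n := Q₁ - T₁ + 1) (by omega) (by omega) (by omega),
      halfCoeff_down_down (c := c₂) (u := s₁) (v := s₃) (u' := s₁ - 1) (v' := s₃ - 1)
        (n := T₃ + 1) (by omega) (by omega) (by omega),
      halfCoeff_down_up (c := c₃) (u := s₁) (v := s₂) (u' := s₁ - 1) (v' := s₂ + 1)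
        (n := Q₃ - T₃ + 1) (by omega) (by omega) (by omega)]
    linear_combination (-(triDelta A c₁ c₂ c₃ * triDelta A c₁ (s₂ + 1) (s₃ - 1) * triDelta A c₂ s₁ s₃ *
      triDelta A c₃ s₁ s₂ * (triDelta A 1 s₂ (s₂ + 1) * triDelta A 1 s₃ (s₃ - 1))) *
      Complex.I ^ (c₁ + c₂ + c₃ + s₁ + s₂ + s₃ + (s₂ + 1 + (s₃ - 1) + 1))) * key

/-- The pentagon identity (Biedenharn and Elliott) in which one color is `1/2`. -/
theorem pentagon (hA₀ : A ≠ 0) (hA₁ : ‖A‖ < 1) {c₁ c₂ c₃ s₁ s₂ s₃ s₂' s₃' : ℤ}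
    (hs2 : s₂' = s₂ + 1 ∨ s₂' = s₂ - 1) (hs3 : s₃' = s₃ + 1 ∨ s₃' = s₃ - 1) :
    pentagonSummand A c₁ c₂ c₃ s₁ s₂ s₃ s₂' s₃' (s₁ + 1) +
        pentagonSummand A c₁ c₂ c₃ s₁ s₂ s₃ s₂' s₃' (s₁ - 1) =
      tet A c₁ c₂ c₃ s₁ s₂ s₃ * halfTet A c₁ s₂ s₃ s₂' s₃' := by
  by_cases h : AdmTriple c₁ c₂ c₃ ∧ AdmTriple c₁ s₂' s₃' ∧ AdmTriple c₂ s₁ s₃ ∧ AdmTriple c₃ s₁ s₂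
  · obtain ⟨hc, h1, h2, h3⟩ := h
    rcases hs2 with hs2 | hs2 <;> rcases hs3 with hs3 | hs3
    · exact pentagon_of_adm hA₀ hA₁ hc h1 h2 h3 (.inl ⟨hs2, hs3⟩)
    · exact pentagon_of_adm hA₀ hA₁ hc h1 h2 h3 (.inr (.inr ⟨hs2, hs3⟩))
    -- The fourth sign pattern is the mixed one, reflected by exchanging the indices `2` and `3`.
    · have := pentagon_of_adm hA₀ hA₁ hc.swap_right h1.swap_right h3 h2 (.inr (.inr ⟨hs3, hs2⟩))
      rwa [pentagonSummand_swap hA₀ hA₁ _ _ _ _ _ _ _ _ (s₁ + 1),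
        pentagonSummand_swap hA₀ hA₁ _ _ _ _ _ _ _ _ (s₁ - 1), tet_swap_right hA₀ hA₁,
        halfTet_swap hA₀ hA₁] at this
    · exact pentagon_of_adm hA₀ hA₁ hc h1 h2 h3 (.inr (.inl ⟨hs2, hs3⟩))
  -- If one of the four triples not involving `s₁'` is inadmissible, it makes every summand and the
  -- right-hand side vanish.
  · have hL : ∀ x, pentagonSummand A c₁ c₂ c₃ s₁ s₂ s₃ s₂' s₃' x = 0 := by
      intro x
      by_contra hx
      have h1 := right_ne_zero_of_mul hx
      have h2 := right_ne_zero_of_mul (left_ne_zero_of_mul hx)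
      have h3 := right_ne_zero_of_mul (left_ne_zero_of_mul (left_ne_zero_of_mul hx))
      exact h ⟨(admTet_of_ne_zero h3).1, (admTet_of_ne_zero h3).2.1,
        (admTriple_of_halfTet_ne_zero h2).1, (admTriple_of_halfTet_ne_zero h1).1⟩
    rw [hL, hL, add_zero]
    by_contra hx
    have h1 := right_ne_zero_of_mul (Ne.symm hx)
    have h3 := admTet_of_ne_zero (left_ne_zero_of_mul (Ne.symm hx))
    exact h ⟨h3.1, (admTriple_of_halfTet_ne_zero h1).2.1, h3.2.2.1.swap, h3.2.2.2.rotate.rotate⟩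

/-- The evaluations from `(c,u,v)` to `(c,u',v')` and back are multiplied: `Δ(c,u,v)` and
`Δ(c,u',v')` cancel, and only rational factors and phases remain. -/
theorem halfTet_sq (hA₀ : A ≠ 0) (hA₁ : ‖A‖ < 1) {c u v u' v' : ℤ}
    (h : AdmTriple c u v) (h' : AdmTriple c u' v') (hu : u' = u + 1 ∨ u' = u - 1)
    (hv : v' = v + 1 ∨ v' = v - 1) :
    halfTet A c u v u' v' * halfTet A c u v u' v' =
      (triDelta A 1 u u' * triDelta A 1 u u') * (triDelta A 1 v v' * triDelta A 1 v v') *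
        Complex.I ^ (u + v + 1 + (u' + v' + 1)) *
        (halfCoeff A c u v u' v' * halfCoeff A c u' v' u v) := by
  have d := triDelta_ne_zero hA₀ hA₁ c u v
  have d' := triDelta_ne_zero hA₀ hA₁ c u' v'
  have e := halfTet_mul_triDelta hA₀ hA₁ h h' hu hv
  have e' := halfTet_mul_triDelta hA₀ hA₁ h' h (by omega) (by omega)
  rw [halfTet_symm hA₀ hA₁, triDelta_swap_right 1 u u', triDelta_swap_right 1 v v'] at e'
  apply mul_right_cancel₀ d
  apply mul_right_cancel₀ d'
  rw [zpow_add₀ Complex.I_ne_zero]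
  linear_combination e' * halfTet A c u v u' v' * triDelta A c u' v' +
    e * (triDelta A c u' v' * (triDelta A 1 u u' * triDelta A 1 v v') *
        (Complex.I ^ (u' + v' + 1) * halfCoeff A c u' v' u v))

end quantum

end

end SpinNetwork

namespace SpinNetwork

noncomputable section

section quantum

variable {A : ℂ}

theorem orthogonality_term (hA₀ : A ≠ 0) (hA₁ : ‖A‖ < 1) {c u v u' v' : ℤ} (hu0 : 0 ≤ u)
    (h' : AdmTriple c u' v') (hu : u = u' + 1 ∨ u = u' - 1) (hv : v = v' + 1 ∨ v = v' - 1) :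
    regionWeight A u' * (regionWeight A v * (halfTet A c u v u' v' * halfTet A c u v u' v')) *
        (qInt A (u + 1) * qInt A (v' + 1)) =
      Complex.I ^ (2 * u' + 2 * v + (u + v + 1 + (u' + v' + 1))) *
        (halfCoeff A c u v u' v' * halfCoeff A c u' v' u v) := by
  by_cases h : AdmTriple c u v
  · have w1 := regionWeight_mul_triDelta_sq hA₀ hA₁ hu0 h'.nonneg.2.1 (by omega)
    have w2 := regionWeight_mul_triDelta_sq hA₀ hA₁ h'.nonneg.2.2 h.nonneg.2.2 hv
    rw [triDelta_swap_right 1 v v'] at w2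
    rw [halfTet_sq hA₀ hA₁ h h' (by omega) (by omega), zpow_add₀ Complex.I_ne_zero (2 * u' + 2 * v),
      zpow_add₀ Complex.I_ne_zero (2 * u'), ← w1, ← w2]
    ring
  · have hX : halfTet A c u v u' v' = 0 := by
      by_contra hX
      exact h (admTriple_of_halfTet_ne_zero hX).1
    -- An inadmissible neighbor of an admissible pair lies just outside the boundary, where the
    -- quantum integer in `halfCoeff` is `[0]`.
    have hη : halfCoeff A c u v u' v' = 0 := by
      simp only [AdmTriple, Int.even_iff] at h h'
      rcases hu with rfl | rfl <;> rcases hv with rfl | rfl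
      · omega
      · rw [halfCoeff_down_up (n := 0) (by omega) (by omega) (by omega), qInt_zero]
      · rw [halfCoeff_up_down (n := 0) (by omega) (by omega) (by omega), qInt_zero]
      · rw [halfCoeff_up_up (n := 0) (by omega) (by omega) (by omega), qInt_zero]
    rw [hX, hη]
    ring

/-- Multiplication by `[u+1] [v'+1]` turns both terms into products of two quantum integers, and the
claim becomes `qInt_mul_qInt`. -/
theorem orthogonality_diag (hA₀ : A ≠ 0) (hA₁ : ‖A‖ < 1) {c u u' v' : ℤ} (hu0 : 0 ≤ u)
    (h' : AdmTriple c u' v') (hu : u = u' + 1 ∨ u = u' - 1) :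
    regionWeight A u' *
      (regionWeight A (v' + 1) * (halfTet A c u (v' + 1) u' v' * halfTet A c u (v' + 1) u' v') +
        regionWeight A (v' - 1) * (halfTet A c u (v' - 1) u' v' * halfTet A c u (v' - 1) u' v')) =
      1 := by
  have hv0 := h'.nonneg.2.2
  have q1 := qInt_ne_zero hA₀ hA₁ (show 0 < u + 1 by omega)
  have q2 := qInt_ne_zero hA₀ hA₁ (show 0 < v' + 1 by omega)
  apply mul_right_cancel₀ (mul_ne_zero q1 q2)
  rw [mul_add, add_mul, orthogonality_term hA₀ hA₁ hu0 h' hu (.inl rfl),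
    orthogonality_term hA₀ hA₁ hu0 h' hu (.inr rfl)]
  obtain ⟨x, y, z, rfl, rfl, rfl⟩ := h'.exists_param
  rcases hu with rfl | rfl
  · rw [halfCoeff_down_down (n := x + y + z + 2) (by omega) (by omega) (by omega),
      halfCoeff_up_up (n := x + 1) (by omega) (by omega) (by omega),
      halfCoeff_down_up (n := z) (by omega) (by omega) (by omega),
      halfCoeff_up_down (n := y + 1) (by omega) (by omega) (by omega),
      I_zpow_congr_neg (b := 0) ⟨2 * x + y + z + 1, by ring⟩,
      I_zpow_congr (b := 0) (a := _ + 2 * ((x : ℤ) + z - 1) + _) ⟨2 * x + y + z, by ring⟩,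
      qInt_mul_of_eq hA₀ (p := (x : ℤ) + y + 1 + 1) (q := x + z + 1) (c := x + 1) (a := y + 1)
        (b := z) (r := x + y + z + 2) (by ring) (by ring) (by ring), zpow_zero]
    ring
  · rw [halfCoeff_up_down (n := y) (by omega) (by omega) (by omega),
      halfCoeff_down_up (n := z + 1) (by omega) (by omega) (by omega),
      halfCoeff_up_up (n := x) (by omega) (by omega) (by omega),
      halfCoeff_down_down (n := x + y + z + 1) (by omega) (by omega) (by omega),
      I_zpow_congr (b := 0) ⟨2 * x + y + z + 1, by ring⟩,
      I_zpow_congr_neg (b := 0) (a := _ + 2 * ((x : ℤ) + z - 1) + _) ⟨2 * x + y + z - 1, by ring⟩,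
      qInt_mul_of_eq hA₀ (p := (x : ℤ) + y - 1 + 1) (q := x + z + 1) (c := x) (a := y)
        (b := z + 1) (r := x + y + z + 1) (by ring) (by ring) (by ring), zpow_zero]
    ring

/-- The two terms have equal products of coefficients and opposite phases. Admissibility on both
sides of `u` makes both intermediate triples admissible. -/
theorem orthogonality_off_diag (hA₀ : A ≠ 0) (hA₁ : ‖A‖ < 1) {c u v' : ℤ}
    (h' : AdmTriple c (u - 1) v') (h'' : AdmTriple c (u + 1) v') :
    regionWeight A (v' + 1) *
        (halfTet A c u (v' + 1) (u - 1) v' * halfTet A c u (v' + 1) (u + 1) v') +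
      regionWeight A (v' - 1) *
        (halfTet A c u (v' - 1) (u - 1) v' * halfTet A c u (v' - 1) (u + 1) v') = 0 := by
  have hv0 := h'.nonneg.2.2
  have q2 := qInt_ne_zero hA₀ hA₁ (show 0 < v' + 1 by omega)
  have hd := triDelta_ne_zero hA₀ hA₁
  have term : ∀ v, (v = v' + 1 ∨ v = v' - 1) → AdmTriple c u v →
      regionWeight A v * (halfTet A c u v (u - 1) v' * halfTet A c u v (u + 1) v') *
        (qInt A (v' + 1) * triDelta A c (u + 1) v') =
      triDelta A c (u - 1) v' * (triDelta A 1 u (u + 1) * triDelta A 1 u (u - 1)) *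
        Complex.I ^ (2 * v + (u + v + 1) + (u - 1 + v' + 1)) *
        (halfCoeff A c u v (u + 1) v' * halfCoeff A c (u - 1) v' u v) := by
    intro v hv h
    have w2 := regionWeight_mul_triDelta_sq hA₀ hA₁ hv0 h.nonneg.2.2 hv
    have e1 := halfTet_mul_triDelta hA₀ hA₁ h h'' (.inl rfl) (by omega)
    have e2 := halfTet_mul_triDelta hA₀ hA₁ h' h (by omega) hv
    rw [halfTet_symm hA₀ hA₁] at e2
    rw [triDelta_swap_right 1 v v'] at w2
    rw [triDelta_swap_right 1 v v'] at e2
    apply mul_right_cancel₀ (hd c u v)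
    calc _ = regionWeight A v * qInt A (v' + 1) *
          (halfTet A c u v (u - 1) v' * triDelta A c u v) *
          (halfTet A c u v (u + 1) v' * triDelta A c (u + 1) v') := by ring
      _ = _ := by
        rw [e1, e2, zpow_add₀ Complex.I_ne_zero _ (u - 1 + v' + 1),
          zpow_add₀ Complex.I_ne_zero (2 * v), ← w2, triDelta_swap_right 1 (u - 1) u]
        ring
  have a1 : AdmTriple c u (v' + 1) := by
    simp only [AdmTriple, Int.even_iff] at *; omega
  have a2 : AdmTriple c u (v' - 1) := by
    simp only [AdmTriple, Int.even_iff] at *; omega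
  have hpar : (c + u + v') % 2 = 1 := by
    simp only [AdmTriple, Int.even_iff] at *; omega
  apply mul_right_cancel₀ (mul_ne_zero q2 (hd c (u + 1) v'))
  rw [add_mul, term _ (.inl rfl) a1, term _ (.inr rfl) a2,
    halfCoeff_up_down (n := (c + u - v' + 1) / 2) (by omega) (by omega) (by omega),
    halfCoeff_up_up (n := (u + v' - c + 1) / 2) (by omega) (by omega) (by omega),
    halfCoeff_up_up (n := (u + v' - c + 1) / 2) (by omega) (by omega) (by omega),
    halfCoeff_up_down (n := (c + u - v' + 1) / 2) (by omega) (by omega) (by omega),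
    I_zpow_congr_neg (b := 2 * (v' - 1) + (u + (v' - 1) + 1) + (u - 1 + v' + 1)) ⟨1, by ring⟩]
  ring

/-- Orthogonality of `6j`-symbols with an entry `1/2`. -/
theorem orthogonality (hA₀ : A ≠ 0) (hA₁ : ‖A‖ < 1) {c u u' u'' v' : ℤ} (hu0 : 0 ≤ u)
    (h' : AdmTriple c u' v') (hu' : u' = u + 1 ∨ u' = u - 1) (hu'' : u'' = u + 1 ∨ u'' = u - 1) :
    regionWeight A u' *
      (regionWeight A (v' + 1) * (halfTet A c u (v' + 1) u' v' * halfTet A c u (v' + 1) u'' v') +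
        regionWeight A (v' - 1) * (halfTet A c u (v' - 1) u' v' * halfTet A c u (v' - 1) u'' v')) =
      if u'' = u' then 1 else 0 := by
  split_ifs with h
  · rw [h]
    exact orthogonality_diag hA₀ hA₁ hu0 h' (by omega)
  · by_cases h'' : AdmTriple c u'' v'
    · rcases hu' with rfl | rfl <;> rcases hu'' with rfl | rfl
      · exact absurd rfl h
      · rw [mul_comm (halfTet A c u (v' + 1) _ v'), mul_comm (halfTet A c u (v' - 1) _ v'),
          orthogonality_off_diag hA₀ hA₁ h'' h', mul_zero]
      · rw [orthogonality_off_diag hA₀ hA₁ h' h'', mul_zero]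
      · exact absurd rfl h
    · have hX : ∀ v, halfTet A c u v u'' v' = 0 := by
        intro v
        by_contra hX
        exact h'' (admTriple_of_halfTet_ne_zero hX).2.1
      rw [hX, hX]
      ring

/-! ### The quotients of tetrahedra in the recursions -/

/-- The denominator is a theta graph by `tet_zero`, so the quotient is a half tetrahedron normalized
by roots of region weights. Its phase is its own inverse, as `I ^ (4 * b) = 1`. -/
theorem vQuot_eq (hA₀ : A ≠ 0) (hA₁ : ‖A‖ < 1) (a a₁ b a' a₁' : ℤ) :
    vQuot A a a₁ b a' a₁' = Complex.I ^ (2 * b) *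
      (sqrtRegionWeight A a' * sqrtRegionWeight A a₁') * halfTet A b a a₁ a' a₁' := by
  have e : tet A a a₁ b a₁' a' 1 = halfTet A b a a₁ a' a₁' := by
    rw [halfTet, tet_swap hA₀ hA₁ a b a₁ a₁' 1 a', tet_swap_right hA₀ hA₁ a b a₁ a₁' 1 a']
  rw [vQuot, e]
  by_cases h : halfTet A b a a₁ a' a₁' = 0
  · rw [h]; simp
  · have hadm := (admTriple_of_halfTet_ne_zero h).2.1.rotate
    have s1 := sqrtRegionWeight_ne_zero hA₀ hA₁ hadm.nonneg.1
    have s2 := sqrtRegionWeight_ne_zero hA₀ hA₁ hadm.nonneg.2.1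
    have hI : Complex.I ^ (2 * b) ≠ 0 := zpow_ne_zero _ Complex.I_ne_zero
    have hI2 : Complex.I ^ (2 * b) * Complex.I ^ (2 * b) = 1 := by
      rw [← zpow_add₀ Complex.I_ne_zero, I_zpow_congr (b := 0) ⟨b, by ring⟩, zpow_zero]
    rw [tet_zero hA₀ hA₁ hadm]
    field_simp
    rw [pow_two, hI2]

end quantum

end

end SpinNetwork

namespace SpinNetwork

noncomputable section

section quantum

variable {A : ℂ}

/-! ### The first-order circle relation around a triangle, and the three-term recursion -/

/-- The integers at distance `1` from `x`. -/
def nbr (x : ℤ) : Finset ℤ := {x + 1, x - 1}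

theorem mem_nbr {x y : ℤ} : y ∈ nbr x ↔ y = x + 1 ∨ y = x - 1 := by simp [nbr]

theorem mem_nbr_comm {x y : ℤ} : y ∈ nbr x ↔ x ∈ nbr y := by
  simp only [mem_nbr]; omega

theorem sum_nbr (x : ℤ) (f : ℤ → ℂ) : ∑ y ∈ nbr x, f y = f (x + 1) + f (x - 1) :=
  Finset.sum_pair (by omega)

/-- Being neighbors is symmetric, but a shift by one may leave a finite range. The condition on the
support makes the interchange legitimate. -/
theorem sum_sum_nbr_comm {S S' : Finset ℤ} {G : ℤ → ℤ → ℂ}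
    (hG : ∀ u u', G u u' ≠ 0 → u ∈ S ∧ u' ∈ S') :
    ∑ u ∈ S, ∑ u' ∈ nbr u, G u u' = ∑ u' ∈ S', ∑ u ∈ nbr u', G u u' := by
  rw [Finset.sum_sigma', Finset.sum_sigma']
  refine Finset.sum_bij_ne_zero (fun p _ _ => ⟨p.2, p.1⟩) ?_ ?_ ?_ ?_
  · rintro ⟨u, u'⟩ h hne
    rw [Finset.mem_sigma] at h ⊢
    exact ⟨(hG _ _ hne).2, mem_nbr_comm.1 h.2⟩
  · rintro ⟨u, u'⟩ _ _ ⟨w, w'⟩ _ _ h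
    simp only [Sigma.mk.injEq, heq_eq_eq] at h ⊢
    exact ⟨h.2, h.1⟩
  · rintro ⟨u', u⟩ h hne
    rw [Finset.mem_sigma] at h
    exact ⟨⟨u, u'⟩, Finset.mem_sigma.2 ⟨(hG _ _ hne).1, mem_nbr_comm.1 h.2⟩, hne, rfl⟩
  · intros; rfl

theorem pentagon_sum (hA₀ : A ≠ 0) (hA₁ : ‖A‖ < 1) {c₁ c₂ c₃ s₁ s₂ s₃ s₂' s₃' : ℤ}
    (hs2 : s₂' ∈ nbr s₂) (hs3 : s₃' ∈ nbr s₃) :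
    ∑ s₁' ∈ nbr s₁, regionWeight A s₁' * tet A c₁ c₂ c₃ s₁' s₂' s₃' * halfTet A c₂ s₁ s₃ s₁' s₃' *
        halfTet A c₃ s₁ s₂ s₁' s₂' =
      tet A c₁ c₂ c₃ s₁ s₂ s₃ * halfTet A c₁ s₂ s₃ s₂' s₃' := by
  rw [sum_nbr, ← pentagon hA₀ hA₁ (mem_nbr.1 hs2) (mem_nbr.1 hs3)]
  rfl

theorem orthogonality_sum (hA₀ : A ≠ 0) (hA₁ : ‖A‖ < 1) {c u u' u'' v' : ℤ} (hu0 : 0 ≤ u)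
    (h' : AdmTriple c u' v') (hu' : u' ∈ nbr u) (hu'' : u'' ∈ nbr u) :
    ∑ v ∈ nbr v', regionWeight A v * (halfTet A c u v u' v' * halfTet A c u v u'' v') =
      if u'' = u' then (regionWeight A u')⁻¹ else 0 := by
  have h := orthogonality hA₀ hA₁ hu0 h' (mem_nbr.1 hu') (mem_nbr.1 hu'')
  have hw := regionWeight_ne_zero hA₀ hA₁ h'.nonneg.2.1
  rw [sum_nbr]
  apply mul_left_cancel₀ hw
  rw [h]
  split_ifs
  · rw [mul_inv_cancel₀ hw]
  · rw [mul_zero]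

/-- The first-order relation obtained by fusing a circle of color `1/2` with the three sides of a
triangle; `b₀`, `b₁`, `b₂` are the colors of the other edges at the corners. -/
def CircleRelation (A : ℂ) (b₀ b₁ b₂ : ℤ) (B : ℤ → ℤ → ℤ → ℂ) : Prop :=
  ∀ a₀ a₁ a₂ a₀' a₂' : ℤ, a₀' ∈ nbr a₀ → a₂' ∈ nbr a₂ →
    halfTet A b₂ a₂ a₀ a₂' a₀' * B a₀ a₁ a₂ =
      ∑ a₁' ∈ nbr a₁, regionWeight A a₁' *
        (halfTet A b₀ a₀ a₁ a₀' a₁' * halfTet A b₁ a₁ a₂ a₁' a₂') * B a₀' a₁' a₂'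

theorem tet_opposite (hA₀ : A ≠ 0) (hA₁ : ‖A‖ < 1) (a₀ a₁ a₂ b₀ b₁ b₂ : ℤ) :
    tet A a₀ a₁ b₀ b₁ b₂ a₂ = tet A b₂ b₁ b₀ a₁ a₀ a₂ := by
  rw [tet_swap hA₀ hA₁ b₁ b₂ b₀ a₀ a₁ a₂, ← tet_swap_right hA₀ hA₁ b₁ b₂ b₀,
    ← tet_swap hA₀ hA₁ b₁ b₀ b₂, tet_flip hA₀ hA₁ b₀ a₀ a₁ a₂ b₁ b₂,
    ← tet_swap hA₀ hA₁ b₀ a₀, tet_swap_right hA₀ hA₁ a₀ a₁ b₀]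

/-- In the position of `tet_opposite` this is the pentagon identity, with `a₁` as the color that is
summed over. -/
theorem circleRelation_tet (hA₀ : A ≠ 0) (hA₁ : ‖A‖ < 1) (b₀ b₁ b₂ : ℤ) :
    CircleRelation A b₀ b₁ b₂ fun a₀ a₁ a₂ => tet A a₀ a₁ b₀ b₁ b₂ a₂ := by
  intro a₀ a₁ a₂ a₀' a₂' h0 h2
  simp only [tet_opposite hA₀ hA₁]
  rw [mul_comm, halfTet_swap hA₀ hA₁ b₂ a₀ a₂ a₀' a₂', ← pentagon_sum hA₀ hA₁ h0 h2]
  refine Finset.sum_congr rfl fun a₁' _ => ?_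
  rw [halfTet_swap hA₀ hA₁ b₀ a₀ a₁ a₀' a₁']
  ring

/-- The state sum over the state of a triangular region with sides `a₀`, `a₁`, `a₂`, the states of the
regions on the other sides being `t₀`, `t₁`, `t₂`. -/
def triangleSum (A : ℂ) (b₀ b₁ b₂ t₀ t₁ t₂ a₀ a₁ a₂ : ℤ) : ℂ :=
  ∑ u ∈ Finset.Icc 0 (a₀ + t₀), regionWeight A u *
    (tet A b₀ t₁ t₀ u a₀ a₁ * tet A b₁ t₂ t₁ u a₁ a₂ * tet A b₂ t₀ t₂ u a₂ a₀)

/-- The pentagon is used once per corner: at `b₂` it creates a new face state `u'`, at `b₀` it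
creates the new color `a₁'`, and at `b₁` it is read backwards to sum out the old state `u`. -/
theorem circleRelation_triangleSum (hA₀ : A ≠ 0) (hA₁ : ‖A‖ < 1) (b₀ b₁ b₂ t₀ t₁ t₂ : ℤ) :
    CircleRelation A b₀ b₁ b₂ (triangleSum A b₀ b₁ b₂ t₀ t₁ t₂) := by
  intro a₀ a₁ a₂ a₀' a₂' h0 h2
  have hT0 : ∀ u a₀ a₁, tet A b₀ t₁ t₀ u a₀ a₁ = tet A t₀ b₀ t₁ a₁ u a₀ := fun u a₀ a₁ => by
    rw [← tet_swap_right hA₀ hA₁ b₀ t₁ t₀, tet_swap hA₀ hA₁ t₀ b₀ t₁]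
  have step1 : halfTet A b₂ a₂ a₀ a₂' a₀' * triangleSum A b₀ b₁ b₂ t₀ t₁ t₂ a₀ a₁ a₂ =
      ∑ u ∈ Finset.Icc 0 (a₀ + t₀), ∑ u' ∈ nbr u, regionWeight A u * regionWeight A u' *
        (tet A b₀ t₁ t₀ u a₀ a₁ * tet A b₁ t₂ t₁ u a₁ a₂ * tet A b₂ t₀ t₂ u' a₂' a₀' *
          halfTet A t₀ u a₀ u' a₀' * halfTet A t₂ u a₂ u' a₂') := by
    rw [triangleSum, Finset.mul_sum]
    refine Finset.sum_congr rfl fun u _ => ?_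
    have h := pentagon_sum hA₀ hA₁ (c₁ := b₂) (c₂ := t₀) (c₃ := t₂) (s₁ := u) h2 h0
    calc _ = regionWeight A u * (tet A b₀ t₁ t₀ u a₀ a₁ * tet A b₁ t₂ t₁ u a₁ a₂) *
          (tet A b₂ t₀ t₂ u a₂ a₀ * halfTet A b₂ a₂ a₀ a₂' a₀') := by ring
      _ = _ := by
        rw [← h, Finset.mul_sum]
        refine Finset.sum_congr rfl fun u' _ => ?_
        ring
  -- The half tetrahedron at `t₀` confines `u` and `u'` to the two intervals.
  rw [step1, sum_sum_nbr_comm (S' := Finset.Icc 0 (a₀' + t₀))]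
  · have step2 : ∀ u' ∈ Finset.Icc 0 (a₀' + t₀), ∀ u ∈ nbr u',
        regionWeight A u * regionWeight A u' *
        (tet A b₀ t₁ t₀ u a₀ a₁ * tet A b₁ t₂ t₁ u a₁ a₂ * tet A b₂ t₀ t₂ u' a₂' a₀' *
          halfTet A t₀ u a₀ u' a₀' * halfTet A t₂ u a₂ u' a₂') =
        ∑ a₁' ∈ nbr a₁, regionWeight A a₁' * halfTet A b₀ a₀ a₁ a₀' a₁' *
          (regionWeight A u' * (tet A b₀ t₁ t₀ u' a₀' a₁' * tet A b₂ t₀ t₂ u' a₂' a₀')) *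
          (regionWeight A u * tet A b₁ t₂ t₁ u a₁ a₂ * halfTet A t₂ u' a₂' u a₂ *
            halfTet A t₁ u' a₁' u a₁) := by
      intro u' _ u hu
      have h := pentagon_sum hA₀ hA₁ (c₁ := t₀) (c₂ := b₀) (c₃ := t₁) (s₁ := a₁)
        (mem_nbr_comm.1 hu) h0
      calc _ = regionWeight A u * regionWeight A u' * (tet A b₁ t₂ t₁ u a₁ a₂ *
            tet A b₂ t₀ t₂ u' a₂' a₀' * halfTet A t₂ u a₂ u' a₂') *
            (tet A t₀ b₀ t₁ a₁ u a₀ * halfTet A t₀ u a₀ u' a₀') := by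
            rw [hT0]; ring
        _ = _ := by
          rw [← h, Finset.mul_sum]
          refine Finset.sum_congr rfl fun a₁' _ => ?_
          rw [hT0, halfTet_swap hA₀ hA₁ b₀ a₀ a₁ a₀' a₁', halfTet_swap hA₀ hA₁ t₁ u a₁ u' a₁',
            halfTet_symm hA₀ hA₁ t₂ u a₂ u' a₂', halfTet_symm hA₀ hA₁ t₁ u a₁ u' a₁']
          ring
    rw [Finset.sum_congr rfl fun u' hu' => Finset.sum_congr rfl (step2 u' hu')]
    rw [Finset.sum_congr rfl fun u' _ => Finset.sum_comm]
    rw [Finset.sum_comm]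
    refine Finset.sum_congr rfl fun a₁' ha₁' => ?_
    rw [triangleSum, Finset.mul_sum]
    refine Finset.sum_congr rfl fun u' _ => ?_
    rw [← Finset.mul_sum, pentagon_sum hA₀ hA₁ (c₁ := b₁) (c₂ := t₂) (c₃ := t₁) (s₁ := u')
      (mem_nbr_comm.1 ha₁') (mem_nbr_comm.1 h2), halfTet_symm hA₀ hA₁ b₁ a₁ a₂ a₁' a₂']
    ring
  · intro u u' hne
    have h := admTriple_of_halfTet_ne_zero (right_ne_zero_of_mul
      (left_ne_zero_of_mul (right_ne_zero_of_mul hne)))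
    have h1 := h.1.nonneg
    have h2 := h.2.1.nonneg
    have h3 := h.1.2.2.1
    have h4 := h.2.1.2.2.1
    have h5 := h.1.2.1
    simp only [AdmTriple] at h
    rw [Finset.mem_Icc, Finset.mem_Icc]
    omega

/-- The circle relation in terms of `𝕍`. The root of the weight of the middle side occurs once in
each factor of `tetK`, which gives the weight in the sum; the other roots and the phases are common
factors. -/
theorem CircleRelation.tetZ_mul (hA₀ : A ≠ 0) (hA₁ : ‖A‖ < 1) {b₀ b₁ b₂ : ℤ}
    {B : ℤ → ℤ → ℤ → ℂ} (hB : CircleRelation A b₀ b₁ b₂ B) (hb : Even (b₀ + b₁ + b₂))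
    (a₀ a₁ a₂ : ℤ) {s : ℤ} (hs : s = 1 ∨ s = -1) :
    tetZ A b₂ a₀ a₂ s * B a₀ a₁ a₂ =
      tetK A b₀ b₁ a₀ a₁ a₂ s 1 * B (a₀ + s) (a₁ + 1) (a₂ + s) +
        tetK A b₀ b₁ a₀ a₁ a₂ s (-1) * B (a₀ + s) (a₁ - 1) (a₂ + s) := by
  have h := hB a₀ a₁ a₂ (a₀ + s) (a₂ + s) (mem_nbr.2 (by omega)) (mem_nbr.2 (by omega))
  -- As `b₀ + b₁ + b₂` is even, the three signs `I ^ (2 * b_i)` multiply to `1`.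
  have hI : Complex.I ^ (2 * b₂) = Complex.I ^ (2 * b₀) * Complex.I ^ (2 * b₁) := by
    rw [← zpow_add₀ Complex.I_ne_zero]
    obtain ⟨m, hm⟩ := hb
    exact I_zpow_congr ⟨m - b₀ - b₁, by linarith⟩
  have hK : ∀ t, tetK A b₀ b₁ a₀ a₁ a₂ s t = Complex.I ^ (2 * b₂) *
      (sqrtRegionWeight A (a₂ + s) * sqrtRegionWeight A (a₀ + s)) *
      (regionWeight A (a₁ + t) * (halfTet A b₀ a₀ a₁ (a₀ + s) (a₁ + t) *
        halfTet A b₁ a₁ a₂ (a₁ + t) (a₂ + s))) := by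
    intro t
    rw [tetK, vQuot_eq hA₀ hA₁, vQuot_eq hA₀ hA₁, hI]
    by_cases h0 : halfTet A b₀ a₀ a₁ (a₀ + s) (a₁ + t) = 0
    · rw [h0]; ring
    · rw [← sqrtRegionWeight_mul_self hA₀ hA₁ (admTriple_of_halfTet_ne_zero h0).2.1.nonneg.2.2]
      ring
  rw [hK, hK, tetZ, vQuot_eq hA₀ hA₁, mul_assoc, h, sum_nbr, ← sub_eq_add_neg]
  ring

/-- Raising the two sides together preserves admissibility with `b₂`, so the half tetrahedron is one
of the nonzero closed forms. The color of the middle side does not enter. -/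
theorem tetZ_ne_zero (hA₀ : A ≠ 0) (hA₁ : ‖A‖ < 1) {a₀ a₂ b₂ : ℤ} (h : AdmTriple a₂ a₀ b₂) :
    tetZ A b₂ (a₀ + 1) (a₂ + 1) (-1) ≠ 0 := by
  rw [tetZ, vQuot_eq hA₀ hA₁]
  simp only [← sub_eq_add_neg, add_sub_cancel_right]
  have hh : AdmTriple b₂ (a₂ + 1) (a₀ + 1) := by
    simp only [AdmTriple, Int.even_iff] at *; omega
  exact mul_ne_zero (mul_ne_zero (zpow_ne_zero _ Complex.I_ne_zero)
    (mul_ne_zero (sqrtRegionWeight_ne_zero hA₀ hA₁ h.nonneg.1)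
      (sqrtRegionWeight_ne_zero hA₀ hA₁ h.nonneg.2.1)))
    (halfTet_ne_zero hA₀ hA₁ hh h.rotate.rotate (.inr (by ring)) (.inr (by ring)))

/-- The first-order relation is used upwards at `(a₀, a₁, a₂)` and downwards at `(a₀+1, a₁±1,
a₂+1)`. Eliminating the two intermediate values leaves `a₁ + 2`, `a₁ - 2`, and two returns to `a₁`.
-/
theorem CircleRelation.three_term (hA₀ : A ≠ 0) (hA₁ : ‖A‖ < 1) {b₀ b₁ b₂ : ℤ}
    {B : ℤ → ℤ → ℤ → ℂ} (hB : CircleRelation A b₀ b₁ b₂ B) (hb : Even (b₀ + b₁ + b₂))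
    {a₀ a₁ a₂ : ℤ} (h : AdmTriple a₂ a₀ b₂) :
    ∑ ε ∈ ({1, -1} : Finset ℤ),
        tetK A b₀ b₁ a₀ a₁ a₂ 1 ε * tetK A b₀ b₁ (a₀ + 1) (a₁ + ε) (a₂ + 1) (-1) ε /
          tetZ A b₂ (a₀ + 1) (a₂ + 1) (-1) * B a₀ (a₁ + 2 * ε) a₂ =
      (tetZ A b₂ a₀ a₂ 1 -
        ∑ ε ∈ ({1, -1} : Finset ℤ),
          tetK A b₀ b₁ a₀ a₁ a₂ 1 ε * tetK A b₀ b₁ (a₀ + 1) (a₁ + ε) (a₂ + 1) (-1) (-ε) /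
            tetZ A b₂ (a₀ + 1) (a₂ + 1) (-1)) * B a₀ a₁ a₂ := by
  have hZ := tetZ_ne_zero hA₀ hA₁ h
  have up := hB.tetZ_mul hA₀ hA₁ hb a₀ a₁ a₂ (.inl rfl)
  have d1 := hB.tetZ_mul hA₀ hA₁ hb (a₀ + 1) (a₁ + 1) (a₂ + 1) (.inr rfl)
  have d2 := hB.tetZ_mul hA₀ hA₁ hb (a₀ + 1) (a₁ - 1) (a₂ + 1) (.inr rfl)
  rw [Finset.sum_pair (by norm_num), Finset.sum_pair (by norm_num)]
  simp only [← sub_eq_add_neg, add_sub_cancel_right, sub_add_cancel, mul_neg, mul_one, neg_neg]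
    at d1 d2 ⊢
  rw [show a₁ + 1 + 1 = a₁ + 2 by ring] at d1
  rw [show a₁ - 1 - 1 = a₁ - 2 by ring] at d2
  field_simp
  linear_combination -tetZ A b₂ (a₀ + 1) (a₂ + 1) (-1) * up -
    tetK A b₀ b₁ a₀ a₁ a₂ 1 1 * d1 - tetK A b₀ b₁ a₀ a₁ a₂ 1 (-1) * d2

end quantum

end

end SpinNetwork

namespace SpinNetwork

noncomputable section

/-! ### Sums over boxes -/

theorem sum_piFinset_eq_sum_update {ι : Type*} [Fintype ι] [DecidableEq ι] (t : ι → Finset ℤ)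
    (i : ι) (g : (ι → ℤ) → ℂ) :
    ∑ s ∈ Fintype.piFinset t, g s =
      ∑ u ∈ t i, ∑ s ∈ Fintype.piFinset (Function.update t i {u}), g s := by
  rw [← Finset.sum_fiberwise_of_maps_to (g := fun s : ι → ℤ => s i) (t := t i)
    fun s hs => Fintype.mem_piFinset.1 hs i]
  refine Finset.sum_congr rfl fun u hu => Finset.sum_congr ?_ fun _ _ => rfl
  ext s
  simp only [Finset.mem_filter, Fintype.mem_piFinset]
  constructor
  · rintro ⟨h1, h2⟩ j
    rcases eq_or_ne j i with rfl | hj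
    · simp [h2]
    · simpa [hj] using h1 j
  · intro h
    have hi := h i
    simp only [Function.update_self, Finset.mem_singleton] at hi
    refine ⟨fun j => ?_, hi⟩
    rcases eq_or_ne j i with rfl | hj
    · rwa [hi]
    · simpa [hj] using h j

/-- A fixed placeholder `z` in the frozen coordinate makes the index set independent of `u`, so that
the two sums can be interchanged. -/
theorem sum_piFinset_update_singleton {ι : Type*} [Fintype ι] [DecidableEq ι] (t : ι → Finset ℤ)
    (i : ι) (u z : ℤ) (g : (ι → ℤ) → ℂ) :
    ∑ s ∈ Fintype.piFinset (Function.update t i {u}), g s =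
      ∑ s ∈ Fintype.piFinset (Function.update t i {z}), g (Function.update s i u) := by
  have key : ∀ (u z : ℤ) (s : ι → ℤ), s ∈ Fintype.piFinset (Function.update t i {u}) →
      Function.update s i z ∈ Fintype.piFinset (Function.update t i {z}) := by
    intro u z s hs
    rw [Fintype.mem_piFinset] at hs ⊢
    intro j
    have := hs j
    rcases eq_or_ne j i with rfl | hj
    · simp
    · simpa [hj] using this
  have self : ∀ (u : ℤ) (s : ι → ℤ), s ∈ Fintype.piFinset (Function.update t i {u}) → s i = u := by
    intro u s hs
    simpa using Fintype.mem_piFinset.1 hs i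
  refine Finset.sum_bij' (fun s _ => Function.update s i z) (fun s _ => Function.update s i u)
    (fun s hs => key u z s hs) (fun s hs => key z u s hs) ?_ ?_ ?_
  · intro s hs
    simp [← self u s hs]
  · intro s hs
    simp [← self z s hs]
  · intro s hs
    simp [← self u s hs]

namespace TrivalentMap

variable {V : Type*} (Γ : TrivalentMap V)

/-! ### Darts, edges and regions -/

theorem rot_apply (d : V × Fin 3) : Γ.rot d = (d.1, d.2 + 1) := rfl

theorem rot_fst (d : V × Fin 3) : (Γ.rot d).1 = d.1 := rfl

theorem rot_rot_rot (d : V × Fin 3) : Γ.rot (Γ.rot (Γ.rot d)) = d := by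
  obtain ⟨v, i⟩ := d
  simp only [rot_apply]
  congr 1
  fin_cases i <;> rfl

theorem rot_symm_eq (d : V × Fin 3) : Γ.rot.symm d = Γ.rot (Γ.rot d) := by
  rw [Equiv.symm_apply_eq, rot_rot_rot]

theorem rot_ne (d : V × Fin 3) : Γ.rot d ≠ d := by
  obtain ⟨v, i⟩ := d
  simp only [rot_apply, ne_eq, Prod.mk.injEq, true_and]
  fin_cases i <;> decide

theorem rot_rot_ne (d : V × Fin 3) : Γ.rot (Γ.rot d) ≠ d := by
  intro h
  have := Γ.rot_rot_rot d
  rw [h] at this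
  exact Γ.rot_ne d this

theorem eq_or_eq_of_fst_eq {d d' : V × Fin 3} (h : d'.1 = d.1) :
    d' = d ∨ d' = Γ.rot d ∨ d' = Γ.rot (Γ.rot d) := by
  obtain ⟨v, i⟩ := d
  obtain ⟨w, j⟩ := d'
  simp only at h
  subst h
  simp only [rot_apply, Prod.mk.injEq, true_and]
  fin_cases i <;> fin_cases j <;> decide

theorem next_apply (d : V × Fin 3) : Γ.next d = Γ.rot (Γ.rot (Γ.opp d)) := by
  rw [← rot_symm_eq]; rfl

theorem rot_next (d : V × Fin 3) : Γ.rot (Γ.next d) = Γ.opp d := by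
  rw [next_apply, rot_rot_rot]

/-- The dart `rot (rot d)` is the clockwise neighbor of `d`, and the corner between them lies to the
right of `d`. -/
theorem region_rot_rot (d : V × Fin 3) : Γ.region (Γ.rot (Γ.rot d)) = Γ.region (Γ.opp d) := by
  rw [← region_next Γ (Γ.opp d), next_apply, Γ.opp_opp]

theorem edge_opp (d : V × Fin 3) : Γ.edge (Γ.opp d) = Γ.edge d :=
  Quotient.sound (Equiv.Perm.sameCycle_apply_left.2 (Equiv.Perm.SameCycle.refl _ _))

theorem edge_eq_iff {d d' : V × Fin 3} : Γ.edge d = Γ.edge d' ↔ d' = d ∨ d' = Γ.opp d := by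
  constructor
  · intro h
    obtain ⟨k, hk⟩ : Γ.opp.SameCycle d d' := Quotient.exact h
    have h2 : Γ.opp ^ 2 = 1 := by
      ext1 a
      simp [pow_two, Γ.opp_opp]
    rcases Int.even_or_odd' k with ⟨m, rfl | rfl⟩
    · left
      rw [zpow_mul, show Γ.opp ^ (2 : ℤ) = 1 from h2, one_zpow] at hk
      exact hk.symm
    · right
      rw [zpow_add, zpow_mul, show Γ.opp ^ (2 : ℤ) = 1 from h2, one_zpow, one_mul, zpow_one] at hk
      exact hk.symm
  · rintro (rfl | rfl)
    · rfl
    · rw [edge_opp]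

theorem exists_region_eq (r : Γ.Region) : ∃ d, Γ.region d = r := Quotient.exists_rep r

/-! ### Weights of vertices -/

/-- The factor of the weight of a state `s` which belongs to the vertex `v`. -/
def vertexWeight (A : ℂ) (c : Γ.Edge → ℤ) (s : Γ.Region → ℤ) (v : V) : ℂ :=
  tet A (c (Γ.edge (v, 0))) (c (Γ.edge (v, 1))) (c (Γ.edge (v, 2)))
      (s (Γ.region (v, 1))) (s (Γ.region (v, 2))) (s (Γ.region (v, 0)))

variable {Γ} {A : ℂ}

/-- Cyclic symmetry of the 6j-symbol: the weight of a vertex can be read off starting from any of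
its darts. -/
theorem vertexWeight_eq (hA₀ : A ≠ 0) (hA₁ : ‖A‖ < 1) (c : Γ.Edge → ℤ) (s : Γ.Region → ℤ)
    (d : V × Fin 3) :
    Γ.vertexWeight A c s d.1 =
      tet A (c (Γ.edge d)) (c (Γ.edge (Γ.rot d))) (c (Γ.edge (Γ.rot (Γ.rot d))))
        (s (Γ.region (Γ.rot d))) (s (Γ.region (Γ.opp d))) (s (Γ.region d)) := by
  have hrot : ∀ a b c d e f : ℤ, tet A b c a e f d = tet A a b c d e f := fun a b c d e f => by
    rw [← tet_swap_right hA₀ hA₁ b c a, tet_swap hA₀ hA₁ a b c]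
  rw [← region_rot_rot]
  obtain ⟨v, i⟩ := d
  simp only [vertexWeight, rot_apply]
  fin_cases i
  · rfl
  · exact (hrot _ _ _ _ _ _).symm
  · exact hrot _ _ _ _ _ _

theorem admTriple_of_vertexWeight_ne_zero (hA₀ : A ≠ 0) (hA₁ : ‖A‖ < 1) {c : Γ.Edge → ℤ}
    {s : Γ.Region → ℤ} (d : V × Fin 3) (h : Γ.vertexWeight A c s d.1 ≠ 0) :
    AdmTriple (s (Γ.region d)) (s (Γ.region (Γ.opp d))) (c (Γ.edge d)) := by
  rw [vertexWeight_eq hA₀ hA₁] at h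
  exact (admTet_of_ne_zero h).2.1.reverse

theorem IsShadowState.nonneg {c : Γ.Edge → ℤ} {s : Γ.Region → ℤ} {r₀ : Γ.Region}
    (h : Γ.IsShadowState c r₀ s) (r : Γ.Region) : 0 ≤ s r := by
  obtain ⟨d, rfl⟩ := Γ.exists_region_eq r
  exact (h.2 d).nonneg.1

variable [Fintype V]

theorem weight_eq (c : Γ.Edge → ℤ) (s : Γ.Region → ℤ) :
    Γ.weight A c s = (∏ r, regionWeight A (s r)) * ∏ v, Γ.vertexWeight A c s v := rfl

/-- Admissibility across edges is enforced by the vanishing convention for `tet`. A sum over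
shadow-states can therefore be replaced by one over any box that contains them. -/
theorem isShadowState_of_vertexWeight (hA₀ : A ≠ 0) (hA₁ : ‖A‖ < 1) {c : Γ.Edge → ℤ}
    {s : Γ.Region → ℤ} {r₀ : Γ.Region} (h0 : s r₀ = 0)
    (h : ∏ v, Γ.vertexWeight A c s v ≠ 0) : Γ.IsShadowState c r₀ s :=
  ⟨h0, fun d => admTriple_of_vertexWeight_ne_zero hA₀ hA₁ d
    (Finset.prod_ne_zero_iff.1 h _ (Finset.mem_univ _))⟩

theorem exists_bound (hΓ : Γ.Connected) (c : Γ.Edge → ℤ) (r₀ : Γ.Region) :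
    ∃ N : ℤ, ∀ s, Γ.IsShadowState c r₀ s → ∀ r, s r ≤ N := by
  have hfin := Γ.finite_shadowStates hΓ c r₀
  obtain ⟨N, hN⟩ := (hfin.biUnion fun s _ => Set.finite_range s).bddAbove
  exact ⟨N, fun s hs r => hN (Set.mem_biUnion hs ⟨r, rfl⟩)⟩

open scoped Classical in
theorem bracket_eq_sum (hA₀ : A ≠ 0) (hA₁ : ‖A‖ < 1) {c : Γ.Edge → ℤ} {r₀ : Γ.Region} {N : ℤ}
    (hN : ∀ s, Γ.IsShadowState c r₀ s → ∀ r, s r ≤ N) :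
    Γ.bracket A r₀ c =
      ∑ s ∈ Fintype.piFinset (Function.update (fun _ => Finset.Icc 0 N) r₀ {0}), Γ.weight A c s := by
  apply finsum_mem_eq_sum_of_inter_support_eq
  ext s
  simp only [Set.mem_inter_iff, Function.mem_support, and_congr_left_iff, Set.mem_ofPred_eq,
    Finset.mem_coe, Fintype.mem_piFinset]
  intro hs
  constructor
  · intro h r
    rcases eq_or_ne r r₀ with rfl | hr
    · simp [h.1]
    · simp [hr, h.nonneg r, hN s h r]
  · intro h
    exact isShadowState_of_vertexWeight hA₀ hA₁ (by simpa using h r₀) (right_ne_zero_of_mul hs)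

end TrivalentMap

end

end SpinNetwork

namespace SpinNetwork

noncomputable section

namespace TrivalentMap

variable {V : Type*} {Γ : TrivalentMap V} {A : ℂ}

/-! ### Triangular faces -/

theorem next_ne_opp (d : V × Fin 3) : Γ.next d ≠ Γ.opp d := by
  rw [next_apply]
  exact Γ.rot_rot_ne _

theorem region_eq_iff_of_triangle {x : V × Fin 3} (h : Γ.next (Γ.next (Γ.next x)) = x)
    {d : V × Fin 3} :
    Γ.region d = Γ.region x ↔ d = x ∨ d = Γ.next x ∨ d = Γ.next (Γ.next x) := by
  constructor
  · intro hd
    obtain ⟨k, hk⟩ : Γ.next.SameCycle x d := Quotient.exact hd.symm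
    have h3 : ∀ m : ℤ, ((Γ.next ^ (3 : ℤ)) ^ m) x = x := by
      intro m
      have : (Γ.next ^ (3 : ℤ)) x = x := h
      exact Equiv.Perm.zpow_apply_eq_self_of_apply_eq_self this m
    have hk' : (Γ.next ^ (k % 3)) x = d := by
      rw [← hk, ← Int.emod_add_mul_ediv k 3, zpow_add, zpow_mul, Equiv.Perm.mul_apply, h3]
      simp
    have := Int.emod_nonneg k (show (3 : ℤ) ≠ 0 by norm_num)
    have := Int.emod_lt_of_pos k (show (0 : ℤ) < 3 by norm_num)
    obtain h0 | h1 | h2 : k % 3 = 0 ∨ k % 3 = 1 ∨ k % 3 = 2 := by omega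
    · rw [h0] at hk'; exact .inl hk'.symm
    · rw [h1] at hk'; exact .inr (.inl hk'.symm)
    · rw [h2] at hk'; exact .inr (.inr hk'.symm)
  · rintro (rfl | rfl | rfl) <;> simp only [region_next]

/-- The two sides of an edge of a triangular face are different regions. -/
theorem region_opp_ne_of_triangle {x : V × Fin 3} (h : Γ.next (Γ.next (Γ.next x)) = x) :
    Γ.region (Γ.opp x) ≠ Γ.region x := by
  rw [Ne, region_eq_iff_of_triangle h]
  rintro (h' | h' | h')
  · exact Γ.opp_ne x h'
  · exact next_ne_opp x h'.symm
  · rw [← h', next_apply, Γ.opp_opp] at h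
    exact Γ.rot_rot_ne x h

theorem region_rot_next_ne {x : V × Fin 3} (h : Γ.next (Γ.next (Γ.next x)) = x) :
    Γ.region (Γ.rot x) ≠ Γ.region x := by
  have h2 : Γ.next (Γ.next (Γ.next (Γ.next (Γ.next x)))) = Γ.next (Γ.next x) := by rw [h]
  have := region_opp_ne_of_triangle h2
  rwa [← rot_next, h, region_next, region_next] at this

/-- A triangular face has only one corner at each of its vertices. -/
theorem eq_of_fst_eq_of_region_eq {x d : V × Fin 3} (h : Γ.next (Γ.next (Γ.next x)) = x)
    (hd : d.1 = x.1) (hr : Γ.region d = Γ.region x) : d = x := by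
  rcases Γ.eq_or_eq_of_fst_eq hd with rfl | rfl | rfl
  · rfl
  · exact absurd hr (region_rot_next_ne h)
  · rw [region_rot_rot] at hr
    exact absurd hr (region_opp_ne_of_triangle h)


theorem edge_ne_of_region_ne {x d : V × Fin 3} (h1 : Γ.region d ≠ Γ.region x)
    (h2 : Γ.region (Γ.opp d) ≠ Γ.region x) : Γ.edge d ≠ Γ.edge x := by
  rw [Ne, edge_eq_iff]
  rintro (rfl | h')
  · exact h1 rfl
  · exact h2 (by rw [h'])

variable (Γ) in
/-- The darts `x`, `y`, `z` run around a triangular face. -/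
structure IsTriangle (x y z : V × Fin 3) : Prop where
  next_x : Γ.next x = y
  next_y : Γ.next y = z
  next_z : Γ.next z = x
  ne : y ≠ x

theorem isTriangle_of_faceLength {x : V × Fin 3} (h : Γ.faceLength x = 3) :
    Γ.IsTriangle x (Γ.next x) (Γ.next (Γ.next x)) := by
  refine ⟨rfl, rfl, ?_, fun h' => ?_⟩
  · have := Function.iterate_minimalPeriod (f := Γ.next) (x := x)
    rw [← faceLength, h] at this
    exact this
  · have : Function.minimalPeriod Γ.next x = 1 := Function.minimalPeriod_eq_one_iff_isFixedPt.2 h'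
    rw [← faceLength, h] at this
    omega

namespace IsTriangle

variable {x y z : V × Fin 3} (h : Γ.IsTriangle x y z)
include h

theorem iterate : Γ.next (Γ.next (Γ.next x)) = x := by
  rw [h.next_x, h.next_y, h.next_z]

theorem rotate : Γ.IsTriangle y z x := by
  refine ⟨h.next_y, h.next_z, h.next_x, fun h' => h.ne ?_⟩
  have h1 := h.next_y
  rw [h', ← h.next_x] at h1
  rw [← h.next_x]
  exact Γ.next.injective h1

theorem region_y : Γ.region y = Γ.region x := by rw [← h.next_x, region_next]

theorem rot_y : Γ.rot y = Γ.opp x := by rw [← h.next_x, rot_next]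

theorem region_opp_ne : Γ.region (Γ.opp x) ≠ Γ.region x := region_opp_ne_of_triangle h.iterate

/-- A triangular face meets each of its vertices in a single corner, so its three vertices are
distinct even if the graph has multiple edges. -/
theorem fst_ne : y.1 ≠ x.1 := fun h' =>
  h.ne (eq_of_fst_eq_of_region_eq h.iterate h' h.region_y)

theorem edge_ne : Γ.edge y ≠ Γ.edge x := by
  rw [Ne, edge_eq_iff, not_or]
  refine ⟨fun h' => h.ne h'.symm, fun h' => next_ne_opp (Γ := Γ) x ?_⟩
  rw [h.next_x, h', Γ.opp_opp]

theorem region_ne_of_fst_ne {d : V × Fin 3} (hx : d.1 ≠ x.1) (hy : d.1 ≠ y.1) (hz : d.1 ≠ z.1) :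
    Γ.region d ≠ Γ.region x := by
  rw [Ne, region_eq_iff_of_triangle h.iterate, h.next_x, h.next_y]
  rintro (rfl | rfl | rfl)
  exacts [hx rfl, hy rfl, hz rfl]

theorem region_z : Γ.region z = Γ.region x := by rw [h.rotate.region_y, h.region_y]

/-- Both regions next to the third edge at a corner differ from the face, whereas a side has the
face next to it. -/
theorem spoke_ne : Γ.edge (Γ.rot (Γ.rot y)) ≠ Γ.edge x ∧ Γ.edge (Γ.rot (Γ.rot y)) ≠ Γ.edge y ∧
    Γ.edge (Γ.rot (Γ.rot y)) ≠ Γ.edge z := by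
  have h1 : Γ.region (Γ.rot (Γ.rot y)) ≠ Γ.region x := by
    rw [region_rot_rot, ← h.region_y]
    exact h.rotate.region_opp_ne
  have h2 : Γ.region (Γ.opp (Γ.rot (Γ.rot y))) ≠ Γ.region x := by
    rw [← region_rot_rot, rot_rot_rot, h.rot_y]
    exact h.region_opp_ne
  exact ⟨edge_ne_of_region_ne h1 h2,
    edge_ne_of_region_ne (h.region_y ▸ h1) (h.region_y ▸ h2),
    edge_ne_of_region_ne (h.region_z ▸ h1) (h.region_z ▸ h2)⟩

end IsTriangle

/-! ### Brackets as functions of the colors of a triangular face -/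

open scoped Classical in
/-- The coloring `c` with the colors of the edges of `x`, `y`, `z` replaced by `a₀`, `a₁`, `a₂`. -/
def recolor (Γ : TrivalentMap V) (c : Γ.Edge → ℤ) (x y z : V × Fin 3) (a₀ a₁ a₂ : ℤ) :
    Γ.Edge → ℤ := fun e =>
  if e = Γ.edge x then a₀ else if e = Γ.edge y then a₁ else if e = Γ.edge z then a₂ else c e

theorem recolor_rotate {x y z : V × Fin 3} (h : Γ.IsTriangle x y z) (c : Γ.Edge → ℤ)
    (a₀ a₁ a₂ : ℤ) : Γ.recolor c y z x a₁ a₂ a₀ = Γ.recolor c x y z a₀ a₁ a₂ := by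
  funext e
  have h0 := h.edge_ne
  have h1 := h.rotate.edge_ne
  have h2 := h.rotate.rotate.edge_ne
  simp only [recolor]
  split_ifs <;> simp_all

theorem recolor_of_ne {c : Γ.Edge → ℤ} {x y z : V × Fin 3} {a₀ a₁ a₂ : ℤ} {e : Γ.Edge}
    (hx : e ≠ Γ.edge x) (hy : e ≠ Γ.edge y) (hz : e ≠ Γ.edge z) :
    Γ.recolor c x y z a₀ a₁ a₂ e = c e := by
  simp [recolor, hx, hy, hz]

open scoped Classical in
-- The dart `y` starts at the corner between the sides `x` and `y`, since `rot y` is the reverse of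
-- `x`. Only the face has state `u` there, and only the spoke keeps its color.
theorem vertexWeight_recolor (hA₀ : A ≠ 0) (hA₁ : ‖A‖ < 1) {x y z : V × Fin 3}
    (h : Γ.IsTriangle x y z) (c : Γ.Edge → ℤ)
    (a₀ a₁ a₂ : ℤ) (s : Γ.Region → ℤ) (u : ℤ) :
    Γ.vertexWeight A (Γ.recolor c x y z a₀ a₁ a₂) (Function.update s (Γ.region x) u) y.1 =
      tet A (c (Γ.edge (Γ.rot (Γ.rot y)))) (s (Γ.region (Γ.opp y))) (s (Γ.region (Γ.opp x)))
        u a₀ a₁ := by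
  have hsymm : ∀ p q r x y z : ℤ, tet A p q r x y z = tet A r y x z q p := fun p q r x y z => by
    rw [tet_swap_right hA₀ hA₁ r x y z p q, tet_flip hA₀ hA₁ r p q z x y,
      ← tet_swap hA₀ hA₁ r p q z, tet_swap_right hA₀ hA₁ p q r]
  have e0 : Γ.recolor c x y z a₀ a₁ a₂ (Γ.edge (Γ.rot y)) = a₀ := by
    rw [h.rot_y, edge_opp]; simp [recolor]
  have e1 : Γ.recolor c x y z a₀ a₁ a₂ (Γ.edge y) = a₁ := by simp [recolor, h.edge_ne]
  have e2 : Γ.recolor c x y z a₀ a₁ a₂ (Γ.edge (Γ.rot (Γ.rot y))) =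
      c (Γ.edge (Γ.rot (Γ.rot y))) :=
    recolor_of_ne h.spoke_ne.1 h.spoke_ne.2.1 h.spoke_ne.2.2
  rw [vertexWeight_eq hA₀ hA₁, e0, e1, e2, h.rot_y, Function.update_of_ne h.region_opp_ne,
    Function.update_of_ne (h.region_y ▸ h.rotate.region_opp_ne), h.region_y, Function.update_self,
    hsymm]

open scoped Classical in
theorem vertexWeight_recolor_of_ne {x y z : V × Fin 3} (h : Γ.IsTriangle x y z) (c : Γ.Edge → ℤ)
    (a₀ a₁ a₂ : ℤ) (s : Γ.Region → ℤ) (u : ℤ) {v : V} (hx : v ≠ x.1) (hy : v ≠ y.1)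
    (hz : v ≠ z.1) :
    Γ.vertexWeight A (Γ.recolor c x y z a₀ a₁ a₂) (Function.update s (Γ.region x) u) v =
      Γ.vertexWeight A c s v := by
  have hr : ∀ i, Γ.region (v, i) ≠ Γ.region x := fun i => h.region_ne_of_fst_ne hx hy hz
  have he : ∀ i, Γ.recolor c x y z a₀ a₁ a₂ (Γ.edge (v, i)) = c (Γ.edge (v, i)) := by
    have key : ∀ {x y z : V × Fin 3}, Γ.IsTriangle x y z → v ≠ x.1 → v ≠ y.1 → ∀ i,
        Γ.edge (v, i) ≠ Γ.edge x := by
      intro x y z h hx hy i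
      rw [Ne, edge_eq_iff]
      rintro (h' | h')
      · exact hx (by rw [h'])
      · refine hy ?_
        have := congrArg Γ.opp h'
        rw [Γ.opp_opp, ← h.rot_y] at this
        rw [← rot_fst Γ y, this]
    intro i
    exact recolor_of_ne (key h hx hy i) (key h.rotate hy hz i) (key h.rotate.rotate hz hx i)
  simp only [vertexWeight, he, Function.update_of_ne (hr _)]

theorem Admissible.dart {c : Γ.Edge → ℤ} (hc : Γ.Admissible c) (d : V × Fin 3) :
    AdmTriple (c (Γ.edge d)) (c (Γ.edge (Γ.rot d))) (c (Γ.edge (Γ.rot (Γ.rot d)))) := by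
  obtain ⟨v, i⟩ := d
  have h := hc v
  simp only [rot_apply]
  fin_cases i
  · exact h
  · exact h.rotate
  · exact h.rotate.rotate

variable [Fintype V]

open scoped Classical in
/-- The part of the weight of a state that belongs to the exterior of a triangular face. -/
def outerWeight (Γ : TrivalentMap V) (A : ℂ) (c : Γ.Edge → ℤ) (x y z : V × Fin 3)
    (s : Γ.Region → ℤ) : ℂ :=
  (∏ r ∈ Finset.univ.erase (Γ.region x), regionWeight A (s r)) *
    ∏ v ∈ ((Finset.univ.erase x.1).erase y.1).erase z.1, Γ.vertexWeight A c s v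

open scoped Classical in
-- The colors of the sides and the state of the face are seen only by the face and its three
-- corners. Everything else is a factor independent of them.
theorem weight_recolor (hA₀ : A ≠ 0) (hA₁ : ‖A‖ < 1) {x y z : V × Fin 3}
    (h : Γ.IsTriangle x y z) (c : Γ.Edge → ℤ)
    (a₀ a₁ a₂ : ℤ) (s : Γ.Region → ℤ) (u : ℤ) :
    Γ.weight A (Γ.recolor c x y z a₀ a₁ a₂) (Function.update s (Γ.region x) u) =
      Γ.outerWeight A c x y z s * (regionWeight A u *
        (tet A (c (Γ.edge (Γ.rot (Γ.rot y)))) (s (Γ.region (Γ.opp y))) (s (Γ.region (Γ.opp x)))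
            u a₀ a₁ *
          tet A (c (Γ.edge (Γ.rot (Γ.rot z)))) (s (Γ.region (Γ.opp z))) (s (Γ.region (Γ.opp y)))
            u a₁ a₂ *
          tet A (c (Γ.edge (Γ.rot (Γ.rot x)))) (s (Γ.region (Γ.opp x))) (s (Γ.region (Γ.opp z)))
            u a₂ a₀)) := by
  have w0 := vertexWeight_recolor hA₀ hA₁ h c a₀ a₁ a₂ s u
  have w1 := vertexWeight_recolor hA₀ hA₁ h.rotate c a₁ a₂ a₀ s u
  have w2 := vertexWeight_recolor hA₀ hA₁ h.rotate.rotate c a₂ a₀ a₁ s u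
  rw [h.region_y, recolor_rotate h] at w1
  rw [h.region_z, recolor_rotate h.rotate, recolor_rotate h] at w2
  have outer : ∏ r ∈ Finset.univ.erase (Γ.region x),
      regionWeight A (Function.update s (Γ.region x) u r) =
      ∏ r ∈ Finset.univ.erase (Γ.region x), regionWeight A (s r) :=
    Finset.prod_congr rfl fun r hr => by rw [Function.update_of_ne (Finset.ne_of_mem_erase hr)]
  have inner : ∏ v ∈ ((Finset.univ.erase x.1).erase y.1).erase z.1,
      Γ.vertexWeight A (Γ.recolor c x y z a₀ a₁ a₂) (Function.update s (Γ.region x) u) v =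
      ∏ v ∈ ((Finset.univ.erase x.1).erase y.1).erase z.1, Γ.vertexWeight A c s v := by
    refine Finset.prod_congr rfl fun v hv => ?_
    simp only [Finset.mem_erase, Finset.mem_univ, and_true] at hv
    exact vertexWeight_recolor_of_ne h c a₀ a₁ a₂ s u hv.2.2 hv.2.1 hv.1
  rw [weight_eq, ← Finset.mul_prod_erase Finset.univ _ (Finset.mem_univ (Γ.region x)),
    ← Finset.mul_prod_erase Finset.univ _ (Finset.mem_univ x.1),
    ← Finset.mul_prod_erase (Finset.univ.erase x.1) _ (a := y.1) (by simp [h.fst_ne]),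
    ← Finset.mul_prod_erase ((Finset.univ.erase x.1).erase y.1) _ (a := z.1)
      (by simp [h.rotate.fst_ne, h.rotate.rotate.fst_ne.symm]), w0, w1, w2, outerWeight,
    Function.update_self, outer, inner]
  ring

open scoped Classical in
-- As the face is not `r₀`, its state is free; summing over it first produces `triangleSum`, while
-- the outer factor does not depend on the colors of the sides.
theorem bracket_recolor (hA₀ : A ≠ 0) (hA₁ : ‖A‖ < 1) {x y z : V × Fin 3}
    (h : Γ.IsTriangle x y z) {r₀ : Γ.Region} (hr₀ : r₀ ≠ Γ.region x) (c : Γ.Edge → ℤ)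
    (a₀ a₁ a₂ : ℤ) {N : ℤ}
    (hN : ∀ s, Γ.IsShadowState (Γ.recolor c x y z a₀ a₁ a₂) r₀ s → ∀ r, s r ≤ N) :
    Γ.bracket A r₀ (Γ.recolor c x y z a₀ a₁ a₂) =
      ∑ s ∈ Fintype.piFinset
          (Function.update (Function.update (fun _ => Finset.Icc 0 N) r₀ {0}) (Γ.region x) {0}),
        Γ.outerWeight A c x y z s *
          triangleSum A (c (Γ.edge (Γ.rot (Γ.rot y)))) (c (Γ.edge (Γ.rot (Γ.rot z))))
            (c (Γ.edge (Γ.rot (Γ.rot x)))) (s (Γ.region (Γ.opp x))) (s (Γ.region (Γ.opp y)))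
            (s (Γ.region (Γ.opp z))) a₀ a₁ a₂ := by
  rw [bracket_eq_sum hA₀ hA₁ hN, sum_piFinset_eq_sum_update _ (Γ.region x)]
  rw [Finset.sum_congr rfl fun u _ => sum_piFinset_update_singleton _ (Γ.region x) u 0 _,
    Finset.sum_comm]
  refine Finset.sum_congr rfl fun s hs => ?_
  rw [Function.update_of_ne hr₀.symm, triangleSum, Finset.mul_sum]
  have hs0 : s r₀ = 0 := by
    have := Fintype.mem_piFinset.1 hs r₀
    rw [Function.update_of_ne hr₀, Function.update_self] at this
    simpa using this
  -- The face state runs over two different intervals. Outside their intersection the weight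
  -- vanishes, by a triangle inequality at a corner or by the bound `N`.
  refine Finset.sum_congr_of_eq_on_inter ?_ ?_ ?_
  · intro u hu hu'
    rw [weight_recolor hA₀ hA₁ h]
    by_contra hne
    have := (admTet_of_ne_zero (left_ne_zero_of_mul (left_ne_zero_of_mul
      (right_ne_zero_of_mul (right_ne_zero_of_mul hne))))).2.2.2
    rw [Finset.mem_Icc] at hu hu'
    simp only [AdmTriple] at this
    omega
  · intro u hu hu'
    rw [← weight_recolor hA₀ hA₁ h]
    by_contra hne
    have hS := isShadowState_of_vertexWeight hA₀ hA₁
      (show Function.update s (Γ.region x) u r₀ = 0 by rw [Function.update_of_ne hr₀, hs0])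
      (right_ne_zero_of_mul hne)
    have := hN _ hS (Γ.region x)
    rw [Function.update_self] at this
    rw [Finset.mem_Icc] at hu hu'
    omega
  · intro u _ _
    exact weight_recolor hA₀ hA₁ h c a₀ a₁ a₂ s u

/-- The coefficients of the circle relation do not involve the outer states, so the relation for
`triangleSum` can be summed over them. A bound `K` common to all the colorings involved provides one
index set. -/
theorem circleRelation_bracket (hA₀ : A ≠ 0) (hA₁ : ‖A‖ < 1) (hΓ : Γ.Connected)
    {x y z : V × Fin 3} (h : Γ.IsTriangle x y z) {r₀ : Γ.Region} (hr₀ : r₀ ≠ Γ.region x)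
    (c : Γ.Edge → ℤ) :
    CircleRelation A (c (Γ.edge (Γ.rot (Γ.rot y)))) (c (Γ.edge (Γ.rot (Γ.rot z))))
      (c (Γ.edge (Γ.rot (Γ.rot x))))
      fun a₀ a₁ a₂ => Γ.bracket A r₀ (Γ.recolor c x y z a₀ a₁ a₂) := by
  intro a₀ a₁ a₂ a₀' a₂' h0 h2
  obtain ⟨N, hN⟩ := exists_bound hΓ (Γ.recolor c x y z a₀ a₁ a₂) r₀
  have hM := fun a₁' => exists_bound hΓ (Γ.recolor c x y z a₀' a₁' a₂') r₀
  choose M hM using hM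
  obtain ⟨K, hK1, hK2⟩ : ∃ K, N ≤ K ∧ ∀ a₁' ∈ nbr a₁, M a₁' ≤ K := by
    refine ⟨max N (max (M (a₁ + 1)) (M (a₁ - 1))), by omega, fun a ha => ?_⟩
    rcases mem_nbr.1 ha with rfl | rfl <;> omega
  dsimp only
  rw [bracket_recolor hA₀ hA₁ h hr₀ c a₀ a₁ a₂ (N := K) fun s hs r => (hN s hs r).trans hK1,
    Finset.mul_sum]
  have expand := fun a₁' (ha : a₁' ∈ nbr a₁) => bracket_recolor hA₀ hA₁ h hr₀ c a₀' a₁' a₂'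
    (N := K) fun s hs r => (hM a₁' s hs r).trans (hK2 a₁' ha)
  refine Eq.trans ?_ (Finset.sum_congr rfl fun a ha => congrArg (_ * ·) (expand a ha)).symm
  simp only [Finset.mul_sum]
  rw [Finset.sum_comm (s := nbr a₁)]
  refine Finset.sum_congr rfl fun s _ => ?_
  rw [mul_left_comm, circleRelation_triangleSum hA₀ hA₁ _ _ _ _ _ _ a₀ a₁ a₂ a₀' a₂' h0 h2,
    Finset.mul_sum]
  refine Finset.sum_congr rfl fun a₁' _ => ?_
  ring

/-- The three-term recursion when the region of state `0` is not the triangular face. -/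
theorem three_term_of_ne (hA₀ : A ≠ 0) (hA₁ : ‖A‖ < 1) (hΓ : Γ.Connected) {r₀ : Γ.Region}
    {x : V × Fin 3} (hx : Γ.faceLength x = 3) (hr₀ : r₀ ≠ Γ.region x) {c : Γ.Edge → ℤ}
    (hc : Γ.Admissible c) :
    (∀ ε ∈ ({1, -1} : Finset ℤ), Γ.zCoeff A x (c + Γ.deltaPert x ε) (-1) (-1) ≠ 0) ∧
      ∑ ε ∈ ({1, -1} : Finset ℤ),
          Γ.kCoeff A x c (Γ.deltaPert x ε) *
              Γ.kCoeff A x (c + Γ.deltaPert x ε) (-Γ.deltaPert x (-ε)) /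
            Γ.zCoeff A x (c + Γ.deltaPert x ε) (-1) (-1) *
            Γ.bracket A r₀ (c + (2 * ε) • Γ.halfAt (Γ.side x 1)) =
        (Γ.zCoeff A x c 1 1 -
          ∑ ε ∈ ({1, -1} : Finset ℤ),
            Γ.kCoeff A x c (Γ.deltaPert x ε) *
                Γ.kCoeff A x (c + Γ.deltaPert x ε) (-Γ.deltaPert x ε) /
              Γ.zCoeff A x (c + Γ.deltaPert x ε) (-1) (-1)) *
          Γ.bracket A r₀ c := by
  have h := isTriangle_of_faceLength hx
  have side0 : Γ.side x 0 = Γ.edge x := rfl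
  have side1 : Γ.side x 1 = Γ.edge (Γ.next x) := rfl
  have side2 : Γ.side x 2 = Γ.edge (Γ.next (Γ.next x)) := rfl
  generalize hy : Γ.next x = y at *
  generalize hz : Γ.next y = z at *
  have spoke0 : Γ.spoke x 0 = Γ.edge (Γ.rot (Γ.rot y)) := by rw [h.rot_y]; rfl
  have spoke1 : Γ.spoke x 1 = Γ.edge (Γ.rot (Γ.rot z)) := by rw [h.rotate.rot_y, ← hy]; rfl
  have spoke2 : Γ.spoke x 2 = Γ.edge (Γ.rot (Γ.rot x)) := by
    rw [h.rotate.rotate.rot_y, ← hz, ← hy]; rfl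
  have n0 := h.edge_ne
  have n1 := h.rotate.edge_ne
  have n2 := h.rotate.rotate.edge_ne
  have δ0 : ∀ ε, Γ.deltaPert x ε (Γ.edge x) = 1 := fun ε => by
    simp [deltaPert, halfAt, side0, side1, side2, n0.symm, n2]
  have δ1 : ∀ ε, Γ.deltaPert x ε (Γ.edge y) = ε := fun ε => by
    simp [deltaPert, halfAt, side0, side1, side2, n0, n1.symm]
  have δ2 : ∀ ε, Γ.deltaPert x ε (Γ.edge z) = 1 := fun ε => by
    simp [deltaPert, halfAt, side0, side1, side2, n1, n2.symm]
  have δs : ∀ ε e, e ≠ Γ.edge x → e ≠ Γ.edge y → e ≠ Γ.edge z → Γ.deltaPert x ε e = 0 := by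
    intro ε e h0 h1 h2
    simp [deltaPert, halfAt, side0, side1, side2, h0, h1, h2]
  have s0 : ∀ ε, Γ.deltaPert x ε (Γ.edge (Γ.rot (Γ.rot y))) = 0 := fun ε =>
    δs ε _ h.spoke_ne.1 h.spoke_ne.2.1 h.spoke_ne.2.2
  have s1 : ∀ ε, Γ.deltaPert x ε (Γ.edge (Γ.rot (Γ.rot z))) = 0 := fun ε =>
    δs ε _ h.rotate.spoke_ne.2.2 h.rotate.spoke_ne.1 h.rotate.spoke_ne.2.1
  have s2 : ∀ ε, Γ.deltaPert x ε (Γ.edge (Γ.rot (Γ.rot x))) = 0 := fun ε =>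
    δs ε _ h.rotate.rotate.spoke_ne.2.1 h.rotate.rotate.spoke_ne.2.2 h.rotate.rotate.spoke_ne.1
  have hZ : ∀ c s, Γ.zCoeff A x c s s =
      tetZ A (c (Γ.edge (Γ.rot (Γ.rot x)))) (c (Γ.edge x)) (c (Γ.edge z)) s := by
    intro c s
    simp only [zCoeff, hx, tetZ, Nat.add_one_sub_one, side0, side2, spoke2]
  have hK : ∀ c δ, δ (Γ.edge z) = δ (Γ.edge x) → Γ.kCoeff A x c δ =
      tetK A (c (Γ.edge (Γ.rot (Γ.rot y)))) (c (Γ.edge (Γ.rot (Γ.rot z)))) (c (Γ.edge x))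
        (c (Γ.edge y)) (c (Γ.edge z)) (δ (Γ.edge x)) (δ (Γ.edge y)) := by
    intro c δ hδ
    simp only [kCoeff, hx, tetK, Nat.add_one_sub_one, Finset.prod_range_succ, Finset.prod_range_zero,
      one_mul, zero_add, Nat.reduceAdd, side0, side1, side2, spoke0, spoke1, hδ]
  have r0 : Γ.edge (Γ.rot x) = Γ.edge z := by rw [h.rotate.rotate.rot_y, edge_opp]
  have r1 : Γ.edge (Γ.rot y) = Γ.edge x := by rw [h.rot_y, edge_opp]
  have r2 : Γ.edge (Γ.rot z) = Γ.edge y := by rw [h.rotate.rot_y, edge_opp]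
  have hadm : AdmTriple (c (Γ.edge z)) (c (Γ.edge x)) (c (Γ.edge (Γ.rot (Γ.rot x)))) := by
    have := hc.dart x
    rw [r0] at this
    exact this.swap
  -- In the sum of the parity conditions at the three corners, each side of the triangle is counted
  -- twice.
  have hb : Even (c (Γ.edge (Γ.rot (Γ.rot y))) + c (Γ.edge (Γ.rot (Γ.rot z))) +
      c (Γ.edge (Γ.rot (Γ.rot x)))) := by
    have h0 := (hc.dart x).2.2.2
    have h1 := (hc.dart y).2.2.2
    have h2 := (hc.dart z).2.2.2
    rw [r0, Int.even_iff] at h0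
    rw [r1, Int.even_iff] at h1
    rw [r2, Int.even_iff] at h2
    rw [Int.even_iff]
    omega
  have T := (circleRelation_bracket hA₀ hA₁ hΓ h hr₀ c).three_term hA₀ hA₁ hb hadm
    (a₁ := c (Γ.edge y))
  have hc0 : Γ.recolor c x y z (c (Γ.edge x)) (c (Γ.edge y)) (c (Γ.edge z)) = c := by
    funext e
    simp only [recolor]
    split_ifs <;> simp_all
  have hc1 : ∀ ε, Γ.recolor c x y z (c (Γ.edge x)) (c (Γ.edge y) + 2 * ε) (c (Γ.edge z)) =
      c + (2 * ε) • Γ.halfAt (Γ.side x 1) := by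
    intro ε
    funext e
    simp only [recolor, Pi.add_apply, Pi.smul_apply, halfAt, side1]
    split_ifs <;> simp_all
  simp only [hc0, hc1] at T
  have hK' : ∀ ε, Γ.kCoeff A x c (Γ.deltaPert x ε) = _ := fun ε =>
    hK c (Γ.deltaPert x ε) (by rw [δ0, δ2])
  have hKn : ∀ ε ε', Γ.kCoeff A x (c + Γ.deltaPert x ε) (-Γ.deltaPert x ε') = _ := fun ε ε' =>
    hK (c + Γ.deltaPert x ε) (-Γ.deltaPert x ε') (by rw [Pi.neg_apply, Pi.neg_apply, δ0, δ2])
  simp only [Pi.add_apply, Pi.neg_apply, δ0, δ1, δ2, s0, s1, add_zero] at hK' hKn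
  simp only [hK', hKn, hZ, Pi.add_apply, δ0, δ2, s2, add_zero, neg_neg]
  exact ⟨fun _ _ => tetZ_ne_zero hA₀ hA₁ hadm, T⟩

end TrivalentMap

end

end SpinNetwork

namespace SpinNetwork

noncomputable section

/-! ### The bracket of the tetrahedron -/

theorem tetrahedron_isTriangle (x : Fin 4 × Fin 3) :
    tetrahedron.IsTriangle x (tetrahedron.next x) (tetrahedron.next (tetrahedron.next x)) := by
  refine ⟨rfl, rfl, ?_, ?_⟩
  · revert x; decide
  · revert x; decide

theorem tetrahedron_region_cases (x d : Fin 4 × Fin 3) :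
    tetrahedron.region d = tetrahedron.region x ∨
      tetrahedron.region d = tetrahedron.region (tetrahedron.opp x) ∨
      tetrahedron.region d = tetrahedron.region (tetrahedron.opp (tetrahedron.next x)) ∨
      tetrahedron.region d =
        tetrahedron.region (tetrahedron.opp (tetrahedron.next (tetrahedron.next x))) := by
  simp only [TrivalentMap.region_eq_iff_of_triangle (tetrahedron_isTriangle _).iterate]
  revert x d
  decide

open scoped Classical in
/-- The state whose value is `0` on the region to the left of `x`, and on each other region the color of
the edge that separates it from this region. -/
def tetrahedronState (c : tetrahedron.Edge → ℤ) (x : Fin 4 × Fin 3) (r : tetrahedron.Region) : ℤ :=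
  if r = tetrahedron.region (tetrahedron.opp x) then c (tetrahedron.edge x)
  else if r = tetrahedron.region (tetrahedron.opp (tetrahedron.next x)) then
    c (tetrahedron.edge (tetrahedron.next x))
  else if r = tetrahedron.region (tetrahedron.opp (tetrahedron.next (tetrahedron.next x))) then
    c (tetrahedron.edge (tetrahedron.next (tetrahedron.next x)))
  else 0

theorem tetrahedron_regions_ne (x : Fin 4 × Fin 3) :
    tetrahedron.region (tetrahedron.opp (tetrahedron.next x)) ≠
      tetrahedron.region (tetrahedron.opp x) := by
  rw [← tetrahedron.region_rot_rot, (tetrahedron_isTriangle x).rot_y]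
  exact TrivalentMap.region_rot_next_ne (tetrahedron_isTriangle _).iterate

theorem tetrahedronState_opp (c : tetrahedron.Edge → ℤ) (x : Fin 4 × Fin 3) :
    tetrahedronState c x (tetrahedron.region (tetrahedron.opp x)) = c (tetrahedron.edge x) := by
  simp [tetrahedronState]

theorem tetrahedronState_next (c : tetrahedron.Edge → ℤ) (x : Fin 4 × Fin 3) :
    tetrahedronState c (tetrahedron.next x) = tetrahedronState c x := by
  funext r
  have h0 := tetrahedron_regions_ne x
  have h1 := tetrahedron_regions_ne (tetrahedron.next x)
  have h2 := tetrahedron_regions_ne (tetrahedron.next (tetrahedron.next x))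
  rw [(tetrahedron_isTriangle x).next_z] at h2
  rw [tetrahedronState, tetrahedronState, (tetrahedron_isTriangle x).next_z]
  split_ifs <;> simp_all

theorem tetrahedronState_self (c : tetrahedron.Edge → ℤ) (x : Fin 4 × Fin 3) :
    tetrahedronState c x (tetrahedron.region x) = 0 := by
  have h := tetrahedron_isTriangle x
  have h0 := h.region_opp_ne.symm
  have h1 := h.rotate.region_opp_ne.symm
  have h2 := h.rotate.rotate.region_opp_ne.symm
  rw [h.region_y] at h1
  rw [h.region_z] at h2
  simp [tetrahedronState, h0, h1, h2]

/-- Every other region shares an edge with the region of state `0`, and a triple with an entry `0`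
is admissible only if its other two entries agree. -/
theorem eq_tetrahedronState {c : tetrahedron.Edge → ℤ} {x : Fin 4 × Fin 3}
    {s : tetrahedron.Region → ℤ} (hs : tetrahedron.IsShadowState c (tetrahedron.region x) s) :
    s = tetrahedronState c x := by
  have key : ∀ d, tetrahedron.region d = tetrahedron.region x →
      s (tetrahedron.region (tetrahedron.opp d)) = c (tetrahedron.edge d) := by
    intro d hd
    have h := hs.2 d
    rw [hd, hs.1] at h
    exact admTriple_zero h.swap
  have h := tetrahedron_isTriangle x
  funext r
  obtain ⟨d, rfl⟩ := tetrahedron.exists_region_eq r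
  rcases tetrahedron_region_cases x d with h' | h' | h' | h' <;> rw [h']
  · rw [hs.1, tetrahedronState_self]
  · rw [key x rfl, tetrahedronState_opp]
  · rw [key _ h.region_y, ← tetrahedronState_next, tetrahedronState_opp]
  · rw [key _ h.region_z, ← tetrahedronState_next, ← tetrahedronState_next, tetrahedronState_opp]

variable {A : ℂ}

/-- There is one candidate state. If it is not a shadow-state its weight is `0`, so it may be
included in any case. -/
theorem tetrahedron_bracket_eq_weight (hA₀ : A ≠ 0) (hA₁ : ‖A‖ < 1) (c : tetrahedron.Edge → ℤ)
    (x : Fin 4 × Fin 3) :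
    tetrahedron.bracket A (tetrahedron.region x) c =
      tetrahedron.weight A c (tetrahedronState c x) := by
  rw [← Finset.sum_singleton (fun s => tetrahedron.weight A c s)]
  apply finsum_mem_eq_sum_of_inter_support_eq
  ext s
  simp only [Set.mem_inter_iff, Function.mem_support, and_congr_left_iff, Set.mem_ofPred_eq,
    Finset.mem_coe, Finset.mem_singleton]
  intro hs
  constructor
  · exact eq_tetrahedronState
  · rintro rfl
    exact TrivalentMap.isShadowState_of_vertexWeight hA₀ hA₁ (tetrahedronState_self c x)
      (right_ne_zero_of_mul hs)

/-- The vertices on the boundary of the region of state `0` carry symbols with an entry `0`. -/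
theorem tetrahedron_vertexWeight (hA₀ : A ≠ 0) (hA₁ : ‖A‖ < 1) {c : tetrahedron.Edge → ℤ}
    (hc : tetrahedron.Admissible c) (x : Fin 4 × Fin 3) :
    tetrahedron.vertexWeight A c (tetrahedronState c x) (tetrahedron.next x).1 =
      Complex.I ^ (2 * c (tetrahedron.edge (tetrahedron.rot (tetrahedron.rot (tetrahedron.next x)))))
        / (sqrtRegionWeight A (c (tetrahedron.edge (tetrahedron.next x))) *
          sqrtRegionWeight A (c (tetrahedron.edge x))) := by
  have h := tetrahedron_isTriangle x
  have hd := hc.dart (tetrahedron.next x)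
  rw [TrivalentMap.vertexWeight_eq hA₀ hA₁]
  rw [h.rot_y, TrivalentMap.edge_opp] at hd ⊢
  rw [← tetrahedronState_next, tetrahedronState_opp, TrivalentMap.region_next,
    tetrahedronState_next, tetrahedronState_opp, tetrahedronState_self, tet_zero hA₀ hA₁ hd]

theorem tetrahedron_rot_opp (x : Fin 4 × Fin 3) :
    tetrahedron.rot (tetrahedron.opp (tetrahedron.rot (tetrahedron.rot x))) =
      tetrahedron.opp (tetrahedron.rot (tetrahedron.rot (tetrahedron.next (tetrahedron.next x)))) := by
  revert x; decide

theorem tetrahedron_vertices (x : Fin 4 × Fin 3) :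
    (tetrahedron.next x).1 ≠ x.1 ∧ (tetrahedron.next (tetrahedron.next x)).1 ≠ x.1 ∧
      (tetrahedron.next (tetrahedron.next x)).1 ≠ (tetrahedron.next x).1 ∧
      Finset.univ = {(tetrahedron.next x).1, (tetrahedron.next (tetrahedron.next x)).1, x.1,
        (tetrahedron.opp (tetrahedron.rot (tetrahedron.rot x))).1} ∧
      (tetrahedron.opp (tetrahedron.rot (tetrahedron.rot x))).1 ∉
        ({(tetrahedron.next x).1, (tetrahedron.next (tetrahedron.next x)).1, x.1} : Finset (Fin 4)) := by
  revert x; decide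

theorem tetrahedron_apexWeight (hA₀ : A ≠ 0) (hA₁ : ‖A‖ < 1) (c : tetrahedron.Edge → ℤ)
    {x y z : Fin 4 × Fin 3} (h : tetrahedron.IsTriangle x y z) :
    tetrahedron.vertexWeight A c (tetrahedronState c x)
        (tetrahedron.opp (tetrahedron.rot (tetrahedron.rot x))).1 =
      tet A (c (tetrahedron.edge (tetrahedron.rot (tetrahedron.rot x))))
        (c (tetrahedron.edge (tetrahedron.rot (tetrahedron.rot z))))
        (c (tetrahedron.edge (tetrahedron.rot (tetrahedron.rot y))))
        (c (tetrahedron.edge y)) (c (tetrahedron.edge x)) (c (tetrahedron.edge z)) := by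
  have r1 := tetrahedron_rot_opp x
  have r2 := tetrahedron_rot_opp z
  have hy : tetrahedronState c y = tetrahedronState c x := by
    rw [← h.next_x, tetrahedronState_next]
  have hz : tetrahedronState c z = tetrahedronState c x := by
    rw [← h.next_y, tetrahedronState_next, hy]
  have hreg : ∀ d, tetrahedron.region (tetrahedron.opp (tetrahedron.rot (tetrahedron.rot d))) =
      tetrahedron.region (tetrahedron.rot d) := fun d => by
    rw [← tetrahedron.region_rot_rot, tetrahedron.rot_rot_rot]
  rw [h.next_x, h.next_y] at r1
  rw [h.next_z, h.next_x] at r2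
  rw [TrivalentMap.vertexWeight_eq hA₀ hA₁, r1, r2, tetrahedron.opp_opp, TrivalentMap.edge_opp,
    TrivalentMap.edge_opp, TrivalentMap.edge_opp, hreg, hreg, tetrahedron.region_rot_rot,
    h.rotate.rot_y, h.rotate.rotate.rot_y, tetrahedronState_opp, ← hz, tetrahedronState_opp, hz,
    ← hy, tetrahedronState_opp]

/-- The three vertices around the region of state `0` contribute inverse roots of region weights,
each root occurring twice. They cancel the weights of the other three regions, and the apex
contributes the symbol. -/
theorem tetrahedron_bracket_region (hA₀ : A ≠ 0) (hA₁ : ‖A‖ < 1) {c : tetrahedron.Edge → ℤ}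
    (hc : tetrahedron.Admissible c) {x y z : Fin 4 × Fin 3} (h : tetrahedron.IsTriangle x y z) :
    tetrahedron.bracket A (tetrahedron.region x) c =
      tet A (c (tetrahedron.edge (tetrahedron.rot (tetrahedron.rot x))))
        (c (tetrahedron.edge (tetrahedron.rot (tetrahedron.rot z))))
        (c (tetrahedron.edge (tetrahedron.rot (tetrahedron.rot y))))
        (c (tetrahedron.edge y)) (c (tetrahedron.edge x)) (c (tetrahedron.edge z)) := by
  classical
  have hy : tetrahedronState c y = tetrahedronState c x := by
    rw [← h.next_x, tetrahedronState_next]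
  have hz : tetrahedronState c z = tetrahedronState c x := by
    rw [← h.next_y, tetrahedronState_next, hy]
  have w0 := tetrahedron_vertexWeight hA₀ hA₁ hc x
  have w1 := tetrahedron_vertexWeight hA₀ hA₁ hc y
  have w2 := tetrahedron_vertexWeight hA₀ hA₁ hc z
  rw [h.next_x] at w0
  rw [h.next_y, hy] at w1
  rw [h.next_z, hz] at w2
  have hreg : (Finset.univ : Finset tetrahedron.Region) = {tetrahedron.region x,
      tetrahedron.region (tetrahedron.opp x), tetrahedron.region (tetrahedron.opp y),
      tetrahedron.region (tetrahedron.opp z)} := by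
    ext r
    obtain ⟨d, rfl⟩ := tetrahedron.exists_region_eq r
    have := tetrahedron_region_cases x d
    rw [h.next_x, h.next_y] at this
    simpa using this
  obtain ⟨n1, n2, n3, hver, n4⟩ := tetrahedron_vertices x
  have m0 := tetrahedron_regions_ne x
  have m1 := tetrahedron_regions_ne y
  have m2 := tetrahedron_regions_ne z
  have k0 := h.region_opp_ne
  have k1 := h.rotate.region_opp_ne
  have k2 := h.rotate.rotate.region_opp_ne
  rw [h.region_y] at k1
  rw [h.region_z] at k2
  rw [h.next_x, h.next_y] at hver n4
  rw [h.next_x] at n1 n3 m0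
  rw [h.next_y] at n3 m1
  rw [h.next_x, h.next_y] at n2
  rw [h.next_z] at m2
  rw [tetrahedron_bracket_eq_weight hA₀ hA₁, TrivalentMap.weight_eq, hreg, hver,
    Finset.prod_insert, Finset.prod_insert, Finset.prod_pair, Finset.prod_insert,
    Finset.prod_insert, Finset.prod_pair, w0, w1, w2, tetrahedron_apexWeight hA₀ hA₁ c h]
  · have o0 := tetrahedronState_opp c x
    have o1 := tetrahedronState_opp c y
    have o2 := tetrahedronState_opp c z
    rw [hy] at o1
    rw [hz] at o2
    have h0 := hc.dart x
    have h1 := hc.dart y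
    have h2 := hc.dart z
    have e0 : tetrahedron.edge (tetrahedron.rot x) = tetrahedron.edge z := by
      rw [h.rotate.rotate.rot_y, TrivalentMap.edge_opp]
    have e1 : tetrahedron.edge (tetrahedron.rot y) = tetrahedron.edge x := by
      rw [h.rot_y, TrivalentMap.edge_opp]
    have e2 : tetrahedron.edge (tetrahedron.rot z) = tetrahedron.edge y := by
      rw [h.rotate.rot_y, TrivalentMap.edge_opp]
    rw [e0] at h0
    rw [e1] at h1
    rw [e2] at h2
    rw [o0, o1, o2, tetrahedronState_self]
    generalize c (tetrahedron.edge x) = a₀ at *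
    generalize c (tetrahedron.edge y) = a₁ at *
    generalize c (tetrahedron.edge z) = a₂ at *
    generalize c (tetrahedron.edge (tetrahedron.rot (tetrahedron.rot x))) = b₂ at *
    generalize c (tetrahedron.edge (tetrahedron.rot (tetrahedron.rot y))) = b₀ at *
    generalize c (tetrahedron.edge (tetrahedron.rot (tetrahedron.rot z))) = b₁ at *
    -- The sum of the three spokes is even, because every side occurs twice in the parity conditions
    -- at the corners.
    have hI : Complex.I ^ (2 * b₀) * Complex.I ^ (2 * b₁) * Complex.I ^ (2 * b₂) = 1 := by
      rw [← zpow_add₀ Complex.I_ne_zero, ← zpow_add₀ Complex.I_ne_zero,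
        ← zpow_zero Complex.I]
      refine I_zpow_congr ?_
      have p0 := h0.2.2.2
      have p1 := h1.2.2.2
      have p2 := h2.2.2.2
      rw [Int.even_iff] at p0 p1 p2
      omega
    have q0 := sqrtRegionWeight_ne_zero hA₀ hA₁ h0.nonneg.1
    have q1 := sqrtRegionWeight_ne_zero hA₀ hA₁ h1.nonneg.1
    have q2 := sqrtRegionWeight_ne_zero hA₀ hA₁ h2.nonneg.1
    have hw0 : regionWeight A 0 = 1 := by simp [regionWeight, qInt_one hA₀ hA₁]
    rw [← sqrtRegionWeight_mul_self hA₀ hA₁ h0.nonneg.1,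
      ← sqrtRegionWeight_mul_self hA₀ hA₁ h1.nonneg.1,
      ← sqrtRegionWeight_mul_self hA₀ hA₁ h2.nonneg.1, hw0]
    field_simp
    linear_combination tet A b₂ b₁ b₀ a₁ a₀ a₂ * hI
  all_goals
    simp only [Finset.mem_insert, Finset.mem_singleton, not_or] at n4 ⊢
    grind

theorem tetrahedron_bracket (hA₀ : A ≠ 0) (hA₁ : ‖A‖ < 1) (r₀ : tetrahedron.Region)
    {c : tetrahedron.Edge → ℤ} (hc : tetrahedron.Admissible c) :
    tetrahedron.bracket A r₀ c =
      tet A (c (tetrahedron.edge (0, 0))) (c (tetrahedron.edge (0, 1)))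
        (c (tetrahedron.edge (0, 2))) (c (tetrahedron.edge (2, 2)))
        (c (tetrahedron.edge (1, 1))) (c (tetrahedron.edge (1, 2))) := by
  have hcyc : ∀ a b c d e f : ℤ, tet A b c a e f d = tet A a b c d e f := fun a b c d e f => by
    rw [← tet_swap_right hA₀ hA₁ b c a, tet_swap hA₀ hA₁ a b c]
  obtain ⟨d, rfl⟩ := tetrahedron.exists_region_eq r₀
  have o1 : tetrahedron.edge (1, 0) = tetrahedron.edge (0, 0) := tetrahedron.edge_opp (0, 0)
  have o2 : tetrahedron.edge (2, 0) = tetrahedron.edge (0, 1) := tetrahedron.edge_opp (0, 1)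
  have o3 : tetrahedron.edge (3, 0) = tetrahedron.edge (0, 2) := tetrahedron.edge_opp (0, 2)
  have o4 : tetrahedron.edge (3, 2) = tetrahedron.edge (1, 1) := tetrahedron.edge_opp (1, 1)
  have o5 : tetrahedron.edge (2, 1) = tetrahedron.edge (1, 2) := tetrahedron.edge_opp (1, 2)
  have o6 : tetrahedron.edge (3, 1) = tetrahedron.edge (2, 2) := tetrahedron.edge_opp (2, 2)
  -- One dart for each of the four regions; the four resulting symbols agree by tetrahedral
  -- symmetry.
  have cases : ∀ d, tetrahedron.region d = tetrahedron.region (0, 0) ∨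
      tetrahedron.region d = tetrahedron.region (0, 1) ∨
      tetrahedron.region d = tetrahedron.region (0, 2) ∨
      tetrahedron.region d = tetrahedron.region (1, 1) := by
    simp only [TrivalentMap.region_eq_iff_of_triangle (tetrahedron_isTriangle _).iterate]
    decide
  rcases cases d with h | h | h | h <;> rw [h]
  · have t : tetrahedron.IsTriangle (0, 0) (1, 2) (2, 0) := tetrahedron_isTriangle (0, 0)
    have key := tetrahedron_bracket_region hA₀ hA₁ hc t
    rw [key, o2, tet_flip hA₀ hA₁, hcyc, hcyc]
    rfl
  · have t : tetrahedron.IsTriangle (0, 1) (2, 2) (3, 0) := tetrahedron_isTriangle (0, 1)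
    have key := tetrahedron_bracket_region hA₀ hA₁ hc t
    rw [key, o3, tet_flip hA₀ hA₁, ← o4, ← o5]
    rfl
  · have t : tetrahedron.IsTriangle (0, 2) (3, 2) (1, 0) := tetrahedron_isTriangle (0, 2)
    have key := tetrahedron_bracket_region hA₀ hA₁ hc t
    rw [key, o1, o4, hcyc, ← tet_swap hA₀ hA₁, tet_flip hA₀ hA₁, tet_swap hA₀ hA₁, ← o6]
    rfl
  · have t : tetrahedron.IsTriangle (1, 1) (3, 1) (2, 1) := tetrahedron_isTriangle (1, 1)
    have key := tetrahedron_bracket_region hA₀ hA₁ hc t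
    rw [key, o6, o5, ← o1, ← o2, ← o3]
    rfl

end

end SpinNetwork

namespace SpinNetwork

noncomputable section

section quantum

variable {A : ℂ}

/-! ### Pushing a circle of color `1/2` across a disc -/

/-- The last element of the list `s :: l`. -/
def lastD : ℤ → List ℤ → ℤ
  | s, [] => s
  | _, t :: l => lastD t l

theorem lastD_append (s : ℤ) (p q : List ℤ) : lastD s (p ++ q) = lastD (lastD s p) q := by
  induction p generalizing s with
  | nil => rfl
  | cons t p ih => exact ih t

theorem lastD_mem {s : ℤ} {p : List ℤ} : lastD s p = s ∨ lastD s p ∈ p := by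
  induction p generalizing s with
  | nil => exact .inl rfl
  | cons t p ih =>
    right
    rcases ih (s := t) with h | h
    · rw [lastD, h]; exact List.mem_cons_self
    · exact List.mem_cons_of_mem _ h

/-- The action of an arc of color `1/2` that crosses legs of colors `cs`, on functions of the states
of the regions between the legs; `s` and `s'` are the states of the first region. -/
def transfer (A : ℂ) : List ℤ → List ℤ → ℤ → ℤ → (List ℤ → ℂ) → ℂ
  | [], _, _, _, g => g []
  | _ :: _, [], _, _, _ => 0
  | c :: cs, t :: ss, s, s', g => ∑ t' ∈ nbr t, regionWeight A t' * halfTet A c s t s' t' *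
      transfer A cs ss t t' fun l => g (t' :: l)

/-- Crossing two groups of legs is crossing one after the other; the second crossing starts from the
old and new states of the region between the groups. -/
theorem transfer_append (cs ds P Q : List ℤ) (hP : P.length = cs.length) (s s' : ℤ)
    (g : List ℤ → ℂ) :
    transfer A (cs ++ ds) (P ++ Q) s s' g = transfer A cs P s s' fun p' =>
      transfer A ds Q (lastD s P) (lastD s' p') fun q' => g (p' ++ q') := by
  induction cs generalizing P s s' g with
  | nil =>
    obtain rfl := List.length_eq_zero_iff.1 hP
    rfl
  | cons c cs ih =>
    obtain ⟨t, P, rfl⟩ := List.exists_cons_of_length_eq_add_one hP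
    simp only [List.cons_append, transfer]
    refine Finset.sum_congr rfl fun t' _ => ?_
    rw [ih P (by simpa using hP)]
    rfl

/-- Old and new states of a region are always neighbors. This fact about the last region is
available as a hypothesis because the pentagon needs it. -/
theorem transfer_congr (cs P : List ℤ) (hP : P.length = cs.length) {s s' : ℤ} (hs : s' ∈ nbr s)
    {g h : List ℤ → ℂ}
    (H : ∀ p', p'.length = cs.length → lastD s' p' ∈ nbr (lastD s P) → g p' = h p') :
    transfer A cs P s s' g = transfer A cs P s s' h := by
  induction cs generalizing P s s' g h with
  | nil =>
    obtain rfl := List.length_eq_zero_iff.1 hP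
    exact H [] rfl hs
  | cons c cs ih =>
    obtain ⟨t, P, rfl⟩ := List.exists_cons_of_length_eq_add_one hP
    simp only [transfer]
    refine Finset.sum_congr rfl fun t' ht' => ?_
    rw [ih P (by simpa using hP) ht' fun p' hp' hl => H (t' :: p') (by simp [hp']) hl]

theorem transfer_sum {ι : Type*} (S : Finset ι) (k : ι → ℂ) (cs P : List ℤ) (s s' : ℤ)
    (g : ι → List ℤ → ℂ) :
    (transfer A cs P s s' fun p => ∑ i ∈ S, k i * g i p) =
      ∑ i ∈ S, k i * transfer A cs P s s' (g i) := by
  induction cs generalizing P s s' g with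
  | nil => rfl
  | cons c cs ih =>
    cases P with
    | nil => simp [transfer]
    | cons t P =>
      simp only [transfer, ih, Finset.mul_sum]
      rw [Finset.sum_comm]
      refine Finset.sum_congr rfl fun i _ => Finset.sum_congr rfl fun t' _ => ?_
      ring

theorem transfer_mul (k : ℂ) (cs P : List ℤ) (s s' : ℤ) (g : List ℤ → ℂ) :
    (transfer A cs P s s' fun p => k * g p) = k * transfer A cs P s s' g := by
  simpa using transfer_sum (A := A) {()} (fun _ => k) cs P s s' fun _ => g

/-- The function `F` of the states of the regions at the boundary of a disc with legs of colors `cs` is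
compatible with pushing a circle of color `1/2` across the disc. -/
def Intertwines (A : ℂ) (cs : List ℤ) (F : List ℤ → ℂ) : Prop :=
  ∀ (s s' : ℤ) (ss : List ℤ), ss.length = cs.length → 0 ≤ s → 0 ≤ s' → (∀ t ∈ ss, 0 ≤ t) →
    lastD s ss = s → s' ∈ nbr s →
    (transfer A cs ss s s' fun l => F (s' :: l)) =
      regionWeight A s' / regionWeight A s * F (s :: ss)

/-- The value of a disc that meets the graph in an arc of color `c`. -/
def arcValue (c : ℤ) : List ℤ → ℂ
  | [u, v, w] => open scoped Classical in if AdmTriple c u v ∧ w = u then 1 else 0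
  | _ => 0

/-- The two crossings of the arc give the square of one half tetrahedron, and orthogonality sums it.
-/
theorem intertwines_arcValue (hA₀ : A ≠ 0) (hA₁ : ‖A‖ < 1) (c : ℤ) :
    Intertwines A [c, c] (arcValue c) := by
  intro u u' ss hl hu hu' _ hlast hn
  obtain ⟨v, w, rfl⟩ : ∃ v w, ss = [v, w] := List.length_eq_two.1 hl
  obtain rfl : w = u := hlast
  have h1 : ∀ v' ∈ nbr v, ∑ t' ∈ nbr w, regionWeight A t' * halfTet A c v w v' t' *
      arcValue c [u', v', t'] = regionWeight A u' * halfTet A c v w v' u' *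
        arcValue c [u', v', u'] := by
    intro v' _
    refine Finset.sum_eq_single_of_mem u' hn fun t' _ ht' => ?_
    simp [arcValue, ht']
  have h2 : ∀ v', halfTet A c w v u' v' * (halfTet A c v w v' u' * arcValue c [u', v', u']) =
      halfTet A c u' v' w v * halfTet A c u' v' w v := by
    intro v'
    rw [halfTet_swap hA₀ hA₁ c w v u' v', ← halfTet_symm hA₀ hA₁ c w v u' v']
    by_cases h : halfTet A c u' v' w v = 0
    · simp [h]
    · have := (admTriple_of_halfTet_ne_zero h).1
      simp [arcValue, this]
  simp only [transfer]
  rw [Finset.sum_congr rfl fun v' hv' => by rw [h1 v' hv']]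
  have h3 : ∀ v' ∈ nbr v, regionWeight A v' * halfTet A c w v u' v' * (regionWeight A u' *
      halfTet A c v w v' u' * arcValue c [u', v', u']) = regionWeight A u' * (regionWeight A v' *
        (halfTet A c u' v' w v * halfTet A c u' v' w v)) := by
    intro v' _
    rw [← h2]
    ring
  rw [Finset.sum_congr rfl h3, ← Finset.mul_sum]
  by_cases h : AdmTriple c w v
  · rw [orthogonality_sum hA₀ hA₁ hu' h (mem_nbr_comm.1 hn) (mem_nbr_comm.1 hn)]
    simp [arcValue, h, div_eq_mul_inv]
  · have : ∀ v', halfTet A c u' v' w v = 0 := fun v' => by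
      by_contra h'
      exact h (admTriple_of_halfTet_ne_zero h').2.1
    simp [arcValue, h, this]

theorem exists_append_of_length {α : Type*} {l : List α} {m n : ℕ} (h : l.length = m + n) :
    ∃ p q, l = p ++ q ∧ p.length = m ∧ q.length = n :=
  ⟨l.take m, l.drop m, (List.take_append_drop m l).symm, by simp [h], by simp [h]⟩

/-- Enlarging a disc by the end of one of its legs, a vertex. -/
theorem Intertwines.grow (hA₀ : A ≠ 0) (hA₁ : ‖A‖ < 1) {F F' : List ℤ → ℂ}
    {pre post : List ℤ} {c c₁ c₂ : ℤ} (hF : Intertwines A (pre ++ c :: post) F)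
    (hF' : ∀ s p x y q, p.length = pre.length → F' (s :: (p ++ x :: y :: q)) =
      tet A c c₁ c₂ x y (lastD s p) * F (s :: (p ++ y :: q))) :
    Intertwines A (pre ++ c₁ :: c₂ :: post) F' := by
  intro s s' ss hl hs hs' hpos hlast hn
  obtain ⟨P, R, rfl, hP, hR⟩ := exists_append_of_length (l := ss) (m := pre.length)
    (n := post.length + 2) (by simpa using hl)
  obtain ⟨x, R, rfl⟩ := List.exists_cons_of_length_eq_add_one hR
  obtain ⟨y, Q, rfl⟩ := List.exists_cons_of_length_eq_add_one (n := post.length) (by simpa using hR)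
  have hQ : Q.length = post.length := by simpa using hR
  have key := hF s s' (P ++ y :: Q) (by simp [hP, hQ]) hs hs'
    (fun t ht => hpos t (by
      simp only [List.mem_append, List.mem_cons] at ht ⊢; tauto))
    (by rw [lastD_append] at hlast ⊢; exact hlast) hn
  rw [hF' s P x y Q hP, mul_left_comm, ← key, transfer_append _ _ _ _ hP,
    transfer_append _ _ _ _ hP, ← transfer_mul]
  refine transfer_congr pre P hP hn fun p' hp' hr => ?_
  simp only [transfer]
  rw [Finset.mul_sum]
  simp only [Finset.mul_sum]
  rw [Finset.sum_comm]
  refine Finset.sum_congr rfl fun y' hy' => ?_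
  -- The pentagon at the new vertex trades the crossing of the leg `c` for crossings of `c₁` and
  -- `c₂`.
  rw [← mul_assoc, mul_left_comm (tet A c c₁ c₂ x y (lastD s P)),
    halfTet_swap hA₀ hA₁ c y (lastD s P) y' (lastD s' p'),
    ← pentagon_sum hA₀ hA₁ hy' hr, Finset.mul_sum, Finset.sum_mul]
  refine Finset.sum_congr rfl fun x' _ => ?_
  simp only [hF' _ _ _ _ _ hp', transfer_mul]
  rw [halfTet_swap hA₀ hA₁ c₁ x (lastD s P) x' (lastD s' p')]
  ring

open scoped Classical in
/-- The states that are admissible next to a region of state `r` across an edge of color `c`. -/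
def admStates (c r : ℤ) : Finset ℤ := {v ∈ Finset.Icc 0 (c + r) | AdmTriple c r v}

theorem mem_admStates {c r v : ℤ} : v ∈ admStates c r ↔ AdmTriple c r v := by
  simp only [admStates, Finset.mem_filter, Finset.mem_Icc, and_iff_right_iff_imp]
  intro h
  exact ⟨h.nonneg.2.2, h.1⟩

/-- Joining two consecutive legs of a disc. -/
theorem Intertwines.close (hA₀ : A ≠ 0) (hA₁ : ‖A‖ < 1) {F F' : List ℤ → ℂ}
    {pre post : List ℤ} {c : ℤ} (hF : Intertwines A (pre ++ c :: c :: post) F)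
    (hF' : ∀ s p q, p.length = pre.length → F' (s :: (p ++ q)) =
      ∑ v ∈ admStates c (lastD s p), regionWeight A v * F (s :: (p ++ v :: lastD s p :: q))) :
    Intertwines A (pre ++ post) F' := by
  intro s s' ss hl hs hs' hpos hlast hn
  obtain ⟨P, Q, rfl, hP, hQ⟩ := exists_append_of_length (l := ss) (m := pre.length)
    (n := post.length) (by simpa using hl)
  have hr0 : 0 ≤ lastD s P := by
    rcases lastD_mem (s := s) (p := P) with h | h
    · rwa [h]
    · exact hpos _ (List.mem_append_left _ h)
  have key : ∀ v ∈ admStates c (lastD s P), _ := fun v hv =>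
    hF s s' (P ++ v :: lastD s P :: Q) (by simp [hP, hQ]) hs hs'
      (fun t ht => by
        simp only [List.mem_append, List.mem_cons] at ht
        rcases ht with ht | rfl | rfl | ht
        · exact hpos t (List.mem_append_left _ ht)
        · exact (mem_admStates.1 hv).nonneg.2.2
        · exact hr0
        · exact hpos t (List.mem_append_right _ ht))
      (by rw [lastD_append] at hlast ⊢; exact hlast) hn
  rw [hF' s P Q hP, Finset.mul_sum, transfer_append _ _ _ _ hP]
  have e : ∀ v ∈ admStates c (lastD s P),
      regionWeight A s' / regionWeight A s *
        (regionWeight A v * F (s :: (P ++ v :: lastD s P :: Q))) = regionWeight A v *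
      transfer A pre P s s' fun p' => transfer A (c :: c :: post) (v :: lastD s P :: Q) (lastD s P)
        (lastD s' p') fun q' => F (s' :: (p' ++ q')) := by
    intro v hv
    rw [mul_left_comm, ← key v hv, transfer_append _ _ _ _ hP]
  rw [Finset.sum_congr rfl e, ← transfer_sum]
  refine transfer_congr pre P hP hn fun p' hp' hr => ?_
  simp only [hF' _ _ _ hp']
  set r := lastD s P
  set r' := lastD s' p'
  simp only [transfer, Finset.mul_sum]
  rw [sum_sum_nbr_comm (S' := admStates c r'), transfer_sum]
  · refine Finset.sum_congr rfl fun v' hv' => ?_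
    have hadm := mem_admStates.1 hv'
    -- Summation over `v` is orthogonality. It forces the new state behind the second leg to equal
    -- the one before the first leg, as it must for two legs that have been joined.
    rw [Finset.sum_comm, Finset.sum_eq_single_of_mem r' hr]
    · have h := orthogonality_sum hA₀ hA₁ hr0 hadm hr hr
      rw [if_pos rfl] at h
      calc _ = regionWeight A v' * (regionWeight A r' * (regionWeight A r')⁻¹) *
            transfer A post Q r r' fun q' => F (s' :: (p' ++ v' :: r' :: q')) := by
            rw [mul_inv_cancel₀ (regionWeight_ne_zero hA₀ hA₁ hadm.nonneg.2.1), mul_one]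
        _ = _ := by
          rw [← h, Finset.mul_sum, Finset.mul_sum, Finset.sum_mul]
          refine Finset.sum_congr rfl fun v _ => ?_
          rw [halfTet_swap hA₀ hA₁ c r v r' v']
          ring
    · intro r'' hr'' hne
      have h := orthogonality_sum hA₀ hA₁ hr0 hadm hr hr''
      rw [if_neg hne] at h
      calc _ = regionWeight A v' * regionWeight A r'' * (∑ v ∈ nbr v', regionWeight A v *
            (halfTet A c r v r' v' * halfTet A c r v r'' v')) *
            transfer A post Q r r'' fun q' => F (s' :: (p' ++ v' :: r'' :: q')) := by
            rw [Finset.mul_sum, Finset.sum_mul]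
            refine Finset.sum_congr rfl fun v _ => ?_
            rw [halfTet_swap hA₀ hA₁ c r v r'' v']
            ring
        _ = 0 := by rw [h, mul_zero, zero_mul]
  · intro v v' hne
    by_contra h
    refine hne (Finset.sum_eq_zero fun r'' _ => ?_)
    have h0 : halfTet A c r v r' v' = 0 := by
      by_contra h'
      have := admTriple_of_halfTet_ne_zero h'
      exact h ⟨mem_admStates.2 this.1, mem_admStates.2 this.2.1⟩
    rw [h0]
    ring

/-- A disc with two legs of the same color takes a single value on admissible states. -/
theorem Intertwines.eq_of_pair (hA₀ : A ≠ 0) (hA₁ : ‖A‖ < 1) {F : List ℤ → ℂ} {c : ℤ}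
    (hF : Intertwines A [c, c] F) (hlast : ∀ s ss, F (s :: ss) ≠ 0 → lastD s ss = s)
    (hc : 0 ≤ c) : F [c, 0, c] = F [0, c, 0] := by
  -- Pushing a circle expresses the value with outer state `u + 1` through values with outer state
  -- `u`. These agree by induction, and orthogonality evaluates the sum of their coefficients.
  have key : ∀ u : ℕ, ∀ v : ℤ, AdmTriple c u v → F [(u : ℤ), v, u] = F [0, c, 0] := by
    intro u
    induction u with
    | zero =>
      intro v h
      rw [Nat.cast_zero] at h ⊢
      rw [admTriple_zero h]
    | succ u ih =>
      intro v h
      have hn : (u : ℤ) ∈ nbr ((u + 1 : ℕ) : ℤ) := mem_nbr.2 (.inr (by push_cast; ring))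
      have h1 := hF ((u + 1 : ℕ) : ℤ) u [v, ((u + 1 : ℕ) : ℤ)] rfl (by positivity) (by positivity)
        (by
          intro t ht
          simp only [List.mem_cons, List.not_mem_nil, or_false] at ht
          rcases ht with rfl | rfl
          · exact h.nonneg.2.2
          · positivity) rfl hn
      generalize ((u + 1 : ℕ) : ℤ) = w at *
      simp only [transfer] at h1
      have h2 : ∀ v' ∈ nbr v, ∑ t' ∈ nbr w, regionWeight A t' * halfTet A c v w v' t' *
          F [(u : ℤ), v', t'] = regionWeight A u * halfTet A c v w v' u * F [(u : ℤ), v', u] := by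
        intro v' _
        refine Finset.sum_eq_single_of_mem _ hn fun t' _ ht' => ?_
        by_contra h'
        exact ht' (hlast _ _ (right_ne_zero_of_mul h'))
      rw [Finset.sum_congr rfl fun v' hv' => by rw [h2 v' hv']] at h1
      have h3 : ∀ v' ∈ nbr v, regionWeight A v' * halfTet A c w v u v' * (regionWeight A u *
          halfTet A c v w v' u * F [(u : ℤ), v', u]) = regionWeight A u * F [0, c, 0] *
            (regionWeight A v' * (halfTet A c u v' w v * halfTet A c u v' w v)) := by
        intro v' _
        rw [halfTet_swap hA₀ hA₁ c w v u v', ← halfTet_symm hA₀ hA₁ c w v u v']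
        by_cases h' : halfTet A c u v' w v = 0
        · simp [h']
        · rw [ih v' (admTriple_of_halfTet_ne_zero h').1]
          ring
      rw [Finset.sum_congr rfl h3, ← Finset.mul_sum,
        orthogonality_sum hA₀ hA₁ (Int.natCast_nonneg u) h (mem_nbr_comm.1 hn) (mem_nbr_comm.1 hn),
        if_pos rfl] at h1
      have hw := regionWeight_ne_zero hA₀ hA₁ h.nonneg.2.1
      have hu := regionWeight_ne_zero hA₀ hA₁ (Int.natCast_nonneg u)
      field_simp at h1
      exact h1.symm
  have h := key c.toNat 0
  rw [Int.toNat_of_nonneg hc] at h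
  exact h (by simp only [AdmTriple, Int.even_iff]; omega)

end quantum

end

end SpinNetwork

namespace SpinNetwork

noncomputable section

section quantum

variable {A : ℂ}

/-- The function of states obtained from `F` by a vertex at the end of the leg with number `k`. -/
def growValue (A : ℂ) (k : ℕ) (c c₁ c₂ : ℤ) (F : List ℤ → ℂ) : List ℤ → ℂ
  | [] => 0
  | s :: l => match l.drop k with
    | x :: y :: q => tet A c c₁ c₂ x y (lastD s (l.take k)) * F (s :: (l.take k ++ y :: q))
    | _ => 0

theorem growValue_append (c c₁ c₂ : ℤ) (F : List ℤ → ℂ) (s x y : ℤ) (p q : List ℤ) :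
    growValue A p.length c c₁ c₂ F (s :: (p ++ x :: y :: q)) =
      tet A c c₁ c₂ x y (lastD s p) * F (s :: (p ++ y :: q)) := by
  simp [growValue]

theorem lastD_of_growValue_ne_zero {k : ℕ} {c c₁ c₂ : ℤ} {F : List ℤ → ℂ}
    (hF : ∀ s ss, F (s :: ss) ≠ 0 → lastD s ss = s) (s : ℤ) (ss : List ℤ)
    (h : growValue A k c c₁ c₂ F (s :: ss) ≠ 0) : lastD s ss = s := by
  rw [← List.take_append_drop k ss]
  unfold growValue at h
  simp only at h
  split at h
  · next x y q hd =>
    have := hF _ _ (right_ne_zero_of_mul h)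
    rw [hd]
    rw [lastD_append] at this ⊢
    exact this
  · exact absurd rfl h

/-- The function of states obtained from `F` by joining the legs with numbers `k` and `k + 1`. -/
def closeValue (A : ℂ) (k : ℕ) (c : ℤ) (F : List ℤ → ℂ) : List ℤ → ℂ
  | [] => 0
  | s :: l => ∑ v ∈ admStates c (lastD s (l.take k)), regionWeight A v *
      F (s :: (l.take k ++ v :: lastD s (l.take k) :: l.drop k))

theorem closeValue_append (c : ℤ) (F : List ℤ → ℂ) (s : ℤ) (p q : List ℤ) :
    closeValue A p.length c F (s :: (p ++ q)) =
      ∑ v ∈ admStates c (lastD s p), regionWeight A v * F (s :: (p ++ v :: lastD s p :: q)) := by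
  simp [closeValue]

theorem lastD_of_closeValue_ne_zero {k : ℕ} {c : ℤ} {F : List ℤ → ℂ}
    (hF : ∀ s ss, F (s :: ss) ≠ 0 → lastD s ss = s) (s : ℤ) (ss : List ℤ)
    (h : closeValue A k c F (s :: ss) ≠ 0) : lastD s ss = s := by
  obtain ⟨v, -, hv⟩ := Finset.exists_ne_zero_of_sum_ne_zero h
  have := hF _ _ (right_ne_zero_of_mul hv)
  rw [← List.take_append_drop k ss]
  rw [lastD_append] at this ⊢
  exact this

end quantum

namespace TrivalentMap

variable {V : Type*} {Γ : TrivalentMap V} {A : ℂ}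

/-! ### Words of legs around a disc -/

/-- Legs of a disc, given by darts that leave the disc, in counterclockwise order; the first leg has the
region `r` to its right, and the last one has `r'` to its left. -/
def IsPath (Γ : TrivalentMap V) : Γ.Region → List (V × Fin 3) → Γ.Region → Prop
  | r, [], r' => r = r'
  | r, d :: w, r' => Γ.region (Γ.opp d) = r ∧ Γ.IsPath (Γ.region d) w r'

theorem isPath_append {r r' : Γ.Region} {p q : List (V × Fin 3)} :
    Γ.IsPath r (p ++ q) r' ↔ ∃ m, Γ.IsPath r p m ∧ Γ.IsPath m q r' := by
  induction p generalizing r with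
  | nil => simp [IsPath]
  | cons d p ih => simp [IsPath, ih, and_assoc]

theorem IsPath.lastD {r r' : Γ.Region} {p : List (V × Fin 3)} (h : Γ.IsPath r p r')
    (s : Γ.Region → ℤ) : lastD (s r) (p.map fun d => s (Γ.region d)) = s r' := by
  induction p generalizing r with
  | nil => rw [← show r = r' from h]; rfl
  | cons d p ih => exact ih h.2

theorem IsPath.mem {r r' : Γ.Region} {p : List (V × Fin 3)} (h : Γ.IsPath r p r') :
    r' = r ∧ p = [] ∨ r' ∈ p.map Γ.region := by
  induction p generalizing r with
  | nil => exact .inl ⟨(show r = r' from h).symm, rfl⟩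
  | cons d p ih =>
    right
    rcases ih h.2 with ⟨h', -⟩ | h'
    · rw [h']; exact List.mem_cons_self
    · exact List.mem_cons_of_mem _ h'

/-- `F` is the value of a disc with legs `w` which contains the vertices in `S`. -/
structure IsDisc (Γ : TrivalentMap V) (A : ℂ) (c : Γ.Edge → ℤ) (r₀ : Γ.Region)
    (w : List (V × Fin 3)) (S : Finset V) (F : List ℤ → ℂ) : Prop where
  intertwines : Intertwines A (w.map fun d => c (Γ.edge d)) F
  last : ∀ s ss, F (s :: ss) ≠ 0 → lastD s ss = s
  eval : ∀ s : Γ.Region → ℤ,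
    F (s r₀ :: w.map fun d => s (Γ.region d)) = ∏ v ∈ S, Γ.vertexWeight A c s v

theorem region_opp_rot (d : V × Fin 3) : Γ.region (Γ.opp (Γ.rot d)) = Γ.region d := by
  rw [← region_rot_rot, rot_rot_rot]

/-- A disc around one vertex is a disc around an arc whose first leg has been prolonged to a vertex.
-/
theorem exists_isDisc_vertex (hA₀ : A ≠ 0) (hA₁ : ‖A‖ < 1) (c : Γ.Edge → ℤ) (d : V × Fin 3) :
    ∃ F, Γ.IsDisc A c (Γ.region d) [Γ.rot d, Γ.rot (Γ.rot d), d] {d.1} F := by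
  refine ⟨growValue A 0 (c (Γ.edge d)) (c (Γ.edge (Γ.rot d))) (c (Γ.edge (Γ.rot (Γ.rot d))))
    (arcValue (c (Γ.edge d))), ?_, ?_, ?_⟩
  · refine Intertwines.grow hA₀ hA₁ (pre := []) (post := [c (Γ.edge d)])
      (intertwines_arcValue hA₀ hA₁ (c (Γ.edge d))) fun s p x y q hp => ?_
    obtain rfl := List.length_eq_zero_iff.1 hp
    exact growValue_append _ _ _ _ s x y [] q
  · refine lastD_of_growValue_ne_zero fun s ss h => ?_
    unfold arcValue at h
    split at h
    · next u v w heq =>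
      cases heq
      simp only [ne_eq, ite_eq_right_iff, one_ne_zero, imp_false, not_not] at h
      exact h.2
    · exact absurd rfl h
  · intro s
    have h := growValue_append (A := A) (c (Γ.edge d)) (c (Γ.edge (Γ.rot d)))
      (c (Γ.edge (Γ.rot (Γ.rot d)))) (arcValue (c (Γ.edge d))) (s (Γ.region d))
      (s (Γ.region (Γ.rot d))) (s (Γ.region (Γ.rot (Γ.rot d)))) [] [s (Γ.region d)]
    refine h.trans ?_
    rw [Finset.prod_singleton, vertexWeight_eq hA₀ hA₁, region_rot_rot]
    by_cases h0 : tet A (c (Γ.edge d)) (c (Γ.edge (Γ.rot d))) (c (Γ.edge (Γ.rot (Γ.rot d))))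
        (s (Γ.region (Γ.rot d))) (s (Γ.region (Γ.opp d))) (s (Γ.region d)) = 0
    · rw [show lastD (s (Γ.region d)) [] = s (Γ.region d) from rfl, h0, zero_mul]
    · have := (admTet_of_ne_zero h0).2.1
      have h1 : AdmTriple (c (Γ.edge d)) (s (Γ.region d)) (s (Γ.region (Γ.opp d))) := this.swap_right
      simp [arcValue, h1, lastD]

open scoped Classical in
theorem IsDisc.grow (hA₀ : A ≠ 0) (hA₁ : ‖A‖ < 1) {c : Γ.Edge → ℤ} {r₀ : Γ.Region}
    {pre post : List (V × Fin 3)} {d : V × Fin 3} {S : Finset V} {F : List ℤ → ℂ}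
    (h : Γ.IsDisc A c r₀ (pre ++ d :: post) S F) (hp : Γ.IsPath r₀ (pre ++ d :: post) r₀)
    (hd : (Γ.opp d).1 ∉ S) :
    ∃ F', Γ.IsDisc A c r₀ (pre ++ Γ.rot (Γ.opp d) :: Γ.rot (Γ.rot (Γ.opp d)) :: post)
      (insert (Γ.opp d).1 S) F' := by
  refine ⟨growValue A pre.length (c (Γ.edge d)) (c (Γ.edge (Γ.rot (Γ.opp d))))
    (c (Γ.edge (Γ.rot (Γ.rot (Γ.opp d))))) F, ?_, lastD_of_growValue_ne_zero h.last, ?_⟩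
  · have h1 := h.intertwines
    rw [List.map_append, List.map_cons] at h1 ⊢
    refine h1.grow hA₀ hA₁ fun s p x y q hl => ?_
    rw [List.length_map] at hl
    rw [← hl, growValue_append]
  · intro s
    obtain ⟨m, hp1, hp2, -⟩ := isPath_append.1 hp
    have h1 := h.eval s
    have h2 := growValue_append (A := A) (c (Γ.edge d)) (c (Γ.edge (Γ.rot (Γ.opp d))))
      (c (Γ.edge (Γ.rot (Γ.rot (Γ.opp d))))) F (s r₀) (s (Γ.region (Γ.rot (Γ.opp d))))
      (s (Γ.region (Γ.rot (Γ.rot (Γ.opp d))))) (pre.map fun d => s (Γ.region d))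
      (post.map fun d => s (Γ.region d))
    rw [List.length_map] at h2
    rw [List.map_append, List.map_cons] at h1 ⊢
    rw [List.map_cons, h2, hp1.lastD s, Finset.prod_insert hd, ← h1, ← hp2,
      vertexWeight_eq hA₀ hA₁, edge_opp, Γ.region_rot_rot, Γ.opp_opp]

variable [Fintype V]

/-! ### Discs that contain all vertices: enclosing regions by gluing legs -/

open scoped Classical in
/-- `F` is the value of a disc with legs `w` which contains all vertices, and the regions in `C`. -/
structure IsFullDisc (Γ : TrivalentMap V) (A : ℂ) (c : Γ.Edge → ℤ) (r₀ : Γ.Region)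
    (w : List (V × Fin 3)) (C : Finset Γ.Region) (F : List ℤ → ℂ) : Prop where
  intertwines : Intertwines A (w.map fun d => c (Γ.edge d)) F
  last : ∀ s ss, F (s :: ss) ≠ 0 → lastD s ss = s
  eval : ∀ (s : Γ.Region → ℤ) (N : ℤ), (∀ x : Γ.Region → ℤ, (∀ r ∉ C, x r = s r) →
      ∏ v, Γ.vertexWeight A c x v ≠ 0 → ∀ r ∈ C, x r ≤ N) →
    F (s r₀ :: w.map fun d => s (Γ.region d)) =
      ∑ x ∈ Fintype.piFinset fun r => if r ∈ C then Finset.Icc 0 N else {s r},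
        (∏ r ∈ C, regionWeight A (x r)) * ∏ v, Γ.vertexWeight A c x v

theorem IsDisc.isFullDisc {c : Γ.Edge → ℤ} {r₀ : Γ.Region} {w : List (V × Fin 3)}
    {F : List ℤ → ℂ} (h : Γ.IsDisc A c r₀ w Finset.univ F) : Γ.IsFullDisc A c r₀ w ∅ F := by
  refine ⟨h.intertwines, h.last, fun s N _ => ?_⟩
  rw [h.eval s]
  simp [Fintype.piFinset_singleton]

open scoped Classical in
-- By `hd₁` the region to the left of `d` meets the boundary of the disc only between `d` and `opp
-- d`. Gluing these legs encloses it, and the sum in `closeValue` becomes the sum over its state.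
theorem IsFullDisc.close (hA₀ : A ≠ 0) (hA₁ : ‖A‖ < 1) {c : Γ.Edge → ℤ} {r₀ : Γ.Region}
    {pre post : List (V × Fin 3)} {d : V × Fin 3} {C : Finset Γ.Region} {F : List ℤ → ℂ}
    (h : Γ.IsFullDisc A c r₀ (pre ++ d :: Γ.opp d :: post) C F)
    (hp : Γ.IsPath r₀ (pre ++ d :: Γ.opp d :: post) r₀) (hd₀ : Γ.region d ≠ r₀)
    (hd₁ : Γ.region d ∉ (pre ++ Γ.opp d :: post).map Γ.region) (hd₂ : Γ.region d ∉ C)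
    (hd₃ : Γ.region (Γ.opp d) ∉ C) :
    ∃ F', Γ.IsFullDisc A c r₀ (pre ++ post) (insert (Γ.region d) C) F' := by
  refine ⟨closeValue A pre.length (c (Γ.edge d)) F, ?_, lastD_of_closeValue_ne_zero h.last, ?_⟩
  · have h1 := h.intertwines
    simp only [List.map_append, List.map_cons, edge_opp] at h1 ⊢
    refine h1.close hA₀ hA₁ fun s p q hl => ?_
    rw [List.length_map] at hl
    rw [← hl, closeValue_append]
  · intro s N hN
    obtain ⟨m, hp1, hp2, -⟩ := isPath_append.1 hp
    subst hp2
    have hl := hp1.lastD s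
    have h2 := closeValue_append (A := A) (c (Γ.edge d)) F (s r₀)
      (pre.map fun d => s (Γ.region d)) (post.map fun d => s (Γ.region d))
    rw [List.length_map, ← List.map_append] at h2
    rw [h2, hl, sum_piFinset_eq_sum_update _ (Γ.region d), if_pos (Finset.mem_insert_self _ _)]
    set G : ℤ → ℂ := fun v => ∑ x ∈ Fintype.piFinset fun r => if r ∈ C then Finset.Icc 0 N
      else {Function.update s (Γ.region d) v r},
        (∏ r ∈ C, regionWeight A (x r)) * ∏ v, Γ.vertexWeight A c x v with hG
    have hne : ∀ e ∈ pre ++ Γ.opp d :: post, Γ.region e ≠ Γ.region d := fun e he h' =>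
      hd₁ (List.mem_map.2 ⟨e, he, h'⟩)
    have hopp : Γ.region (Γ.opp d) ≠ Γ.region d := hne _ (by simp)
    have left : ∀ v, F (s r₀ :: (pre.map (fun d => s (Γ.region d)) ++ v :: s (Γ.region (Γ.opp d)) ::
        post.map fun d => s (Γ.region d))) = G v := by
      intro v
      have hv := h.eval (Function.update s (Γ.region d) v) N fun x hx hx' r hr => by
        refine hN x (fun r' hr' => ?_) hx' r (Finset.mem_insert_of_mem hr)
        rw [Finset.mem_insert, not_or] at hr'
        rw [hx r' hr'.2, Function.update_of_ne hr'.1]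
      refine Eq.trans ?_ hv
      rw [Function.update_of_ne hd₀.symm, List.map_append, List.map_cons, List.map_cons,
        Function.update_self, Function.update_of_ne hopp]
      congr 3
      · refine List.map_congr_left fun e he => ?_
        rw [Function.update_of_ne (hne e (by simp [he]))]
      · congr 2
        refine List.map_congr_left fun e he => ?_
        rw [Function.update_of_ne (hne e (by simp [he]))]
    have right : ∀ v, ∑ x ∈ Fintype.piFinset (Function.update
        (fun r => if r ∈ insert (Γ.region d) C then Finset.Icc 0 N else {s r}) (Γ.region d) {v}),
          (∏ r ∈ insert (Γ.region d) C, regionWeight A (x r)) * ∏ v, Γ.vertexWeight A c x v =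
        regionWeight A v * G v := by
      intro v
      rw [hG, Finset.mul_sum]
      have hbox : (Function.update
          (fun r => if r ∈ insert (Γ.region d) C then Finset.Icc 0 N else {s r}) (Γ.region d) {v}) =
          fun r => if r ∈ C then Finset.Icc 0 N else {Function.update s (Γ.region d) v r} := by
        funext r
        rcases eq_or_ne r (Γ.region d) with rfl | hr
        · simp [hd₂]
        · simp [hr]
      rw [hbox]
      refine Finset.sum_congr rfl fun x hx => ?_
      have hx := Fintype.mem_piFinset.1 hx (Γ.region d)
      rw [if_neg hd₂, Function.update_self, Finset.mem_singleton] at hx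
      rw [Finset.prod_insert hd₂, hx, mul_assoc]
    -- `closeValue` sums over admissible states and the bracket over an interval; both ranges
    -- contain the support of `G`.
    have supp : ∀ v, G v ≠ 0 → v ∈ admStates (c (Γ.edge d)) (s (Γ.region (Γ.opp d))) ∧
        v ∈ Finset.Icc 0 N := by
      intro v hv
      obtain ⟨x, hx, hx'⟩ := Finset.exists_ne_zero_of_sum_ne_zero hv
      have hx' := right_ne_zero_of_mul hx'
      have hoff : ∀ r ∉ C, x r = Function.update s (Γ.region d) v r := fun r hr => by
        have := Fintype.mem_piFinset.1 hx r
        rwa [if_neg hr, Finset.mem_singleton] at this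
      have hxd := hoff _ hd₂
      rw [Function.update_self] at hxd
      have hxo := hoff _ hd₃
      rw [Function.update_of_ne hopp] at hxo
      have hadm := admTriple_of_vertexWeight_ne_zero hA₀ hA₁ d
        (Finset.prod_ne_zero_iff.1 hx' _ (Finset.mem_univ _))
      rw [hxd, hxo] at hadm
      have hle := hN x (fun r hr => by
        rw [Finset.mem_insert, not_or] at hr
        rw [hoff r hr.2, Function.update_of_ne hr.1]) hx' (Γ.region d) (Finset.mem_insert_self _ _)
      rw [hxd] at hle
      exact ⟨mem_admStates.2 hadm.reverse, Finset.mem_Icc.2 ⟨hadm.nonneg.1, hle⟩⟩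
    simp only [left, right]
    refine Finset.sum_congr_of_eq_on_inter ?_ ?_ fun _ _ _ => rfl
    · intro v _ hv
      by_contra h'
      exact hv (supp v (right_ne_zero_of_mul h')).2
    · intro v _ hv
      by_contra h'
      exact hv (supp v (right_ne_zero_of_mul h')).1

end TrivalentMap

end

end SpinNetwork

namespace SpinNetwork

noncomputable section

namespace TrivalentMap

variable {V : Type*} {Γ : TrivalentMap V} {A : ℂ}

/-! ### The legs of a disc that contains a tree -/

/-- The edges and regions at the vertices in `S` are either interior to a disc with legs `w`, or meet its
boundary. -/
structure IsWord (Γ : TrivalentMap V) (r₀ : Γ.Region) (w : List (V × Fin 3)) (S : Finset V) :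
    Prop where
  path : Γ.IsPath r₀ w r₀
  nodup : w.Nodup
  fst_mem : ∀ d ∈ w, d.1 ∈ S
  opp_notMem : ∀ d, d.1 ∈ S → d ∉ w → (Γ.opp d).1 ∈ S ∧ Γ.opp d ∉ w
  region_mem : ∀ d, d.1 ∈ S → Γ.region d ∈ w.map Γ.region
  length : w.length = S.card + 2

theorem IsPath.region_opp_mem {r r' : Γ.Region} {w : List (V × Fin 3)} (h : Γ.IsPath r w r')
    {d : V × Fin 3} (hd : d ∈ w) : Γ.region (Γ.opp d) = r ∨ Γ.region (Γ.opp d) ∈ w.map Γ.region := by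
  induction w generalizing r with
  | nil => simp at hd
  | cons e w ih =>
    rcases List.mem_cons.1 hd with rfl | hd
    · exact .inl h.1
    · right
      rcases ih h.2 hd with h' | h'
      · rw [h']; exact List.mem_cons_self
      · exact List.mem_cons_of_mem _ h'

theorem isWord_vertex (d : V × Fin 3) :
    Γ.IsWord (Γ.region d) [Γ.rot d, Γ.rot (Γ.rot d), d] {d.1} := by
  have h1 := Γ.rot_ne d
  have h2 := Γ.rot_rot_ne d
  have h3 := Γ.rot_ne (Γ.rot d)
  have key : ∀ e : V × Fin 3, e.1 = d.1 → e ∈ [Γ.rot d, Γ.rot (Γ.rot d), d] := by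
    intro e he
    rcases Γ.eq_or_eq_of_fst_eq he with rfl | rfl | rfl <;> simp
  refine ⟨⟨region_opp_rot d, region_opp_rot _, (region_rot_rot Γ d).symm, rfl⟩, ?_, ?_, ?_, ?_, rfl⟩
  · simp [h1, h2, h3.symm]
  · intro e he
    simp only [List.mem_cons, List.not_mem_nil, or_false] at he
    rcases he with rfl | rfl | rfl <;> simp [rot_fst]
  · intro e he hw
    exact absurd (key e (Finset.mem_singleton.1 he)) hw
  · intro e he
    exact List.mem_map_of_mem (key e (Finset.mem_singleton.1 he))

open scoped Classical in
-- Both darts of the edge that joins the new vertex become interior, and the other two darts at that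
-- vertex become legs. The disc remains a neighborhood of a tree, hence the count of legs.
theorem IsWord.grow {r₀ : Γ.Region} {pre post : List (V × Fin 3)} {d : V × Fin 3} {S : Finset V}
    (h : Γ.IsWord r₀ (pre ++ d :: post) S) (hd : (Γ.opp d).1 ∉ S) :
    Γ.IsWord r₀ (pre ++ Γ.rot (Γ.opp d) :: Γ.rot (Γ.rot (Γ.opp d)) :: post)
      (insert (Γ.opp d).1 S) := by
  obtain ⟨m, hp1, hp2, hp3⟩ := isPath_append.1 h.path
  set e := Γ.opp d with he
  have hde : Γ.opp e = d := Γ.opp_opp d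
  have hdS : d.1 ∈ S := h.fst_mem d (by simp)
  have hpre : ∀ x ∈ pre, x.1 ∈ S := fun x hx => h.fst_mem x (by simp [hx])
  have hpost : ∀ x ∈ post, x.1 ∈ S := fun x hx => h.fst_mem x (by simp [hx])
  have hnd := h.nodup
  rw [List.nodup_append, List.nodup_cons] at hnd
  have hpath : Γ.IsPath r₀ (pre ++ Γ.rot e :: Γ.rot (Γ.rot e) :: post) r₀ := by
    refine isPath_append.2 ⟨m, hp1, ?_, ?_, ?_⟩
    · rw [region_opp_rot, ← hp2]
    · rw [region_opp_rot]
    · rw [region_rot_rot, hde]; exact hp3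
  have hmem : ∀ x, x.1 ∈ S → x ∈ pre ++ Γ.rot e :: Γ.rot (Γ.rot e) :: post →
      x ∈ pre ++ d :: post ∧ x ≠ d := by
    intro x hx hx'
    simp only [List.mem_append, List.mem_cons] at hx' ⊢
    rcases hx' with hx' | rfl | rfl | hx'
    · refine ⟨.inl hx', fun h' => hnd.2.2 x hx' d (by simp) h'⟩
    · exact absurd hx hd
    · exact absurd hx hd
    · refine ⟨.inr (.inr hx'), fun h' => hnd.2.1.1 (h' ▸ hx')⟩
  have hmem' : ∀ x, x ∈ pre ++ d :: post → x ≠ d →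
      x ∈ pre ++ Γ.rot e :: Γ.rot (Γ.rot e) :: post := by
    intro x hx hx'
    simp only [List.mem_append, List.mem_cons] at hx ⊢
    tauto
  have heS : e ∉ pre ++ Γ.rot e :: Γ.rot (Γ.rot e) :: post := by
    simp only [List.mem_append, List.mem_cons, not_or]
    exact ⟨fun h' => hd (hpre _ h'), (Γ.rot_ne e).symm, (Γ.rot_rot_ne e).symm,
      fun h' => hd (hpost _ h')⟩
  refine ⟨hpath, ?_, ?_, ?_, ?_, ?_⟩
  · rw [List.nodup_append, List.nodup_cons, List.nodup_cons]
    refine ⟨hnd.1, ⟨?_, fun h' => hd (hpost (Γ.rot (Γ.rot e)) h'), hnd.2.1.2⟩, ?_⟩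
    · rw [List.mem_cons, not_or]
      exact ⟨(Γ.rot_ne _).symm, fun h' => hd (hpost (Γ.rot e) h')⟩
    · intro x hx y hy hxy
      subst hxy
      simp only [List.mem_cons] at hy
      rcases hy with rfl | rfl | hy
      · exact hd (hpre (Γ.rot e) hx)
      · exact hd (hpre (Γ.rot (Γ.rot e)) hx)
      · exact hnd.2.2 x hx x (by simp [hy]) rfl
  · intro x hx
    simp only [List.mem_append, List.mem_cons] at hx
    rw [Finset.mem_insert]
    rcases hx with hx | rfl | rfl | hx
    · exact .inr (hpre x hx)
    · exact .inl rfl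
    · exact .inl rfl
    · exact .inr (hpost x hx)
  · intro x hx hxw
    rw [Finset.mem_insert] at hx ⊢
    by_cases hxd : x = d
    · rw [hxd, ← he]
      exact ⟨.inl rfl, heS⟩
    rcases hx with hx | hx
    · rcases Γ.eq_or_eq_of_fst_eq hx with rfl | rfl | rfl
      · rw [hde]
        exact ⟨.inr hdS, fun h' => (hmem d hdS h').2 rfl⟩
      · simp at hxw
      · simp at hxw
    · obtain ⟨h1, h2⟩ := h.opp_notMem x hx fun h' => hxw (hmem' x h' hxd)
      exact ⟨.inr h1, fun h' => h2 (hmem _ h1 h').1⟩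
  · intro x hx
    rcases Finset.mem_insert.1 hx with hx | hx
    · rcases Γ.eq_or_eq_of_fst_eq hx with rfl | rfl | rfl
      -- The region to the left of `e` is the one to the right of `rot e`. It is thus either `r₀`,
      -- which closes the cyclic word, or the region to the left of a leg.
      · rcases hpath.region_opp_mem (d := Γ.rot e) (by simp) with h' | h'
        · rw [region_opp_rot] at h'
          rw [h']
          rcases hpath.mem with h'' | h''
          · simp at h''
          · exact h''
        · rwa [region_opp_rot] at h'
      · exact List.mem_map_of_mem (by simp)
      · exact List.mem_map_of_mem (by simp)
    · obtain ⟨y, hy, hyx⟩ := List.mem_map.1 (h.region_mem x hx)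
      by_cases hyd : y = d
      · refine List.mem_map.2 ⟨Γ.rot (Γ.rot e), by simp, ?_⟩
        rw [region_rot_rot, hde, ← hyx, hyd]
      · exact List.mem_map.2 ⟨y, hmem' y hy hyd, hyx⟩
  · have := h.length
    rw [Finset.card_insert_of_notMem hd]
    simp only [List.length_append, List.length_cons] at this ⊢
    omega

theorem Connected.exists_opp_notMem (hΓ : Γ.Connected) {S : Set V} {v₀ v₁ : V} (h₀ : v₀ ∈ S)
    (h₁ : v₁ ∉ S) : ∃ d : V × Fin 3, d.1 ∈ S ∧ (Γ.opp d).1 ∉ S := by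
  by_contra! hS
  obtain ⟨g, hg, hgd⟩ := hΓ (v₀, 0) (v₁, 0)
  have key : ∀ g ∈ Subgroup.closure {Γ.rot, Γ.opp}, ∀ d : V × Fin 3, d.1 ∈ S ↔ (g d).1 ∈ S := by
    intro g hg
    induction hg using Subgroup.closure_induction with
    | mem g hg =>
      intro d
      rcases hg with rfl | rfl
      · rfl
      · refine ⟨hS d, fun h => ?_⟩
        have := hS _ h
        rwa [Γ.opp_opp] at this
    | one => exact fun d => Iff.rfl
    | mul g g' _ _ hg hg' =>
      intro d
      rw [Equiv.Perm.mul_apply, ← hg, ← hg']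
    | inv g _ hg =>
      intro d
      rw [hg (g⁻¹ d), ← Equiv.Perm.mul_apply, mul_inv_cancel, Equiv.Perm.one_apply]
  have := (key g hg (v₀, 0)).1 h₀
  rw [hgd] at this
  exact h₁ this

variable [Fintype V]

/-- A spanning tree is grown one vertex at a time; its disc neighborhood contains all vertices. The
word of legs is chosen independently of the coloring. -/
theorem exists_isWord_univ (hA₀ : A ≠ 0) (hA₁ : ‖A‖ < 1) (hΓ : Γ.Connected) (r₀ : Γ.Region) :
    ∃ w, Γ.IsWord r₀ w Finset.univ ∧ ∀ c, ∃ F, Γ.IsDisc A c r₀ w Finset.univ F := by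
  classical
  obtain ⟨d₀, rfl⟩ := Γ.exists_region_eq r₀
  have key : ∀ n : ℕ, n + 1 ≤ Fintype.card V → ∃ S w, S.card = n + 1 ∧
      Γ.IsWord (Γ.region d₀) w S ∧ ∀ c, ∃ F, Γ.IsDisc A c (Γ.region d₀) w S F := by
    intro n
    induction n with
    | zero =>
      exact fun _ => ⟨{d₀.1}, _, Finset.card_singleton _, isWord_vertex d₀,
        fun c => exists_isDisc_vertex hA₀ hA₁ c d₀⟩
    | succ n ih =>
      intro hn
      obtain ⟨S, w, hS, hw, hF⟩ := ih (by omega)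
      obtain ⟨v₀, h₀⟩ : S.Nonempty := Finset.card_pos.1 (by omega)
      obtain ⟨v₁, h₁⟩ : ∃ v₁, v₁ ∉ S := by
        by_contra! h
        rw [Finset.eq_univ_iff_forall.2 h, Finset.card_univ] at hS
        omega
      obtain ⟨d, hd, hd'⟩ := hΓ.exists_opp_notMem (S := S) h₀ h₁
      have hdw : d ∈ w := by
        by_contra h
        exact hd' (hw.opp_notMem d hd h).1
      obtain ⟨pre, post, rfl⟩ := List.append_of_mem hdw
      refine ⟨_, _, ?_, hw.grow hd', fun c => ?_⟩
      · rw [Finset.card_insert_of_notMem hd', hS]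
      · obtain ⟨F, hF⟩ := hF c
        exact hF.grow hA₀ hA₁ hw.path hd'
  have hV : 0 < Fintype.card V := Fintype.card_pos_iff.2 ⟨d₀.1⟩
  obtain ⟨S, w, hS, hw, hF⟩ := key (Fintype.card V - 1) (by omega)
  obtain rfl : S = Finset.univ := by rw [← Finset.card_eq_iff_eq_univ]; omega
  exact ⟨w, hw, hF⟩

theorem two_mul_card_edge (Γ : TrivalentMap V) : 2 * Nat.card Γ.Edge = 3 * Nat.card V := by
  classical
  have : Finite Γ.Edge := inferInstanceAs (Finite (Quotient _))
  have : Fintype Γ.Edge := Fintype.ofFinite _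
  have h := Finset.card_eq_sum_card_fiberwise (f := Γ.edge) (s := Finset.univ)
    (t := Finset.univ) fun _ _ => Finset.mem_coe.2 (Finset.mem_univ _)
  have hfib : ∀ e ∈ (Finset.univ : Finset Γ.Edge),
      ({d ∈ Finset.univ | Γ.edge d = e} : Finset (V × Fin 3)).card = 2 := by
    intro e _
    obtain ⟨d, rfl⟩ : ∃ d, Γ.edge d = e := Quotient.exists_rep e
    have : ({d' ∈ Finset.univ | Γ.edge d' = Γ.edge d} : Finset (V × Fin 3)) = {d, Γ.opp d} := by
      ext d'
      simp only [Finset.mem_filter, Finset.mem_univ, true_and, Finset.mem_insert,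
        Finset.mem_singleton]
      rw [eq_comm, edge_eq_iff]
    rw [this, Finset.card_pair (Γ.opp_ne d).symm]
  rw [Finset.sum_congr rfl hfib, Finset.sum_const, Finset.card_univ, Finset.card_univ,
    Fintype.card_prod, Fintype.card_fin, smul_eq_mul] at h
  rw [Nat.card_eq_fintype_card, Nat.card_eq_fintype_card]
  omega

end TrivalentMap

end

end SpinNetwork

namespace SpinNetwork

noncomputable section

namespace TrivalentMap

variable {V : Type*} {Γ : TrivalentMap V} {A : ℂ}

/-! ### Independence of the region of state `0` -/

open scoped Classical in
-- A count: with `n` legs there are `n/2` regions other than `r₀`. If each of them occurred twice,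
-- then together with `r₀` there would be at least `n + 1` legs.
theorem exists_unique_leg {r₀ : Γ.Region} {w : List (V × Fin 3)} (hw : w ≠ [])
    (hp : Γ.IsPath r₀ w r₀) (hn : w.Nodup)
    (hcard : w.length + 2 = 2 * (w.map Γ.region).toFinset.card) :
    ∃ d ∈ w, Γ.region d ≠ r₀ ∧ ∀ e ∈ w, Γ.region e = Γ.region d → e = d := by
  by_contra! h
  have hr₀ : r₀ ∈ (w.map Γ.region).toFinset := by
    rw [List.mem_toFinset]
    rcases hp.mem with ⟨-, h'⟩ | h'
    · exact absurd h' hw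
    · exact h'
  have hmaps : ∀ d ∈ w.toFinset, Γ.region d ∈ (w.map Γ.region).toFinset := fun d hd =>
    List.mem_toFinset.2 (List.mem_map_of_mem (List.mem_toFinset.1 hd))
  have h1 := Finset.card_eq_sum_card_fiberwise (f := Γ.region) (s := w.toFinset)
    (t := (w.map Γ.region).toFinset) hmaps
  rw [← Finset.add_sum_erase _ _ hr₀, List.toFinset_card_of_nodup hn] at h1
  have h2 : 1 ≤ ({d ∈ w.toFinset | Γ.region d = r₀} : Finset _).card := by
    obtain ⟨d, hd, hd'⟩ := List.mem_map.1 (List.mem_toFinset.1 hr₀)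
    exact Finset.card_pos.2 ⟨d, Finset.mem_filter.2 ⟨List.mem_toFinset.2 hd, hd'⟩⟩
  have h3 : ∀ r ∈ (w.map Γ.region).toFinset.erase r₀,
      2 ≤ ({d ∈ w.toFinset | Γ.region d = r} : Finset _).card := by
    intro r hr
    rw [Finset.mem_erase, List.mem_toFinset, List.mem_map] at hr
    obtain ⟨hne, d, hd, rfl⟩ := hr
    obtain ⟨e, he, her, hed⟩ := h d hd hne
    exact Finset.one_lt_card.2 ⟨e, by simp [he, her], d, by simp [hd], hed⟩
  have h4 := Finset.card_nsmul_le_sum _ _ _ h3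
  rw [Finset.card_erase_of_mem hr₀, smul_eq_mul] at h4
  omega

variable [Fintype V]

open scoped Classical in
-- A region other than `r₀` that occurs once lies between a leg and its own reverse, which can be
-- glued. This removes two legs and one region, so the numerical condition is preserved and the
-- process ends with one edge uncut.
theorem exists_isFullDisc_pair (hA₀ : A ≠ 0) (hA₁ : ‖A‖ < 1) {r₀ : Γ.Region} (n : ℕ) :
    ∀ (w : List (V × Fin 3)) (C : Finset Γ.Region), w.length = n → w ≠ [] → Γ.IsPath r₀ w r₀ →
    w.Nodup → (∀ d ∈ w, Γ.opp d ∈ w) → w.length + 2 = 2 * (w.map Γ.region).toFinset.card →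
    (∀ r, r ∈ C ↔ r ∉ w.map Γ.region) → (∀ c, ∃ F, Γ.IsFullDisc A c r₀ w C F) →
    ∃ d C, Γ.region (Γ.opp d) = r₀ ∧ Γ.region d ≠ r₀ ∧
      (∀ r, r ∈ C ↔ r ≠ r₀ ∧ r ≠ Γ.region d) ∧
      ∀ c, ∃ F, Γ.IsFullDisc A c r₀ [d, Γ.opp d] C F := by
  induction n using Nat.strong_induction_on with
  | _ n ih =>
  intro w C hlen hw hp hn hopp hcard hC hF
  obtain ⟨d, hd, hd₀, huniq⟩ := exists_unique_leg hw hp hn hcard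
  obtain ⟨pre, tail, rfl⟩ := List.append_of_mem hd
  obtain ⟨m, hp1, hp2, hp3⟩ := isPath_append.1 hp
  cases tail with
  | nil => exact absurd hp3 hd₀
  | cons d' post =>
  obtain ⟨hp3, hp4⟩ := hp3
  -- The reverse of the next leg is also a leg and has the same region to its left, so by uniqueness
  -- it is `d`.
  obtain rfl : d' = Γ.opp d := by
    rw [← huniq _ (hopp d' (by simp)) hp3, Γ.opp_opp]
  subst hp2
  rw [Γ.opp_opp] at hp3
  have hnd := hn
  simp only [List.nodup_append, List.nodup_cons, List.mem_cons, not_or] at hnd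
  obtain ⟨hn1, ⟨⟨-, hn2⟩, hn3, hn4⟩, hn5⟩ := hnd
  have hρ : Γ.region d ∉ (pre ++ Γ.opp d :: post).map Γ.region := by
    intro h
    obtain ⟨e, he, hed⟩ := List.mem_map.1 h
    simp only [List.mem_append, List.mem_cons] at he
    have := huniq e (by simp only [List.mem_append, List.mem_cons]; tauto) hed
    subst this
    rcases he with he | he | he
    · exact hn5 e he e (.inl rfl) rfl
    · exact Γ.opp_ne e he.symm
    · exact hn2 he
  have hr₀ : pre ++ post ≠ [] → Γ.region (Γ.opp d) ∈ (pre ++ post).map Γ.region := by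
    intro hne
    rw [List.map_append, List.mem_append]
    rcases hp1.mem with ⟨h1, rfl⟩ | h1
    · rcases hp4.mem with ⟨-, h2⟩ | h2
      · exact absurd h2 (by simpa using hne)
      · exact .inr (h1 ▸ h2)
    · exact .inl h1
  by_cases hne : pre ++ post = []
  · obtain ⟨rfl, rfl⟩ := List.append_eq_nil_iff.1 hne
    refine ⟨d, C, hp1.symm, hd₀, fun r => ?_, hF⟩
    have h : Γ.region (Γ.opp d) = r₀ := hp1.symm
    simp only [hC, List.nil_append, List.map_cons, List.map_nil, List.mem_cons, List.not_mem_nil,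
      or_false, h]
    tauto
  have hmap : ∀ r, r ∈ (pre ++ post).map Γ.region ↔
      r ∈ (pre ++ d :: Γ.opp d :: post).map Γ.region ∧ r ≠ Γ.region d := by
    intro r
    have h0 := hr₀ hne
    constructor
    · intro h
      refine ⟨?_, ?_⟩
      · simp only [List.map_append, List.map_cons, List.mem_append, List.mem_cons] at h ⊢
        tauto
      · rintro rfl
        refine hρ ?_
        simp only [List.map_append, List.map_cons, List.mem_append, List.mem_cons] at h ⊢
        tauto
    · rintro ⟨h, h'⟩
      simp only [List.map_append, List.map_cons, List.mem_append, List.mem_cons] at h h0 ⊢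
      rcases h with h | h | h | h
      · exact .inl h
      · exact absurd h h'
      · rw [h]; exact h0
      · exact .inr h
  have hd₂ : Γ.region d ∉ C := by simp [hC]
  have hd₃ : Γ.region (Γ.opp d) ∉ C := by simp [hC]
  refine ih (pre ++ post).length ?_ (pre ++ post) (insert (Γ.region d) C) rfl hne ?_ ?_ ?_ ?_ ?_ ?_
  · rw [← hlen]; simp
  · exact isPath_append.2 ⟨_, hp1, hp4⟩
  · rw [List.nodup_append]
    exact ⟨hn1, hn4, fun x hx y hy => hn5 x hx y (.inr (.inr hy))⟩
  · intro x hx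
    have h1 := hopp x (by simp only [List.mem_append, List.mem_cons] at hx ⊢; tauto)
    simp only [List.mem_append, List.mem_cons] at h1 hx ⊢
    rcases h1 with h1 | h1 | h1 | h1
    · exact .inl h1
    · have h2 : x = Γ.opp d := by rw [← h1, Γ.opp_opp]
      rcases hx with hx | hx
      · exact absurd h2 (hn5 x hx _ (.inr (.inl rfl)))
      · exact absurd (h2 ▸ hx) hn3
    · have h2 := Γ.opp.injective h1
      rcases hx with hx | hx
      · exact absurd h2 (hn5 x hx _ (.inl rfl))
      · exact absurd (h2 ▸ hx) hn2
    · exact .inr h1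
  · have : ((pre ++ post).map Γ.region).toFinset =
        ((pre ++ d :: Γ.opp d :: post).map Γ.region).toFinset.erase (Γ.region d) := by
      ext r
      rw [Finset.mem_erase, List.mem_toFinset, List.mem_toFinset, hmap, and_comm]
    rw [this, Finset.card_erase_of_mem (List.mem_toFinset.2 (List.mem_map_of_mem hd))]
    simp only [List.length_append, List.length_cons] at hcard ⊢
    omega
  · intro r
    rw [hmap, Finset.mem_insert, hC]
    tauto
  · intro c
    obtain ⟨F, hF⟩ := hF c
    exact hF.close hA₀ hA₁ hp hd₀ hρ hd₂ hd₃

open scoped Classical in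
-- The regions `i`, `j` are the two sides of the last uncut edge. State `0` on `i` forces the state
-- of `j` to be the color of that edge, and the remaining sum is a value of the disc. The statement
-- is symmetric enough to be used for both orders of the two regions.
theorem bracket_of_isFullDisc (hA₀ : A ≠ 0) (hA₁ : ‖A‖ < 1) (hΓ : Γ.Connected) {c : Γ.Edge → ℤ}
    {d : V × Fin 3} {r₀ : Γ.Region} {C : Finset Γ.Region} {F : List ℤ → ℂ}
    (hF : Γ.IsFullDisc A c r₀ [d, Γ.opp d] C F) (hd : Γ.region (Γ.opp d) = r₀)
    {i j : Γ.Region} (hij : i ≠ j) (hC : ∀ r, r ∈ C ↔ r ≠ i ∧ r ≠ j)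
    (hadj : ∀ s, Γ.IsShadowState c i s → s j = c (Γ.edge d)) (hc : 0 ≤ c (Γ.edge d))
    (s : Γ.Region → ℤ) (hi : s i = 0) (hj : s j = c (Γ.edge d)) :
    Γ.bracket A i c = regionWeight A 0 * regionWeight A (c (Γ.edge d)) *
      F [s r₀, s (Γ.region d), s r₀] := by
  obtain ⟨N, hN⟩ := exists_bound hΓ c i
  have hcN : c (Γ.edge d) ≤ max N (c (Γ.edge d)) := le_max_right _ _
  have hN' : ∀ s, Γ.IsShadowState c i s → ∀ r, s r ≤ max N (c (Γ.edge d)) := fun s hs r =>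
    (hN s hs r).trans (le_max_left _ _)
  generalize max N (c (Γ.edge d)) = M at hcN hN'
  have hC0 : ∀ r, r ∉ C → r = i ∨ r = j := fun r hr => by
    rw [hC] at hr; tauto
  have hF' := hF.eval s M fun x hx hx' r _ => hN' x (isShadowState_of_vertexWeight hA₀ hA₁
    ((hx i (by simp [hC])).trans hi) hx') r
  rw [List.map_cons, List.map_cons, List.map_nil, hd] at hF'
  rw [bracket_eq_sum hA₀ hA₁ hN', hF', sum_piFinset_eq_sum_update _ j,
    Function.update_of_ne hij.symm, Finset.sum_eq_single_of_mem (c (Γ.edge d))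
      (Finset.mem_Icc.2 ⟨hc, hcN⟩)]
  · have hbox : Function.update (Function.update (fun _ => Finset.Icc 0 M) i {0}) j
        {c (Γ.edge d)} = fun r => if r ∈ C then Finset.Icc 0 M else {s r} := by
      funext r
      rcases eq_or_ne r j with rfl | hrj
      · simp [hC, hj]
      · rcases eq_or_ne r i with rfl | hri
        · simp [hC, hi, hrj]
        · simp [hC, hri, hrj]
    rw [hbox, Finset.mul_sum]
    refine Finset.sum_congr rfl fun x hx => ?_
    have hx' : ∀ r ∉ C, x r = s r := fun r hr => by
      have := Fintype.mem_piFinset.1 hx r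
      rwa [if_neg hr, Finset.mem_singleton] at this
    have huniv : (Finset.univ : Finset Γ.Region) = insert i (insert j C) := by
      ext r
      simp only [Finset.mem_univ, Finset.mem_insert, hC, true_iff]
      tauto
    rw [weight_eq, huniv, Finset.prod_insert (by simp [hC, hij]), Finset.prod_insert (by simp [hC]),
      hx' i (by simp [hC]), hx' j (by simp [hC]), hi, hj]
    ring
  · intro v _ hv
    refine Finset.sum_eq_zero fun x hx => ?_
    by_contra h
    have hx := Fintype.mem_piFinset.1 hx
    have hxi := hx i
    have hxj := hx j
    rw [Function.update_of_ne hij, Function.update_self, Finset.mem_singleton] at hxi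
    rw [Function.update_self, Finset.mem_singleton] at hxj
    exact hv (hxj ▸ hadj x (isShadowState_of_vertexWeight hA₀ hA₁ hxi (right_ne_zero_of_mul h)))

/-- The bracket may be computed with another region of state `0`. -/
theorem exists_bracket_eq (hA₀ : A ≠ 0) (hA₁ : ‖A‖ < 1) (hΓ : Γ.Planar) (r₀ : Γ.Region) :
    ∃ r₁ ≠ r₀, ∀ c, Γ.bracket A r₀ c = Γ.bracket A r₁ c := by
  classical
  obtain ⟨w, hw, hF⟩ := exists_isWord_univ hA₀ hA₁ hΓ.connected r₀
  have hregion : ∀ r, r ∈ w.map Γ.region := by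
    intro r
    obtain ⟨d, rfl⟩ := Γ.exists_region_eq r
    exact hw.region_mem d (Finset.mem_univ _)
  -- Planarity enters here. With `2E = 3V`, Euler's formula gives `2R = V + 4`, while the word has
  -- `V + 2` legs.
  have hcard : w.length + 2 = 2 * (w.map Γ.region).toFinset.card := by
    have h1 : (w.map Γ.region).toFinset = Finset.univ := by
      ext r; simpa using List.mem_map.1 (hregion r)
    have h2 := hΓ.euler
    have h3 := Γ.two_mul_card_edge
    have h4 := hw.length
    rw [Finset.card_univ] at h4
    rw [h1, Finset.card_univ]
    rw [Nat.card_eq_fintype_card (α := V)] at h2 h3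
    rw [Nat.card_eq_fintype_card (α := Γ.Region)] at h2
    omega
  obtain ⟨d, C, hd, hd₀, hC, hF⟩ := exists_isFullDisc_pair hA₀ hA₁ w.length w ∅ rfl
    (by rintro rfl; simp at hcard) hw.path hw.nodup
    (fun d hd => by
      by_contra h
      have := (hw.opp_notMem _ (Finset.mem_univ _) h).2
      rw [Γ.opp_opp] at this
      exact this hd) hcard (fun r => by simpa using List.mem_map.1 (hregion r))
    fun c => (hF c).imp fun F h => h.isFullDisc
  refine ⟨Γ.region d, hd₀, fun c => ?_⟩
  obtain ⟨F, hF⟩ := hF c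
  -- The coloring is arbitrary here; if this color is negative there are no shadow-states, and both
  -- brackets vanish.
  by_cases hc : 0 ≤ c (Γ.edge d)
  · have h0 := bracket_of_isFullDisc hA₀ hA₁ hΓ.connected hF hd hd₀.symm hC
      (fun s hs => by
        have := hs.2 d
        rw [hd, hs.1] at this
        exact admTriple_zero this) hc
      (fun r => if r = r₀ then 0 else c (Γ.edge d)) (by simp) (by simp [hd₀])
    have h1 := bracket_of_isFullDisc hA₀ hA₁ hΓ.connected hF hd hd₀
      (fun r => (hC r).trans and_comm)
      (fun s hs => by
        have := hs.2 d
        rw [hd, hs.1] at this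
        exact admTriple_zero this.swap) hc
      (fun r => if r = r₀ then c (Γ.edge d) else 0) (by simp [hd₀]) (by simp)
    simp only [if_true, if_neg hd₀] at h0 h1
    rw [h0, h1]
    have h2 := hF.intertwines
    simp only [List.map_cons, List.map_nil, edge_opp] at h2
    rw [h2.eq_of_pair hA₀ hA₁ hF.last hc]
  · have key : ∀ r, Γ.bracket A r c = 0 := by
      intro r
      have : {s : Γ.Region → ℤ | Γ.IsShadowState c r s} = ∅ :=
        Set.eq_empty_of_forall_notMem fun s hs => hc (hs.2 d).nonneg.2.2
      rw [bracket, this, finsum_mem_empty]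
    rw [key, key]

end TrivalentMap

end

end SpinNetwork

theorem mainTheorem5 (A : ℂ) (hA₀ : A ≠ 0) (hA₁ : ‖A‖ < 1) :
    -- the three-term recursion for a triangular face, with edges `e_0`, `e_1`, `e_2`
    (∀ (V : Type*) [Fintype V] (Γ : SpinNetwork.TrivalentMap V), Γ.Planar →
      ∀ (r₀ : Γ.Region) (x : V × Fin 3), Γ.faceLength x = 3 →
      ∀ c : Γ.Edge → ℤ, Γ.Admissible c →
        (∀ ε ∈ ({1, -1} : Finset ℤ), Γ.zCoeff A x (c + Γ.deltaPert x ε) (-1) (-1) ≠ 0) ∧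
        ∑ ε ∈ ({1, -1} : Finset ℤ),
            Γ.kCoeff A x c (Γ.deltaPert x ε) *
                Γ.kCoeff A x (c + Γ.deltaPert x ε) (-Γ.deltaPert x (-ε)) /
              Γ.zCoeff A x (c + Γ.deltaPert x ε) (-1) (-1) *
              Γ.bracket A r₀ (c + (2 * ε) • Γ.halfAt (Γ.side x 1)) =
          (Γ.zCoeff A x c 1 1 -
            ∑ ε ∈ ({1, -1} : Finset ℤ),
              Γ.kCoeff A x c (Γ.deltaPert x ε) *
                  Γ.kCoeff A x (c + Γ.deltaPert x ε) (-Γ.deltaPert x ε) /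
                Γ.zCoeff A x (c + Γ.deltaPert x ε) (-1) (-1)) *
            Γ.bracket A r₀ c) ∧
    -- the bracket of the tetrahedron is the quantum `6j`-symbol
    (∀ (r₀ : SpinNetwork.tetrahedron.Region) (c : SpinNetwork.tetrahedron.Edge → ℤ),
      SpinNetwork.tetrahedron.Admissible c →
        SpinNetwork.tetrahedron.bracket A r₀ c =
          SpinNetwork.tet A
            (c (SpinNetwork.tetrahedron.edge (0, 0))) (c (SpinNetwork.tetrahedron.edge (0, 1)))
            (c (SpinNetwork.tetrahedron.edge (0, 2))) (c (SpinNetwork.tetrahedron.edge (2, 2)))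
            (c (SpinNetwork.tetrahedron.edge (1, 1))) (c (SpinNetwork.tetrahedron.edge (1, 2)))) ∧
    -- the resulting recursion for quantum `6j`-symbols, in the color `a₁` of one edge
    (∀ a₀ a₁ a₂ b₀ b₁ b₂ : ℤ,
      SpinNetwork.AdmTriple a₀ a₁ b₀ → SpinNetwork.AdmTriple a₁ a₂ b₁ →
      SpinNetwork.AdmTriple a₂ a₀ b₂ → SpinNetwork.AdmTriple b₀ b₁ b₂ →
        SpinNetwork.tetZ A b₂ (a₀ + 1) (a₂ + 1) (-1) ≠ 0 ∧
        ∑ ε ∈ ({1, -1} : Finset ℤ),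
            SpinNetwork.tetK A b₀ b₁ a₀ a₁ a₂ 1 ε *
                SpinNetwork.tetK A b₀ b₁ (a₀ + 1) (a₁ + ε) (a₂ + 1) (-1) ε /
              SpinNetwork.tetZ A b₂ (a₀ + 1) (a₂ + 1) (-1) *
              SpinNetwork.tet A a₀ (a₁ + 2 * ε) b₀ b₁ b₂ a₂ =
          (SpinNetwork.tetZ A b₂ a₀ a₂ 1 -
            ∑ ε ∈ ({1, -1} : Finset ℤ),
              SpinNetwork.tetK A b₀ b₁ a₀ a₁ a₂ 1 ε *
                  SpinNetwork.tetK A b₀ b₁ (a₀ + 1) (a₁ + ε) (a₂ + 1) (-1) (-ε) /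
                SpinNetwork.tetZ A b₂ (a₀ + 1) (a₂ + 1) (-1)) *
            SpinNetwork.tet A a₀ a₁ b₀ b₁ b₂ a₂) := by
  refine ⟨?_, fun r₀ c hc => SpinNetwork.tetrahedron_bracket hA₀ hA₁ r₀ hc, ?_⟩
  · intro V _ Γ hΓ r₀ x hx c hc
    by_cases hr₀ : r₀ = Γ.region x
    -- The coefficients do not involve `r₀`, so it is enough to exchange it for a region off the
    -- face. The exchange has to hold for all colorings, as those with a shifted color on `e_1` need
    -- not be admissible.
    · obtain ⟨r₁, hr₁, h⟩ := SpinNetwork.TrivalentMap.exists_bracket_eq hA₀ hA₁ hΓ r₀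
      simp only [h]
      exact SpinNetwork.TrivalentMap.three_term_of_ne hA₀ hA₁ hΓ.connected hx (hr₀ ▸ hr₁) hc
    · exact SpinNetwork.TrivalentMap.three_term_of_ne hA₀ hA₁ hΓ.connected hx hr₀ hc
  · intro a₀ a₁ a₂ b₀ b₁ b₂ _ _ h hb
    -- The triple `(b₀, b₁, b₂)` enters only through its parity, and the only other condition needed
    -- is that at the corner `e_2 ∩ e_0`.
    exact ⟨SpinNetwork.tetZ_ne_zero hA₀ hA₁ h,
      (SpinNetwork.circleRelation_tet hA₀ hA₁ b₀ b₁ b₂).three_term hA₀ hA₁ hb.2.2.2 h⟩
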